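/- **Setting.** Let $\mathsf a_1=(1,0)$, $\mathsf a_2=(\tfrac12,\tfrac{\sqrt3}2)$, $\mathbb L^\#=\mathbb Z\mathsf a_1+\mathbb Z\mathsf a_2$, $\mathbb L_*=\mathbb L^\#\setminus\{0\}$. Let $N\ge1$, $\Omega=\{s\mathsf a_1+t\mathsf a_2: s,t\in(0,N]\}$, $\mathbb L=\mathbb L^\#\cap\Omega$; write $A^\#=A+N\mathbb L^\#$. The micro-triangulation is the triangulation of $\mathbb R^2$ whose edges are the nearest-neighbour bonds of $\mathbb L^\#$; $\mathcal T_{\rm a}$ is the set of its (closed) triangles contained in $\overline\Omega$. Let the atomistic region $\Omega_{\rm a}\subset{\rm int}(\Omega)$ be a (possibly empty) union of micro-triangles, let the vacancy set satisfy $\mathbb V\subset\mathbb L\cap{\rm int}(\Omega_{\rm a})$, and put $\mathcal L=\mathbb L\setminus\mathbb V$, $\Omega_{\rm c}=\overline{\Omega\setminus\Omega_{\rm a}}\cap\Omega$. Let $\mathcal T_h^{\rm c}$ be a triangulation of $\overline{\Omega_{\rm c}}$ with vertices in $\mathbb L^\#$, whose $N$-periodic extension is regular (two triangles meet in a common face or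 not at all), and such that each of its edges contained in $\partial\Omega_{\rm a}$ has length $1$. Let $\mathcal T_h$ be $\mathcal T_h^{\rm c}$ together with the micro-triangles contained in $\Omega_{\rm a}$. Its shape regularity is the ratio between its largest and smallest angle; $h_T={\rm diam}\,T$. **Energies.** Let $\varphi\in C^2(0,\infty)$, $\phi(r)=\varphi(|r|)$, $M_k(s)=\sup_{|r|\ge s}\|\phi^{(k)}(r)\|$, and assume $\sum_{r\in\mathbb L_*}M_k(s|r|)|r|^k<\infty$ for all $s>0$, $k=0,1,2$. Let $\mathcal B=\{(x,x')\in\mathcal L\times\mathcal L^\#: x\ne x'\}$, $\mathcal B_{\rm c}$ the set of those $b\in\mathcal B$ whose segment lies in ${\rm int}(\Omega_{\rm c}^\#)$, and $\mathcal B_{\rm a}=\mathcal B\setminus\mathcal B_{\rm c}$. For $b=(x,x+r_b)$ let $D_by=y(x+r_b)-y(x)$, let $\nabla_ry(x)=\lim_{t\searrow0}(y(x+tr)-y(x))/t$, and set $$\mathscr E_{\rm a}(y)=\sum_{b\in\mathcal B}\phi(D_by),\qquad \mathscr E_{\rm ac}(y_h)=\sum_{b\in\mathcal B_{\rm a}}\phi(D_by_h)+\sum_{b=(x,x+r)\in\mathcal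 B_{\rm c}}\int_0^1\phi\big(\nabla_{r}y_h(x+tr)\big)\,dt .$$ **Deformations.** Let $\mathsf B\in\mathbb R^{2\times2}$, $\det\mathsf B>0$, and let $y:\mathcal L^\#\to\mathbb R^2$ satisfy $y(x+z)=y(x)+\mathsf Bz$ for $z\in N\mathbb L^\#$ and $\mu_{\rm a}(y):=\inf_{x\ne x'\in\mathcal L^\#}|y(x)-y(x')|/|x-x'|>0$. Let $I_hy$ and $\bar y$ be the continuous piecewise affine interpolants of $y$ with respect to $\mathcal T_h^\#$ and to the micro-triangulation, and let $\mu_{\rm c}(v)=\inf_{x\ne x'\in\Omega_{\rm c}}|v(x)-v(x')|/|x-x'|$. (The values of the interpolants that are used do not depend on $y$ at vacancies.) Assume $$\mu:=\min\{\mu_{\rm a}(y),\ \mu_{\rm a}(I_hy),\ \mu_{\rm c}(I_hy),\ \mu_{\rm c}(\bar y)\}>0 .$$ Let $\Pi_2(y)$ be the set of all continuous $\tilde y:\mathbb R^2\to\mathbb R^2$ with weak first and second derivatives in $L^\infty(\mathbb R^2)$ such that $\tilde y=y$ on $\mathcal L^\#$ and $\tilde y(x+z)=\tilde y(x)+\mathsf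 Bz$ for all $x\in\mathbb R^2$, $z\in N\mathbb L^\#$. **Norms.** Let $\mathscr U_h$ be the space of $N$-periodic continuous functions $u_h:\mathbb R^2\to\mathbb R^2$ that are affine on every $T\in\mathcal T_h^\#$ and whose values at the vacancy sites minimise $\sum_{x\in\mathbb L}\sum_{r\in\mathbb L_*,|r|=1}|r\cdot(v(x+r)-v(x))|^2$ among all $N$-periodic $v:\mathbb L^\#\to\mathbb R^2$ with $v=u_h$ on $\mathcal L^\#$. For $p\in[1,\infty]$, $1/p+1/p'=1$, let $\|\Psi\|_{W^{-1,p}_h}=\sup\{\langle\Psi,u_h\rangle: u_h\in\mathscr U_h,\ \|\nabla u_h\|_{L^{p'}(\Omega)}=1\}$. Norms of gradients and second derivatives are pointwise Euclidean (Frobenius) norms. For a micro-triangle $\tau$ and $r\in\mathbb L_*$ let $$\omega_{\tau,r}={\rm conv}\Big(\bigcup\{b\in\mathcal B_{\rm c}^\#: r_b=r,\ {\rm length}(b\cap\tau)>0\}\Big),$$ where $\mathcal B_{\rm c}^\#$ is the set of all translates of bonds in $\mathcal B_{\rm c}$ by vectors in $N\mathbb L^\#$. If $\omega_{\tau,r}$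 has measure zero (it is then empty or a segment), $\|\cdot\|_{L^\infty(\omega_{\tau,r})}$ denotes the infimum of $\|\cdot\|_{L^\infty(U)}$ over open $U\supset\omega_{\tau,r}$. **Theorem.** For every $\kappa$ there is a constant $C_1$, depending only on $\kappa$, such that, in the above setting with the shape regularity of $\mathcal T_h$ at most $\kappa$ and for every $p\in[1,\infty]$: $\mathscr E_{\rm ac}$ and $\mathscr E_{\rm a}$ are differentiable at $I_hy$ and $y$, respectively, in every direction $u_h\in\mathscr U_h$, and for all $\tilde y\in\Pi_2(y)$ $$\big\|\delta\mathscr E_{\rm ac}(I_hy)-\delta\mathscr E_{\rm a}(y)\big\|_{W^{-1,p}_h}\le C^{\rm coarse}\Big(\sum_{T\in\mathcal T_h}|T|\big(h_T\|\nabla^2\tilde y\|_{L^\infty(T)}\big)^p\Big)^{1/p}+C^{\rm model}\Big(\sum_{\substack{\tau\in\mathcal T_{\rm a}\\ \tau\subset\overline{\Omega_{\rm c}}}}\sum_{r\in\mathbb L_*}K_{|r|}\|\nabla^2\tilde y\|_{L^\infty(\omega_{\tau,r})}^p\Big)^{1/p},$$ where $C^{\rm coarse}=C_1\sum_{r\in\mathbb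 L_*}M_2(\mu|r|)|r|^2$, $K_{|r|}=M_2(\mu|r|)|r|^3$, and $C^{\rm model}=(5/2)^{1/p}\big(\sum_{r\in\mathbb L_*}K_{|r|}\big)^{1/p'}$. For $p=\infty$ the two brackets are read as suprema (over indices with non-zero weight). -/

import Mathlib

open MeasureTheory Set
open scoped ENNReal NNReal Pointwise

namespace ACVacancy

noncomputable section

/-- The Euclidean plane. -/
abbrev E2 : Type := EuclideanSpace ℝ (Fin 2)

/-! ### The triangular lattice -/

/-- First lattice vector. -/
def a1 : E2 := !₂[1, 0]

/-- Second lattice vector. -/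
def a2 : E2 := !₂[1 / 2, Real.sqrt 3 / 2]

/-- The infinite triangular lattice. -/
def Lat : Set E2 := {x | ∃ i j : ℤ, x = (i : ℝ) • a1 + (j : ℝ) • a2}

/-- All lattice directions. -/
def Lstar : Set E2 := Lat \ {0}

/-- The nearest-neighbour directions (the six lattice vectors of length one). -/
def Lnn : Set E2 := {r | r ∈ Lat ∧ ‖r‖ = 1}

/-- The lattice of periods, `N` times the triangular lattice. -/
def perLat (N : ℕ) : Set E2 :=
  {z | ∃ i j : ℤ, z = ((i : ℝ) * N) • a1 + ((j : ℝ) * N) • a2}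

/-- The half-open periodic cell, the image of `(0, N]²` under the lattice matrix. -/
def cell (N : ℕ) : Set E2 :=
  {x | ∃ s ∈ Ioc (0 : ℝ) N, ∃ t ∈ Ioc (0 : ℝ) N, x = s • a1 + t • a2}

/-! ### Triangles, given by their sets of vertices -/

/-- The closed triangle with vertex set `s`. -/
def tri (s : Finset E2) : Set E2 := convexHull ℝ (s : Set E2)

/-- Translation of a vertex set. -/
def shift (z : E2) (s : Finset E2) : Finset E2 := s.map (addRightEmbedding z)

/-- The triangles of the canonical triangulation of the lattice, whose edges are the
nearest-neighbour bonds. -/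
def micro : Set (Finset E2) :=
  {s | ∃ x ∈ Lat, (s : Set E2) = {x, x + a1, x + a2} ∨
    (s : Set E2) = {x + a1, x + a2, x + a1 + a2}}

/-- The micro-triangles of one periodic cell. -/
def Ta (N : ℕ) : Set (Finset E2) := {s | s ∈ micro ∧ tri s ⊆ closure (cell N)}

/-- The continuous piecewise affine interpolant, with respect to a triangulation `𝒯`, of the
values of `w` at the vertices: at a point with barycentric coordinates `c` in a triangle of `𝒯`
the value is the corresponding combination of the vertex values. In a regular triangulation this
does not depend on the triangle. -/
def p1 (𝒯 : Set (Finset E2)) (w : E2 → E2) (x : E2) : E2 :=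
  open Classical in
  if h : ∃ f : E2, ∃ s ∈ 𝒯, ∃ c : E2 → ℝ, (∀ v ∈ s, 0 ≤ c v) ∧ ∑ v ∈ s, c v = 1 ∧
      ∑ v ∈ s, c v • v = x ∧ f = ∑ v ∈ s, c v • w v
  then h.choose else 0

/-! ### The computational domain and the finite element mesh -/

/-- The continuum region of the cell for the atomistic region `A`. -/
def contRegion (N : ℕ) (A : Set E2) : Set E2 := closure (cell N \ A) ∩ cell N

/-- The geometry: period, vacancies, atomistic region and a triangulation of the continuum
region. -/
structure ACMesh where
  /-- the periodicity parameter -/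
  N : ℕ
  N_pos : 0 < N
  /-- the vacancy sites -/
  V : Set E2
  V_sub : V ⊆ Lat ∩ cell N
  /-- the atomistic region: a closed polygonal set in the interior of the cell -/
  Ωa : Set E2
  /-- the boundary of the atomistic region is aligned with the edges of the canonical
  triangulation, that is, the region is a union of micro-triangles -/
  Ωa_aligned : ∃ A ⊆ micro, Ωa = ⋃ s ∈ A, tri s
  Ωa_sub : Ωa ⊆ interior (cell N)
  /-- all vacancies are in the interior of the atomistic region -/
  V_int : V ⊆ interior Ωa
  /-- the triangles of the finite element mesh of the continuum region -/
  Thc : Finset (Finset E2)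
  card_eq : ∀ s ∈ Thc, s.card = 3
  indep : ∀ s ∈ Thc, AffineIndependent ℝ (fun v : s => (v : E2))
  vertex_mem : ∀ s ∈ Thc, (s : Set E2) ⊆ Lat
  cover : ⋃ s ∈ Thc, tri s = closure (contRegion N Ωa)
  /-- the periodic extension of the mesh is regular: any two triangles meet in a common face -/
  regular : ∀ s ∈ Thc, ∀ t ∈ Thc, ∀ z ∈ perLat N,
    tri s ∩ tri (shift z t) ⊆ convexHull ℝ ((s : Set E2) ∩ (shift z t : Set E2))
  /-- the mesh size on the boundary of the atomistic region is the lattice spacing -/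
  unit_edges : ∀ s ∈ Thc, ∀ v ∈ s, ∀ w ∈ s, v ≠ w →
    segment ℝ v w ⊆ frontier Ωa → dist v w = 1

namespace ACMesh

variable (m : ACMesh)

/-- The continuum region. -/
def Ωc : Set E2 := contRegion m.N m.Ωa

/-- The periodic continuation of the continuum region. -/
def Ωcper : Set E2 := m.Ωc + perLat m.N

/-- The atomic sites of one periodic cell. -/
def sites0 : Set E2 := (Lat ∩ cell m.N) \ m.V

/-- All atomic sites, the lattice with a periodic array of vacancies. -/
def sites : Set E2 := m.sites0 + perLat m.N

/-- The mesh of the cell extended to the atomistic region by the micro-triangles. -/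
def Th : Set (Finset E2) := (m.Thc : Set (Finset E2)) ∪ {s | s ∈ micro ∧ tri s ⊆ m.Ωa}

/-- Its periodic extension. -/
def Thper : Set (Finset E2) := {s | ∃ t ∈ m.Th, ∃ z ∈ perLat m.N, s = shift z t}

/-- The micro-triangles in the continuum region. -/
def Tac : Set (Finset E2) := {s | s ∈ Ta m.N ∧ tri s ⊆ closure m.Ωc}

/-- The ratio of the largest and the smallest angle of the mesh is at most `κ`. -/
def ShapeRegular (κ : ℝ) : Prop :=
  ∀ s ∈ m.Th, ∀ u ∈ s, ∀ v ∈ s, ∀ w ∈ s, u ≠ v → v ≠ w → u ≠ w →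
  ∀ t ∈ m.Th, ∀ u' ∈ t, ∀ v' ∈ t, ∀ w' ∈ t, u' ≠ v' → v' ≠ w' → u' ≠ w' →
    EuclideanGeometry.angle u v w ≤ κ * EuclideanGeometry.angle u' v' w'

/-! ### Bonds -/

/-- The bonds between the atoms of the cell and all other atoms. -/
def bonds : Set (E2 × E2) := {b | b.1 ∈ m.sites0 ∧ b.2 ∈ m.sites ∧ b.1 ≠ b.2}

/-- The bonds contained in the interior of the (periodic) continuum region. -/
def bondsC : Set (E2 × E2) := {b | b ∈ m.bonds ∧ segment ℝ b.1 b.2 ⊆ interior m.Ωcper}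

/-- The remaining, atomistic bonds. -/
def bondsA : Set (E2 × E2) := m.bonds \ m.bondsC

/-- The periodic continuation of the set of continuum bonds. -/
def bondsCper : Set (E2 × E2) :=
  {b | ∃ c ∈ m.bondsC, ∃ z ∈ perLat m.N, b = (c.1 + z, c.2 + z)}

/-- The convex hull of all continuum bonds (and their periodic images) in direction `r` that
meet the triangle `τ` in a set of positive length, that is, in more than one point. -/
def omega (τ : Finset E2) (r : E2) : Set E2 :=
  convexHull ℝ (⋃ b ∈ {b | b ∈ m.bondsCper ∧ b.2 - b.1 = r ∧
    (segment ℝ b.1 b.2 ∩ tri τ).Nontrivial}, segment ℝ b.1 b.2)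

end ACMesh

/-! ### Deformations -/

/-- The largest `μ` with `|y x' - y x| ≥ μ |x' - x|` for all points `x, x'` of `S`. -/
def muOn (S : Set E2) (y : E2 → E2) : ℝ :=
  sInf {q | ∃ x ∈ S, ∃ x' ∈ S, x ≠ x' ∧ q = ‖y x' - y x‖ / ‖x' - x‖}

namespace ACMesh

variable (m : ACMesh)

/-- Invertibility of a lattice deformation. -/
def muA (y : E2 → E2) : ℝ := muOn m.sites y

/-- Invertibility in the continuum region. -/
def muC (y : E2 → E2) : ℝ := muOn m.Ωc y

/-- Periodic deformations with macroscopic strain `B`; only the values of `y` at the atomic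
sites are relevant. -/
def IsDeformation (B : E2 →L[ℝ] E2) (y : E2 → E2) : Prop :=
  (∀ x ∈ m.sites, ∀ z ∈ perLat m.N, y (x + z) = y x + B z) ∧ 0 < m.muA y

/-- The nodal interpolant with respect to the finite element mesh. -/
def Ih (y : E2 → E2) : E2 → E2 := p1 m.Thper y

/-- The nearest-neighbour quadratic form that defines the extension of displacements to the
vacancy sites. -/
def PhiNN (v : E2 → E2) : ℝ :=
  ∑' b : {b : E2 × E2 | b.1 ∈ Lat ∩ cell m.N ∧ b.2 - b.1 ∈ Lnn},
    (inner ℝ (b.1.2 - b.1.1) (v b.1.2 - v b.1.1)) ^ 2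

/-- The finite element displacements: periodic functions that are affine on each triangle of the
mesh, and whose values at the vacancy sites are those of the extension operator, that is, they
minimise `PhiNN` among all periodic lattice functions with the same values at the atomic
sites. -/
def Uh : Set (E2 → E2) :=
  {v | (∀ x, ∀ z ∈ perLat m.N, v (x + z) = v x) ∧
    (∀ s ∈ m.Th, ∃ L : E2 →ᵃ[ℝ] E2, ∀ x ∈ tri s, v x = L x) ∧
    (∀ w : E2 → E2, (∀ x ∈ Lat, ∀ z ∈ perLat m.N, w (x + z) = w x) →
      (∀ x ∈ m.sites, w x = v x) → m.PhiNN v ≤ m.PhiNN w)}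

end ACMesh

/-- The micro-interpolant, with respect to the canonical triangulation. -/
def microInterp (y : E2 → E2) : E2 → E2 := p1 micro y

/-! ### Energies -/

/-- The one-sided directional derivative. -/
def Dc (r : E2) (v : E2 → E2) (x : E2) : E2 :=
  derivWithin (fun t : ℝ => v (x + t • r)) (Ici 0) 0

/-- `M_k(s)`, the supremum over `|r| ≥ s` of the norm of the `k`-th Fréchet derivative of
`r ↦ φ(|r|)`. -/
def Mk (φ : ℝ → ℝ) (k : ℕ) (s : ℝ) : ℝ≥0∞ :=
  ⨆ (r : E2) (_ : s ≤ ‖r‖), ‖iteratedFDeriv ℝ k (fun r : E2 => φ ‖r‖) r‖ₑ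

/-- A pair potential that is twice continuously differentiable on `(0, ∞)` and decays so fast,
with its derivatives, that the lattice sums of the energy and of its first two variations
converge. -/
def IsPotential (φ : ℝ → ℝ) : Prop :=
  ContDiffOn ℝ 2 φ (Ioi 0) ∧
    ∀ k ≤ 2, ∀ s : ℝ, 0 < s → ∑' r : Lstar, Mk φ k (s * ‖r.1‖) * ‖r.1‖ₑ ^ k ≠ ⊤

namespace ACMesh

variable (m : ACMesh)

/-- The atomistic energy per period. -/
def Ea (φ : ℝ → ℝ) (y : E2 → E2) : ℝ := ∑' b : m.bonds, φ ‖y b.1.2 - y b.1.1‖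

/-- The energy of the atomistic/continuum coupling method. -/
def Eac (φ : ℝ → ℝ) (y : E2 → E2) : ℝ :=
  (∑' b : m.bondsA, φ ‖y b.1.2 - y b.1.1‖) +
    ∑' b : m.bondsC, ∫ t in (0 : ℝ)..1,
      φ ‖Dc (b.1.2 - b.1.1) y (b.1.1 + t • (b.1.2 - b.1.1))‖

end ACMesh

/-- The first variation of the energy `E` at `y` in direction `u`. -/
def firstVar (E : (E2 → E2) → ℝ) (y u : E2 → E2) : ℝ := deriv (fun t : ℝ => E (y + t • u)) 0

/-! ### Norms -/

/-- The standard basis vectors. -/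
def e (i : Fin 2) : E2 := EuclideanSpace.single i 1

/-- The Frobenius norm. -/
def frob (A : E2 →L[ℝ] E2) : ℝ := Real.sqrt (∑ i, ‖A (e i)‖ ^ 2)

/-- The Frobenius norm of a tensor of third order. -/
def frob2 (H : E2 →L[ℝ] E2 →L[ℝ] E2) : ℝ := Real.sqrt (∑ i, ∑ j, ‖H (e i) (e j)‖ ^ 2)

/-- The `L^q` norm of the gradient over the cell. -/
def gradNorm (N : ℕ) (q : ℝ≥0∞) (v : E2 → E2) : ℝ≥0∞ :=
  eLpNorm (fun x => frob (fderiv ℝ v x)) q (volume.restrict (cell N))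

/-- The discrete negative Sobolev norm of a functional, `q` being the conjugate exponent. -/
def ACMesh.negNorm (m : ACMesh) (q : ℝ≥0∞) (Ψ : (E2 → E2) → ℝ) : ℝ≥0∞ :=
  ⨆ (v : E2 → E2) (_ : v ∈ m.Uh) (_ : gradNorm m.N q v = 1), ENNReal.ofReal (Ψ v)

/-- The `L^∞` norm over a set of a field of third order tensors. -/
def linf (H : E2 → E2 →L[ℝ] E2 →L[ℝ] E2) (A : Set E2) : ℝ≥0∞ :=
  eLpNorm (fun x => frob2 (H x)) ⊤ (volume.restrict A)

/-- The `L^∞` norm over a convex set that may degenerate to a segment. Over a null set it is the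
limit of the norms over shrinking open neighbourhoods; for a continuous field this is the
supremum over the closure. -/
def linfHull (H : E2 → E2 →L[ℝ] E2 →L[ℝ] E2) (A : Set E2) : ℝ≥0∞ :=
  open Classical in
  if volume A = 0 then ⨅ (U : Set E2) (_ : IsOpen U) (_ : A ⊆ U), linf H U else linf H A

/-- The weighted `ℓ^p` norm `(∑ w a ^ p) ^ (1/p)`, with the usual meaning for `p = ∞`. -/
def wlp {ι : Type} (p : ℝ≥0∞) (w a : ι → ℝ≥0∞) : ℝ≥0∞ :=
  open Classical in
  if p = ⊤ then ⨆ (i : ι) (_ : w i ≠ 0), a i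
  else (∑' i, w i * a i ^ p.toReal) ^ (1 / p.toReal)

/-! ### Smooth interpolants -/

/-- `G` is the weak derivative of `f` on the plane. -/
def IsWeakDeriv {F : Type} [NormedAddCommGroup F] [NormedSpace ℝ F]
    (f : E2 → F) (G : E2 → E2 →L[ℝ] F) : Prop :=
  LocallyIntegrable f ∧ LocallyIntegrable G ∧
    ∀ ψ : E2 → ℝ, ContDiff ℝ (⊤ : ℕ∞) ψ → HasCompactSupport ψ → ∀ d : E2,
      ∫ x, (fderiv ℝ ψ x d) • f x = - ∫ x, ψ x • G x d

/-- `w` (in its continuous representative) is a `W^{2,∞}` interpolant of the deformation `y`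
with strain `B`, and `H` is its second weak derivative. -/
def ACMesh.IsInterpolant (m : ACMesh) (B : E2 →L[ℝ] E2) (y w : E2 → E2)
    (H : E2 → E2 →L[ℝ] E2 →L[ℝ] E2) : Prop :=
  Continuous w ∧ (∀ x ∈ m.sites, w x = y x) ∧
    (∀ x, ∀ z ∈ perLat m.N, w (x + z) = w x + B z) ∧
    ∃ G : E2 → E2 →L[ℝ] E2, IsWeakDeriv w G ∧ IsWeakDeriv G H ∧
      MemLp G ⊤ volume ∧ MemLp H ⊤ volume

/-! ### The constants -/

/-- `K_{|r|} = M_2(μ |r|) |r|^3`. -/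
def Kr (φ : ℝ → ℝ) (μ : ℝ) (r : E2) : ℝ≥0∞ := Mk φ 2 (μ * ‖r‖) * ‖r‖ₑ ^ 3

/-- The constant of the coarsening term. -/
def Ccoarse (C₁ : ℝ≥0) (φ : ℝ → ℝ) (μ : ℝ) : ℝ≥0∞ :=
  C₁ * ∑' r : Lstar, Mk φ 2 (μ * ‖r.1‖) * ‖r.1‖ₑ ^ 2

/-- The constant of the modelling term; `q` is the exponent conjugate to `p`. -/
def Cmodel (p q : ℝ≥0∞) (φ : ℝ → ℝ) (μ : ℝ) : ℝ≥0∞ :=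
  (5 / 2 : ℝ≥0∞) ^ (p⁻¹).toReal * (∑' r : Lstar, Kr φ μ r.1) ^ (q⁻¹).toReal

end

end ACVacancy

/-! Both first variations are sums over bonds, so their difference is estimated bond by bond. For a
bond b = (x, x+r) the two stresses are values of the gradient of the radial potential at vectors of
length at least μ|r|. There this gradient is Lipschitz with constant √2 M_2(μ|r|), although the
exterior of a ball is not convex (`norm_fderiv_rad_sub_le`).

For a continuum bond, D_b u is the integral of ∇_r u along the bond (`IsPA.integral_Dc`), so both
variations stand under one integral and it remains to estimate ∇_r I_h y(x+tr) − D_b y. Sites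
determine everything that enters here (`Ih_congr`, `Dc_Ih_congr`), so y may be replaced by its
smooth interpolant w. Inserting ∇_r w(x+tr) splits the quantity into the error of linear
interpolation, of size h_T |r| ‖∇²w‖ on T up to the shape constant (`ACMesh.interp_error`), and the
difference between a derivative and a difference quotient of w on the bond, at most ½|r|² ‖∇²w‖ on ω
(`ACMesh.IsSmooth.ae_model_le`). For an atomistic bond only the first error occurs, averaged over
the bond.

A weighted Hölder inequality over pairs (bond, t) (`holder_bonds`) leaves sums over bonds of line
integrals of powers of piecewise constant functions. They are turned into area integrals by the bond
density estimate `tsum_lintegral_triWeight_le`: the total length, measured in units of |r|, that the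
lattice bonds of direction r spend in a lattice triangle T is at most |T| divided by the area of the
unit cell, whatever r and the shape of T. The reason is that T and its point reflection form a
parallelogram which meets every translate of the lattice in the same number of points.

Bonds may run along edges of the mesh, where the gradient jumps. The derivative in the direction of
the edge is however the same from both sides, so every bound holds with the smaller of the adjacent
values (`low`), and half the weight from each side suffices (`ACMesh.low_le_tsum`).

Two preparations are needed. Mollification shows that w is C¹ and that the increments of its
gradient along segments are bounded by the essential supremum of the second derivative
(`contDiff_of_weakDeriv`). And the mesh completed by the micro-triangles must be regular across the
interface, so that the interpolant is well defined (`ACMesh.reg_Thper`); this is where the unit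
edges on the boundary of the atomistic region enter. -/

namespace ACVacancy

/-! ### Radial potentials -/

/-- The potential as a function of the bond vector. -/
noncomputable def rad (φ : ℝ → ℝ) (r : E2) : ℝ := φ ‖r‖

lemma contDiffAt_rad {φ : ℝ → ℝ} (hφ : ContDiffOn ℝ 2 φ (Ioi 0)) {a : E2} (ha : a ≠ 0) :
    ContDiffAt ℝ 2 (rad φ) a :=
  ContDiffAt.comp a (hφ.contDiffAt (Ioi_mem_nhds (norm_pos_iff.2 ha))) (contDiffAt_norm ℝ ha)

lemma enorm_le_Mk (φ : ℝ → ℝ) (k : ℕ) {ρ : ℝ} {a : E2} (h : ρ ≤ ‖a‖) :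
    ‖iteratedFDeriv ℝ k (rad φ) a‖ₑ ≤ Mk φ k ρ :=
  le_iSup₂ (f := fun (r : E2) (_ : ρ ≤ ‖r‖) => ‖iteratedFDeriv ℝ k (rad φ) r‖ₑ) a h

lemma norm_le_Mk (φ : ℝ → ℝ) (k : ℕ) {ρ : ℝ} {a : E2} (h : ρ ≤ ‖a‖) (hM : Mk φ k ρ ≠ ⊤) :
    ‖iteratedFDeriv ℝ k (rad φ) a‖ ≤ (Mk φ k ρ).toReal := by
  have := ENNReal.toReal_mono hM (enorm_le_Mk φ k h)
  simpa using this

lemma norm_rad_le (φ : ℝ → ℝ) {ρ : ℝ} {a : E2} (h : ρ ≤ ‖a‖) (hM : Mk φ 0 ρ ≠ ⊤) :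
    ‖rad φ a‖ ≤ (Mk φ 0 ρ).toReal := by
  simpa using norm_le_Mk φ 0 h hM

lemma norm_fderiv_rad_le (φ : ℝ → ℝ) {ρ : ℝ} {a : E2} (h : ρ ≤ ‖a‖) (hM : Mk φ 1 ρ ≠ ⊤) :
    ‖fderiv ℝ (rad φ) a‖ ≤ (Mk φ 1 ρ).toReal := by
  rw [← norm_iteratedFDeriv_one]; exact norm_le_Mk φ 1 h hM

lemma norm_fderiv_fderiv_rad_le (φ : ℝ → ℝ) {ρ : ℝ} {a : E2} (h : ρ ≤ ‖a‖)
    (hM : Mk φ 2 ρ ≠ ⊤) :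
    ‖fderiv ℝ (fderiv ℝ (rad φ)) a‖ ≤ (Mk φ 2 ρ).toReal := by
  have := norm_le_Mk φ 2 h hM
  rwa [← norm_iteratedFDeriv_fderiv, ← norm_iteratedFDeriv_fderiv, norm_iteratedFDeriv_zero] at this

lemma fderiv_rad {φ : ℝ → ℝ} (hφ : ContDiffOn ℝ 2 φ (Ioi 0)) {a : E2} (ha : a ≠ 0) :
    fderiv ℝ (rad φ) a = (deriv φ ‖a‖ / ‖a‖) • innerSL ℝ a := by
  have h1 : HasDerivAt φ (deriv φ ‖a‖) ‖a‖ :=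
    ((hφ.contDiffAt (Ioi_mem_nhds (norm_pos_iff.2 ha))).differentiableAt (by norm_num)).hasDerivAt
  have h2 := (hasStrictFDerivAt_norm_sq a).hasFDerivAt
  have h3 : HasFDerivAt (fun x : E2 => ‖x‖) (‖a‖⁻¹ • innerSL ℝ a) a := by
    have := h2.sqrt (by positivity)
    simp only [Real.sqrt_sq (norm_nonneg _)] at this
    have e : (1 / (2 * ‖a‖)) • 2 • innerSL ℝ a = ‖a‖⁻¹ • innerSL ℝ a := by
      rw [← Nat.cast_smul_eq_nsmul ℝ, smul_smul]
      congr 1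
      field_simp
      norm_num
    rwa [e] at this
  have h4 : HasFDerivAt (rad φ) _ a := h1.comp_hasFDerivAt a h3
  rw [h4.fderiv, smul_smul, div_eq_mul_inv]

lemma differentiableAt_fderiv_rad {φ : ℝ → ℝ} (hφ : ContDiffOn ℝ 2 φ (Ioi 0)) {a : E2}
    (ha : a ≠ 0) : DifferentiableAt ℝ (fderiv ℝ (rad φ)) a :=
  ((contDiffAt_rad hφ ha).fderiv_right (m := 1) (by norm_num)).differentiableAt (by norm_num)

lemma differentiableAt_rad {φ : ℝ → ℝ} (hφ : ContDiffOn ℝ 2 φ (Ioi 0)) {a : E2}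
    (ha : a ≠ 0) : DifferentiableAt ℝ (rad φ) a :=
  (contDiffAt_rad hφ ha).differentiableAt (by norm_num)

/-- The quotient φ'(s)/s is the eigenvalue of the Hessian of the radial potential in the tangential
direction. Differentiating the gradient formula along a tangent line gives this, because the norm is
stationary there at the base point. -/
lemma abs_deriv_div_le {φ : ℝ → ℝ} (hφ : ContDiffOn ℝ 2 φ (Ioi 0)) {ρ : ℝ} (hρ : 0 < ρ)
    {b : E2} (hb : ρ ≤ ‖b‖) (hM : Mk φ 2 ρ ≠ ⊤) :
    |deriv φ ‖b‖ / ‖b‖| ≤ (Mk φ 2 ρ).toReal := by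
  have hb0 : b ≠ 0 := norm_pos_iff.1 (hρ.trans_le hb)
  -- The vector b turned by a right angle: tangential and of the same length.
  set τ : E2 := !₂[-b 1, b 0] with hτ
  have hτn : ‖τ‖ = ‖b‖ := by
    simp [EuclideanSpace.norm_eq, hτ, Fin.sum_univ_two]; ring_nf
  have hin : inner ℝ b τ = 0 := by
    simp [hτ, PiLp.inner_apply, Fin.sum_univ_two]; ring
  have hd := (differentiableAt_fderiv_rad hφ hb0).hasFDerivAt
  have hc : HasDerivAt (fun t : ℝ => b + t • τ) τ 0 := by
    simpa using ((hasDerivAt_id (0 : ℝ)).smul_const τ).const_add b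
  have hd1 : HasDerivAt (fun t : ℝ => fderiv ℝ (rad φ) (b + t • τ))
      (fderiv ℝ (fderiv ℝ (rad φ)) b τ) 0 := by
    refine HasFDerivAt.comp_hasDerivAt 0 ?_ hc
    simpa using hd
  have hn : HasDerivAt (fun t : ℝ => ‖b + t • τ‖) 0 0 := by
    have h2 := (hasStrictFDerivAt_norm_sq b).hasFDerivAt
    have h3 : HasDerivAt (fun t : ℝ => ‖b + t • τ‖ ^ 2) (2 * inner ℝ b τ) 0 := by
      have : HasFDerivAt (fun x : E2 => ‖x‖ ^ 2) (2 • innerSL ℝ b) (b + (0:ℝ) • τ) := by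
        simpa using h2
      have := this.comp_hasDerivAt (0:ℝ) hc
      simpa [Function.comp_def] using this
    have := h3.sqrt (by simpa using hb0)
    simpa [Real.sqrt_sq (norm_nonneg _), hin] using this
  have hψ : DifferentiableAt ℝ (fun s => deriv φ s / s) ‖b‖ := by
    refine DifferentiableAt.div ?_ differentiableAt_id (norm_ne_zero_iff.2 hb0)
    have h0 := (hφ.contDiffAt (Ioi_mem_nhds (norm_pos_iff.2 hb0)))
    have h1 := (h0.fderiv_right (m := 1) (by norm_num)).differentiableAt (by norm_num)
    have h2 := h1.clm_apply (differentiableAt_const (1 : ℝ))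
    simpa only [fderiv_apply_one_eq_deriv] using h2
  have hd2 : HasDerivAt (fun t : ℝ => (deriv φ ‖b + t • τ‖ / ‖b + t • τ‖) •
      innerSL ℝ (b + t • τ)) ((deriv φ ‖b‖ / ‖b‖) • innerSL ℝ τ) 0 := by
    have e1 : HasDerivAt (fun t : ℝ => deriv φ ‖b + t • τ‖ / ‖b + t • τ‖) 0 0 := by
      have h0 : DifferentiableAt ℝ (fun s => deriv φ s / s) ‖b + (0:ℝ) • τ‖ := by simpa using hψ
      have := h0.hasDerivAt.comp (0:ℝ) hn
      simpa [Function.comp_def] using this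
    have e2 : HasDerivAt (fun t : ℝ => innerSL ℝ (b + t • τ)) (innerSL ℝ τ) 0 :=
      ((innerSL ℝ : E2 →L[ℝ] _).hasFDerivAt).comp_hasDerivAt (0:ℝ) hc
    have := e1.smul e2
    simp only [zero_smul, add_zero] at this
    exact this
  have hev : (fun t : ℝ => fderiv ℝ (rad φ) (b + t • τ)) =ᶠ[nhds 0]
      (fun t : ℝ => (deriv φ ‖b + t • τ‖ / ‖b + t • τ‖) • innerSL ℝ (b + t • τ)) := by
    have : ∀ᶠ t in nhds (0:ℝ), b + t • τ ≠ 0 :=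
      hc.continuousAt.eventually_ne (by simpa using hb0)
    filter_upwards [this] with t ht using fderiv_rad hφ ht
  have heq := hd1.unique (hd2.congr_of_eventuallyEq hev)
  have h1 := (fderiv ℝ (fderiv ℝ (rad φ)) b).le_opNorm τ
  rw [heq, norm_smul, innerSL_apply_norm, hτn] at h1
  have h2 := le_of_mul_le_mul_right h1 (norm_pos_iff.2 hb0)
  exact h2.trans (norm_fderiv_fderiv_rad_le φ hb hM)

/-- The gradient of the potential is Lipschitz outside a ball, although the exterior of a ball is
not convex. -/
lemma norm_fderiv_rad_sub_le {φ : ℝ → ℝ} (hφ : ContDiffOn ℝ 2 φ (Ioi 0)) {ρ : ℝ} (hρ : 0 < ρ)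
    (hM : Mk φ 2 ρ ≠ ⊤) {a b : E2} (ha : ρ ≤ ‖a‖) (hb : ρ ≤ ‖b‖) :
    ‖fderiv ℝ (rad φ) a - fderiv ℝ (rad φ) b‖ ≤ √2 * (Mk φ 2 ρ).toReal * ‖a - b‖ := by
  wlog hab : ‖b‖ ≤ ‖a‖ generalizing a b
  · rw [norm_sub_rev, norm_sub_rev a]; exact this hb ha (le_of_not_ge hab)
  have hb0 : 0 < ‖b‖ := hρ.trans_le hb
  have ha0 : 0 < ‖a‖ := hρ.trans_le ha
  set M := (Mk φ 2 ρ).toReal with hMd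
  have hM0 : 0 ≤ M := ENNReal.toReal_nonneg
  -- A detour from a to b that stays outside the ball: first radially to the sphere through b, the
  -- shorter vector, then on that sphere. The second part needs no path, since on a sphere the
  -- gradient is a fixed multiple of the position vector.
  set a' : E2 := (‖b‖ / ‖a‖) • a with ha'
  have hna' : ‖a'‖ = ‖b‖ := by
    rw [ha', norm_smul, Real.norm_of_nonneg (by positivity)]; field_simp
  have ha'0 : a' ≠ 0 := by rw [← norm_pos_iff, hna']; exact hb0
  have hseg : ∀ x ∈ segment ℝ a' a, ρ ≤ ‖x‖ := by
    rintro x ⟨s, t, hs, ht, hst, rfl⟩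
    have : s • a' + t • a = (s * (‖b‖ / ‖a‖) + t) • a := by rw [ha', smul_smul, add_smul]
    rw [this, norm_smul, Real.norm_of_nonneg (by positivity)]
    have : (s * (‖b‖ / ‖a‖) + t) * ‖a‖ = s * ‖b‖ + t * ‖a‖ := by field_simp
    rw [this]
    nlinarith
  have h1 : ‖fderiv ℝ (rad φ) a - fderiv ℝ (rad φ) a'‖ ≤ M * ‖a - a'‖ := by
    refine (convex_segment a' a).norm_image_sub_le_of_norm_fderiv_le (𝕜 := ℝ) ?_ ?_
      (left_mem_segment ℝ _ _) (right_mem_segment ℝ _ _)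
    · intro x hx
      exact differentiableAt_fderiv_rad hφ (norm_pos_iff.1 (hρ.trans_le (hseg x hx)))
    · intro x hx
      exact norm_fderiv_fderiv_rad_le φ (hseg x hx) hM
  have h2 : ‖fderiv ℝ (rad φ) a' - fderiv ℝ (rad φ) b‖ ≤ M * ‖a' - b‖ := by
    rw [fderiv_rad hφ ha'0, fderiv_rad hφ (norm_pos_iff.1 hb0), hna', ← smul_sub, ← map_sub,
      norm_smul, innerSL_apply_norm]
    exact mul_le_mul_of_nonneg_right (abs_deriv_div_le hφ hρ hb hM) (norm_nonneg _)
  -- The triangle a, a', b has an angle of at least π/2 at a', so its two legs together are at most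
  -- √2 times the side from a to b. This is the source of the factor √2.
  have hpyth : ‖a - a'‖ ^ 2 + ‖a' - b‖ ^ 2 ≤ ‖a - b‖ ^ 2 := by
    have e : a - b = (a - a') + (a' - b) := by abel
    rw [e, norm_add_sq_real]
    have e2 : a - a' = (‖a‖ / ‖b‖ - 1) • a' := by
      rw [sub_smul, ha', smul_smul, one_smul]
      congr 1
      rw [div_mul_div_cancel₀ hb0.ne', div_self ha0.ne', one_smul]
    have h3 : 0 ≤ inner ℝ (a - a') (a' - b) := by
      rw [e2, real_inner_smul_left, inner_sub_right, real_inner_self_eq_norm_sq, hna']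
      have := real_inner_le_norm a' b
      rw [hna'] at this
      have h4 : 1 ≤ ‖a‖ / ‖b‖ := by rwa [one_le_div hb0]
      apply mul_nonneg <;> nlinarith
    linarith
  have hsum : ‖a - a'‖ + ‖a' - b‖ ≤ √2 * ‖a - b‖ := by
    refine le_of_sq_le_sq ?_ (by positivity)
    rw [mul_pow, Real.sq_sqrt (by norm_num)]
    nlinarith [sq_nonneg (‖a - a'‖ - ‖a' - b‖)]
  calc _ = ‖(fderiv ℝ (rad φ) a - fderiv ℝ (rad φ) a')
        + (fderiv ℝ (rad φ) a' - fderiv ℝ (rad φ) b)‖ := by congr 1; abel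
    _ ≤ M * ‖a - a'‖ + M * ‖a' - b‖ := (norm_add_le _ _).trans (add_le_add h1 h2)
    _ ≤ √2 * M * ‖a - b‖ := by nlinarith


/-! ### Functions with bounded second weak derivatives -/

open scoped Convolution in
/-- Mollification with a smooth bump function. -/
noncomputable def mol {F : Type} [NormedAddCommGroup F] [NormedSpace ℝ F]
    (ρ : ContDiffBump (0 : E2)) (f : E2 → F) : E2 → F :=
  ρ.normed volume ⋆[ContinuousLinearMap.lsmul ℝ ℝ, volume] f

section mol

variable {F : Type} [NormedAddCommGroup F] [NormedSpace ℝ F]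

lemma mol_apply (ρ : ContDiffBump (0 : E2)) (f : E2 → F) (x : E2) :
    mol ρ f x = ∫ t, ρ.normed volume (x - t) • f t :=
  convolution_lsmul_swap

lemma integrable_mol_integrand (ρ : ContDiffBump (0 : E2)) {f : E2 → F}
    (hf : LocallyIntegrable f) (x : E2) :
    Integrable (fun t => ρ.normed volume (x - t) • f t) := by
  refine hf.integrable_smul_left_of_hasCompactSupport
    (ρ.continuous_normed.comp (continuous_const.sub continuous_id)) ?_
  exact ρ.hasCompactSupport_normed.comp_homeomorph (Homeomorph.subLeft x)

/-- The derivative falls on the bump function. The weak derivative is then tested with t ↦ ρ(x − t),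
where the sign from the reflection cancels the sign of the integration by parts. -/
lemma mol_hasFDerivAt [CompleteSpace F] (ρ : ContDiffBump (0 : E2)) {f : E2 → F}
    {G : E2 → E2 →L[ℝ] F} (h : IsWeakDeriv f G) (x : E2) :
    HasFDerivAt (mol ρ f) (mol ρ G x) x := by
  have hc := ρ.hasCompactSupport_normed (μ := volume)
  have hd : ContDiff ℝ 1 (ρ.normed volume) := ρ.contDiff_normed (n := 1)
  have h1 := hc.hasFDerivAt_convolution_right (ContinuousLinearMap.lsmul ℝ ℝ).flip h.1 hd x
  rw [convolution_flip] at h1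
  refine h1.congr_fderiv ?_
  ext1 d
  rw [convolution_precompR_apply _ h.1 (hc.fderiv ℝ) (hd.continuous_fderiv (by norm_num)),
    mol_apply, ContinuousLinearMap.integral_apply (integrable_mol_integrand ρ h.2.1 x),
    convolution_def]
  have hψ : ContDiff ℝ (⊤ : ℕ∞) (fun t => ρ.normed volume (x - t)) :=
    ρ.contDiff_normed.comp (contDiff_const.sub contDiff_id)
  have hψc : HasCompactSupport (fun t => ρ.normed volume (x - t)) :=
    hc.comp_homeomorph (Homeomorph.subLeft x)
  have h2 := h.2.2 _ hψ hψc d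
  have h3 : ∀ t, fderiv ℝ (fun t => ρ.normed volume (x - t)) t d
      = - fderiv ℝ (ρ.normed volume) (x - t) d := by
    intro t
    have e1 : HasFDerivAt (fun t => ρ.normed volume (x - t))
        ((fderiv ℝ (ρ.normed volume) (x - t)).comp (-ContinuousLinearMap.id ℝ E2)) t :=
      ((hd.differentiable (by norm_num)) (x - t)).hasFDerivAt.comp t
        ((hasFDerivAt_id t).const_sub x)
    rw [e1.fderiv]; simp
  simp only [h3, neg_smul, integral_neg, neg_inj] at h2
  simpa using h2

lemma norm_mol_le (ρ : ContDiffBump (0 : E2)) {f : E2 → F} {A : ℝ} {x : E2}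
    (h : ∀ᵐ t, t ∈ Metric.ball x ρ.rOut → ‖f t‖ ≤ A) : ‖mol ρ f x‖ ≤ A := by
  rw [mol_apply]
  have hi : Integrable (fun t => ρ.normed volume (x - t)) :=
    (ρ.integrable_normed (μ := volume)).comp_sub_left x
  have h1 : ∫ t, ρ.normed volume (x - t) * A = A := by
    rw [integral_mul_const, integral_sub_left_eq_self (fun t => ρ.normed volume t) volume x,
      ρ.integral_normed, one_mul]
  conv_rhs => rw [← h1]
  refine norm_integral_le_of_norm_le (hi.mul_const A) ?_
  filter_upwards [h] with t ht
  rw [norm_smul, Real.norm_of_nonneg (ρ.nonneg_normed _)]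
  by_cases hx : t ∈ Metric.ball x ρ.rOut
  · exact mul_le_mul_of_nonneg_left (ht hx) (ρ.nonneg_normed _)
  · have : x - t ∉ Function.support (ρ.normed volume) := by
      rw [ρ.support_normed_eq]
      simpa [dist_eq_norm, norm_sub_rev] using hx
    rw [Function.notMem_support.1 this]; simp

end mol

/-- A sequence of bump functions that concentrates at the origin. -/
noncomputable def bumpSeq (n : ℕ) : ContDiffBump (0 : E2) where
  rIn := 1 / (n + 1)
  rOut := 2 / (n + 1)
  rIn_pos := by positivity
  rIn_lt_rOut := (div_lt_div_iff_of_pos_right (by positivity)).2 (by norm_num)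

open Filter Topology in
lemma bumpSeq_tendsto : Tendsto (fun n => (bumpSeq n).rOut) atTop (𝓝 0) := by
  have := (tendsto_one_div_add_atTop_nhds_zero_nat : Tendsto (fun n : ℕ => 1 / ((n : ℝ) + 1)) atTop (𝓝 0)).const_mul 2
  simp only [mul_zero] at this
  refine this.congr fun n => ?_
  simp only [bumpSeq, mul_one_div]

section weak

variable {F : Type} [NormedAddCommGroup F] [NormedSpace ℝ F] [CompleteSpace F]

-- Mean value inequality for the mollified functions: near the compact segment their derivatives are
-- averages of G over small balls that still lie in U. Convergence is assumed only at the two end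
-- points, so that the lemma applies at Lebesgue points before a continuous representative is known.
open Filter Topology in
lemma IsWeakDeriv.norm_sub_le {f : E2 → F} {G : E2 → E2 →L[ℝ] F} (h : IsWeakDeriv f G)
    {U : Set E2} (hU : IsOpen U) {A : ℝ} (hA : ∀ᵐ t, t ∈ U → ‖G t‖ ≤ A) {P Q : E2}
    (hPQ : segment ℝ P Q ⊆ U)
    (hP : Tendsto (fun n => mol (bumpSeq n) f P) atTop (𝓝 (f P)))
    (hQ : Tendsto (fun n => mol (bumpSeq n) f Q) atTop (𝓝 (f Q))) :
    ‖f Q - f P‖ ≤ A * ‖Q - P‖ := by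
  have hcomp : IsCompact (segment ℝ P Q) := by
    rw [← convexHull_pair]; exact (Set.toFinite {P, Q}).isCompact_convexHull ℝ
  obtain ⟨δ, hδ, hδU⟩ := hcomp.exists_thickening_subset_open hU hPQ
  refine le_of_tendsto ((hQ.sub hP).norm) ?_
  filter_upwards [bumpSeq_tendsto.eventually (gt_mem_nhds hδ)] with n hn
  refine (convex_segment P Q).norm_image_sub_le_of_norm_hasFDerivWithin_le (𝕜 := ℝ)
    (fun x _ => (mol_hasFDerivAt (bumpSeq n) h x).hasFDerivWithinAt) ?_
    (left_mem_segment ℝ _ _) (right_mem_segment ℝ _ _)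
  intro x hx
  refine norm_mol_le _ ?_
  filter_upwards [hA] with t ht htx
  refine ht (hδU ?_)
  rw [Metric.mem_thickening_iff]
  exact ⟨x, hx, (Metric.mem_ball.1 htx).trans hn⟩

end weak

-- On the full-measure set where the mollifications converge, f is Lipschitz by the mean value
-- inequality. A Lipschitz extension from this set is the representative; the extension may enlarge
-- the constant, which is immaterial.
open Filter Topology in
lemma exists_lipschitz_repr {F : Type} [NormedAddCommGroup F] [NormedSpace ℝ F]
    [FiniteDimensional ℝ F] {f : E2 → F} {G : E2 → E2 →L[ℝ] F} (h : IsWeakDeriv f G)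
    {A : ℝ≥0} (hA : ∀ᵐ t, ‖G t‖ ≤ A) : ∃ (K : ℝ≥0) (g : E2 → F), LipschitzWith K g ∧ f =ᵐ[volume] g := by
  have : CompleteSpace F := FiniteDimensional.complete ℝ F
  have hae := ContDiffBump.ae_convolution_tendsto_right_of_locallyIntegrable (μ := volume)
    (φ := bumpSeq) (l := atTop) (K := 2) bumpSeq_tendsto
    (Eventually.of_forall fun n => by simp only [bumpSeq]; apply le_of_eq; ring) h.1
  set S := {x | Tendsto (fun n => mol (bumpSeq n) f x) atTop (𝓝 (f x))} with hS
  have hL : LipschitzOnWith A f S := by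
    refine LipschitzOnWith.of_dist_le_mul fun x hx y hy => ?_
    rw [dist_eq_norm, dist_eq_norm]
    exact h.norm_sub_le isOpen_univ (by filter_upwards [hA] with t ht _ using ht)
      (subset_univ _) hy hx
  obtain ⟨g, hg, hfg⟩ := hL.extend_finite_dimension
  exact ⟨_, g, hg, by filter_upwards [hae] with x hx using hfg hx⟩

lemma IsWeakDeriv.congr_ae {F : Type} [NormedAddCommGroup F] [NormedSpace ℝ F]
    {f g : E2 → F} {G : E2 → E2 →L[ℝ] F} (h : IsWeakDeriv f G) (hfg : f =ᵐ[volume] g) :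
    IsWeakDeriv g G := by
  refine ⟨h.1.congr hfg, h.2.1, fun ψ h1 h2 d => ?_⟩
  rw [← h.2.2 ψ h1 h2 d]
  refine integral_congr_ae ?_
  filter_upwards [hfg] with t ht
  rw [ht]

lemma IsWeakDeriv.congr_ae_right {F : Type} [NormedAddCommGroup F] [NormedSpace ℝ F]
    {f : E2 → F} {G G' : E2 → E2 →L[ℝ] F} (h : IsWeakDeriv f G) (hG : G =ᵐ[volume] G') :
    IsWeakDeriv f G' := by
  refine ⟨h.1, h.2.1.congr hG, fun ψ h1 h2 d => ?_⟩
  rw [h.2.2 ψ h1 h2 d]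
  congr 1
  refine integral_congr_ae ?_
  filter_upwards [hG] with t ht
  rw [ht]

lemma frob2_bound (H : E2 →L[ℝ] E2 →L[ℝ] E2) : ‖H‖ ≤ frob2 H := by
  refine H.opNorm_le_bound₂ (Real.sqrt_nonneg _) fun d r => ?_
  have hd : d = ∑ i, d i • e i := by
    ext j; fin_cases j <;> simp [e, Fin.sum_univ_two]
  have hr : r = ∑ i, r i • e i := by
    ext j; fin_cases j <;> simp [e, Fin.sum_univ_two]
  have h1 : ‖H d r‖ ≤ ∑ i, ∑ j, (|d i| * |r j|) * ‖H (e i) (e j)‖ := by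
    conv_lhs => rw [hd, hr]
    simp only [map_sum, sum_apply, map_smul, smul_apply]
    have h3 : ∀ i j, ‖r j • d i • H (e i) (e j)‖ = |d i| * |r j| * ‖H (e i) (e j)‖ := by
      intro i j
      rw [norm_smul, norm_smul, Real.norm_eq_abs, Real.norm_eq_abs]; ring
    simp only [Fin.sum_univ_two, ← h3]
    rw [smul_add, smul_add]
    refine (norm_add_le _ _).trans ((add_le_add (norm_add_le _ _) (norm_add_le _ _)).trans ?_)
    linarith
  refine h1.trans ?_
  have h2 := Real.sum_mul_le_sqrt_mul_sqrt (Finset.univ : Finset (Fin 2 × Fin 2))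
    (fun p => |d p.1| * |r p.2|) (fun p => ‖H (e p.1) (e p.2)‖)
  simp only [Fintype.sum_prod_type] at h2
  refine h2.trans (le_of_eq ?_)
  rw [mul_comm, frob2, mul_assoc]
  congr 1
  rw [EuclideanSpace.norm_eq, EuclideanSpace.norm_eq, ← Real.sqrt_mul (by positivity)]
  congr 1
  simp only [Fin.sum_univ_two, Real.norm_eq_abs]
  ring

-- The mollified functions converge pointwise and their derivatives converge uniformly, with rate K
-- times the radius of the bump, so the limit is classically differentiable.
open Filter Topology in
lemma IsWeakDeriv.hasFDerivAt {F : Type} [NormedAddCommGroup F] [NormedSpace ℝ F]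
    [FiniteDimensional ℝ F] {f : E2 → F} {g : E2 → E2 →L[ℝ] F} (h : IsWeakDeriv f g)
    (hf : Continuous f) {K : ℝ≥0} (hg : LipschitzWith K g) (x : E2) : HasFDerivAt f (g x) x := by
  have : CompleteSpace F := FiniteDimensional.complete ℝ F
  refine hasFDerivAt_of_tendstoUniformly (l := atTop) (f := fun n => mol (bumpSeq n) f)
    (f' := fun n => mol (bumpSeq n) g) ?_ (fun n x => mol_hasFDerivAt _ h x)
    (fun x => ContDiffBump.convolution_tendsto_right_of_continuous bumpSeq_tendsto hf x) x
  rw [Metric.tendstoUniformly_iff]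
  intro ε hε
  have h1 : Tendsto (fun n => K * (bumpSeq n).rOut) atTop (𝓝 0) := by
    simpa using bumpSeq_tendsto.const_mul (K : ℝ)
  filter_upwards [h1.eventually (gt_mem_nhds hε)] with n hn x
  refine lt_of_le_of_lt ?_ hn
  rw [dist_comm]
  refine ContDiffBump.dist_normed_convolution_le hg.continuous.aestronglyMeasurable ?_
  intro t ht
  exact (hg.dist_le_mul t x).trans (mul_le_mul_of_nonneg_left (Metric.mem_ball.1 ht).le K.2)

lemma ae_norm_le_linf (H : E2 → E2 →L[ℝ] E2 →L[ℝ] E2) {A : Set E2} (hA : MeasurableSet A) :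
    ∀ᵐ t, t ∈ A → ‖H t‖ₑ ≤ linf H A := by
  have h := ae_le_eLpNormEssSup (f := fun x => frob2 (H x)) (μ := volume.restrict A)
  rw [ae_restrict_iff' hA] at h
  filter_upwards [h] with t ht hta
  rw [linf, eLpNorm_exponent_top]
  refine le_trans ?_ (ht hta)
  rw [← ofReal_norm, ← ofReal_norm]
  refine ENNReal.ofReal_le_ofReal ?_
  exact (frob2_bound _).trans (le_abs_self _)

/-- A continuous function with bounded second weak derivative is continuously differentiable and
its gradient varies along a segment no more than the second derivative allows. -/
theorem contDiff_of_weakDeriv {w : E2 → E2} {G : E2 → E2 →L[ℝ] E2}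
    {H : E2 → E2 →L[ℝ] E2 →L[ℝ] E2} (hw : Continuous w) (h1 : IsWeakDeriv w G)
    (h2 : IsWeakDeriv G H) (hH : MemLp H ⊤ volume) :
    ContDiff ℝ 1 w ∧ ∀ U : Set E2, IsOpen U → ∀ P Q, segment ℝ P Q ⊆ U →
      ‖fderiv ℝ w Q - fderiv ℝ w P‖ₑ ≤ linf H U * ‖Q - P‖ₑ := by
  have hA : ∀ᵐ t, ‖H t‖ ≤ (eLpNorm H ⊤ volume).toNNReal := by
    have := ae_le_eLpNormEssSup (f := H) (μ := volume)
    filter_upwards [this] with t ht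
    rw [← eLpNorm_exponent_top] at ht
    have := ENNReal.toReal_mono hH.2.ne ht
    rwa [toReal_enorm] at this
  obtain ⟨K, g, hg, hGg⟩ := exists_lipschitz_repr h2 hA
  have h1' := h1.congr_ae_right hGg
  have h2' := h2.congr_ae hGg
  have hd := h1'.hasFDerivAt hw hg
  have hfd : fderiv ℝ w = g := by ext1 x; exact (hd x).fderiv
  refine ⟨contDiff_one_iff_fderiv.2 ⟨fun x => (hd x).differentiableAt, hfd ▸ hg.continuous⟩, ?_⟩
  intro U hU P Q hPQ
  rw [hfd]
  by_cases htop : linf H U = ⊤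
  · rcases eq_or_ne P Q with rfl | hne
    · rw [sub_self, ← ofReal_norm, norm_zero, ENNReal.ofReal_zero]; exact zero_le
    · rw [htop, ENNReal.top_mul (by simpa [sub_eq_zero] using hne.symm)]; exact le_top
  have hb : ∀ᵐ t, t ∈ U → ‖H t‖ ≤ (linf H U).toReal := by
    filter_upwards [ae_norm_le_linf H hU.measurableSet] with t ht htU
    simpa using ENNReal.toReal_mono htop (ht htU)
  have := h2'.norm_sub_le hU hb hPQ
    (ContDiffBump.convolution_tendsto_right_of_continuous bumpSeq_tendsto hg.continuous P)
    (ContDiffBump.convolution_tendsto_right_of_continuous bumpSeq_tendsto hg.continuous Q)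
  rw [← ofReal_norm, ← ofReal_norm, ← ENNReal.ofReal_toReal htop,
    ← ENNReal.ofReal_mul ENNReal.toReal_nonneg]
  exact ENNReal.ofReal_le_ofReal this


/-! ### Gradient increments on convex sets, bond errors and interpolation errors -/

/-- Along a segment in an open set the gradient of `w` varies at most as `H` allows. -/
def GradBound (w : E2 → E2) (H : E2 → E2 →L[ℝ] E2 →L[ℝ] E2) : Prop :=
  ∀ U : Set E2, IsOpen U → ∀ P Q, segment ℝ P Q ⊆ U →
    ‖fderiv ℝ w Q - fderiv ℝ w P‖ₑ ≤ linf H U * ‖Q - P‖ₑ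

lemma linf_mono (H : E2 → E2 →L[ℝ] E2 →L[ℝ] E2) {A B : Set E2} (h : A ⊆ B) :
    linf H A ≤ linf H B :=
  eLpNorm_mono_measure _ (Measure.restrict_mono h le_rfl)

lemma isClosed_setOf_enorm_sub_le {F : Type*} [NormedAddCommGroup F] {g : E2 → F}
    (hg : Continuous g) {a : ℝ≥0∞} (ha : a ≠ ⊤) :
    IsClosed {p : E2 × E2 | ‖g p.2 - g p.1‖ₑ ≤ a * ‖p.2 - p.1‖ₑ} :=
  isClosed_le (continuous_enorm.comp ((hg.comp continuous_snd).sub (hg.comp continuous_fst)))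
    ((ENNReal.continuous_const_mul ha).comp
        (continuous_enorm.comp (continuous_snd.sub continuous_fst)))

/-- The estimate is a closed condition on the pair of points, and a convex set with interior points
lies in the closure of its interior. This carries bounds from open sets to closed triangles and to
the hulls of bonds. -/
lemma enorm_sub_le_of_interior {F : Type*} [NormedAddCommGroup F] {g : E2 → F}
    (hg : Continuous g) {a : ℝ≥0∞} {K : Set E2} (hK : Convex ℝ K) (hKi : (interior K).Nonempty)
    (h : ∀ p ∈ interior K, ∀ q ∈ interior K, ‖g q - g p‖ₑ ≤ a * ‖q - p‖ₑ)
    {P Q : E2} (hP : P ∈ K) (hQ : Q ∈ K) : ‖g Q - g P‖ₑ ≤ a * ‖Q - P‖ₑ := by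
  by_cases htop : a = ⊤
  · rcases eq_or_ne P Q with rfl | hne
    · rw [sub_self, ← ofReal_norm, norm_zero, ENNReal.ofReal_zero]; exact zero_le
    · rw [htop, ENNReal.top_mul (by simpa [sub_eq_zero] using hne.symm)]; exact le_top
  have hmem : (P, Q) ∈ closure (interior K ×ˢ interior K) := by
    rw [closure_prod_eq, hK.closure_interior_eq_closure_of_nonempty_interior hKi]
    exact mk_mem_prod (subset_closure hP) (subset_closure hQ)
  have hsub : ∀ p ∈ interior K ×ˢ interior K,
      p ∈ {p : E2 × E2 | ‖g p.2 - g p.1‖ₑ ≤ a * ‖p.2 - p.1‖ₑ} := by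
    intro p hp
    rw [mem_prod] at hp
    rw [mem_ofPred_eq]
    exact h p.1 hp.1 p.2 hp.2
  have := closure_minimal hsub (isClosed_setOf_enorm_sub_le hg htop) hmem
  rwa [mem_ofPred_eq] at this

lemma GradBound.of_convex {w : E2 → E2} {H : E2 → E2 →L[ℝ] E2 →L[ℝ] E2} (h : GradBound w H)
    (hw : ContDiff ℝ 1 w) {K : Set E2} (hK : Convex ℝ K) (hKi : (interior K).Nonempty)
    {P Q : E2} (hP : P ∈ K) (hQ : Q ∈ K) :
    ‖fderiv ℝ w Q - fderiv ℝ w P‖ₑ ≤ linf H K * ‖Q - P‖ₑ := by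
  refine enorm_sub_le_of_interior (hw.continuous_fderiv (by norm_num)) hK hKi ?_ hP hQ
  intro p hp q hq
  refine (h _ isOpen_interior p q (hK.interior.segment_subset hp hq)).trans ?_
  exact mul_le_mul_left (linf_mono H interior_subset) _

/-- A convex set without interior points lies in a proper affine subspace, which is a null set. -/
lemma interior_nonempty_of_volume_ne_zero {A : Set E2} (hA : Convex ℝ A) (h : volume A ≠ 0) :
    (interior A).Nonempty := by
  rw [hA.interior_nonempty_iff_affineSpan_eq_top]
  by_contra hne
  exact h (measure_mono_null (subset_affineSpan ℝ A) (Measure.addHaar_affineSubspace _ _ hne))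

/-- If K degenerates, an essential supremum over K carries no information. The bound then holds for
every open neighbourhood of K, hence for the infimum over them. -/
lemma GradBound.linfHull {w : E2 → E2} {H : E2 → E2 →L[ℝ] E2 →L[ℝ] E2} (h : GradBound w H)
    (hw : ContDiff ℝ 1 w) {K : Set E2} (hK : Convex ℝ K)
    {P Q : E2} (hP : P ∈ K) (hQ : Q ∈ K) :
    ‖fderiv ℝ w Q - fderiv ℝ w P‖ₑ ≤ linfHull H K * ‖Q - P‖ₑ := by
  unfold ACVacancy.linfHull
  split_ifs with h0
  · rcases eq_or_ne P Q with rfl | hne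
    · rw [sub_self, ← ofReal_norm, norm_zero, ENNReal.ofReal_zero]; exact zero_le
    have hn : ‖Q - P‖ₑ ≠ 0 := by simpa [sub_eq_zero] using hne.symm
    rw [← ENNReal.div_le_iff hn enorm_ne_top]
    refine le_iInf fun U => le_iInf fun hU => le_iInf fun hKU => ?_
    rw [ENNReal.div_le_iff hn enorm_ne_top]
    exact h U hU P Q ((hK.segment_subset hP hQ).trans hKU)
  · exact h.of_convex hw hK (interior_nonempty_of_volume_ne_zero hK h0) hP hQ

lemma enorm_le_mul_iff {F : Type*} [SeminormedAddGroup F] {a : F} {A : ℝ≥0∞} (hA : A ≠ ⊤)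
    {c : ℝ} (hc : 0 ≤ c) : ‖a‖ₑ ≤ A * ENNReal.ofReal c ↔ ‖a‖ ≤ A.toReal * c := by
  rw [← ofReal_norm, ← ENNReal.ofReal_toReal hA, ← ENNReal.ofReal_mul ENNReal.toReal_nonneg,
    ENNReal.ofReal_le_ofReal_iff (by positivity), ENNReal.toReal_ofReal ENNReal.toReal_nonneg]

lemma hasDerivAt_comp_line {w : E2 → E2} (hw : ContDiff ℝ 1 w) (x r : E2) (s : ℝ) :
    HasDerivAt (fun s : ℝ => w (x + s • r)) (fderiv ℝ w (x + s • r) r) s := by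
  have h1 : HasDerivAt (fun s : ℝ => x + s • r) r s := by
    simpa using ((hasDerivAt_id s).smul_const r).const_add x
  exact ((hw.differentiable (by norm_num)) _).hasFDerivAt.comp_hasDerivAt s h1

lemma integral_fderiv_line {w : E2 → E2} (hw : ContDiff ℝ 1 w) (x r : E2) :
    ∫ s in (0 : ℝ)..1, fderiv ℝ w (x + s • r) r = w (x + r) - w x := by
  have := intervalIntegral.integral_eq_sub_of_hasDerivAt
    (fun s _ => hasDerivAt_comp_line hw x r s) (a := 0) (b := 1)
    (Continuous.intervalIntegrable (((hw.continuous_fderiv (by norm_num)).comp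
      (by fun_prop)).clm_apply continuous_const) _ _)
  simpa using this

/-- The directional derivative at a point of a bond differs from the difference quotient by at
most half of the second derivative. -/
lemma norm_fderiv_sub_bond_le {w : E2 → E2} (hw : ContDiff ℝ 1 w) {x r : E2} {t A : ℝ}
    (ht : t ∈ Icc (0 : ℝ) 1)
    (hA : ∀ s ∈ Icc (0 : ℝ) 1,
      ‖fderiv ℝ w (x + t • r) - fderiv ℝ w (x + s • r)‖ ≤ A * (|t - s| * ‖r‖)) (hA0 : 0 ≤ A) :
    ‖fderiv ℝ w (x + t • r) r - (w (x + r) - w x)‖ ≤ A * (1 / 2 * ‖r‖ ^ 2) := by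
  have hcont : Continuous fun s : ℝ => fderiv ℝ w (x + s • r) r :=
    ((hw.continuous_fderiv (by norm_num)).comp (by fun_prop)).clm_apply continuous_const
  have e1 : fderiv ℝ w (x + t • r) r - (w (x + r) - w x)
      = ∫ s in (0 : ℝ)..1, (fderiv ℝ w (x + t • r) r - fderiv ℝ w (x + s • r) r) := by
    rw [intervalIntegral.integral_sub intervalIntegrable_const (hcont.intervalIntegrable _ _),
      integral_fderiv_line hw]
    simp
  -- The majorant t(1−s) + s(1−t) of |t−s| is affine in s and has integral exactly 1/2 for every t.
  have e2 : A * (1 / 2 * ‖r‖ ^ 2) = ∫ s in (0 : ℝ)..1, A * ((t + s * (1 - 2 * t)) * ‖r‖ ^ 2) := by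
    rw [intervalIntegral.integral_const_mul, intervalIntegral.integral_mul_const,
      intervalIntegral.integral_add (f := fun _ => t) (g := fun s => s * (1 - 2 * t))
        intervalIntegrable_const ((by fun_prop : Continuous _).intervalIntegrable _ _),
      intervalIntegral.integral_mul_const, integral_id, intervalIntegral.integral_const,
      smul_eq_mul]
    ring
  rw [e1, e2]
  refine intervalIntegral.norm_integral_le_of_norm_le zero_le_one ?_
    (Continuous.intervalIntegrable (by fun_prop) _ _)
  refine Filter.Eventually.of_forall fun s hs => ?_
  have hs' : s ∈ Icc (0 : ℝ) 1 := ⟨hs.1.le, hs.2⟩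
  have h1 := ((fderiv ℝ w (x + t • r) - fderiv ℝ w (x + s • r)).le_opNorm r).trans
    (mul_le_mul_of_nonneg_right (hA s hs') (norm_nonneg r))
  have h2 : |t - s| ≤ t + s * (1 - 2 * t) := by
    rw [abs_le]
    constructor <;> nlinarith [ht.1, ht.2, hs'.1, hs'.2, mul_nonneg ht.1 (sub_nonneg.2 hs'.2),
      mul_nonneg hs'.1 (sub_nonneg.2 ht.2)]
  calc _ ≤ A * (|t - s| * ‖r‖) * ‖r‖ := h1
    _ = A * (|t - s| * ‖r‖ ^ 2) := by ring
    _ ≤ _ := by gcongr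

lemma GradBound.bond {w : E2 → E2} {H : E2 → E2 →L[ℝ] E2 →L[ℝ] E2} (h : GradBound w H)
    (hw : ContDiff ℝ 1 w) {K : Set E2} (hK : Convex ℝ K) {x r : E2} (hr : r ≠ 0)
    (hb : segment ℝ x (x + r) ⊆ K) {t : ℝ} (ht : t ∈ Icc (0 : ℝ) 1) :
    ‖fderiv ℝ w (x + t • r) r - (w (x + r) - w x)‖ₑ ≤
      ACVacancy.linfHull H K * ENNReal.ofReal (1 / 2 * ‖r‖ ^ 2) := by
  by_cases htop : ACVacancy.linfHull H K = ⊤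
  · rw [htop, ENNReal.top_mul]
    · exact le_top
    · have := norm_pos_iff.2 hr
      simp only [ne_eq, ENNReal.ofReal_eq_zero, not_le]; positivity
  rw [enorm_le_mul_iff htop (by positivity)]
  have hmem : ∀ s ∈ Icc (0 : ℝ) 1, x + s • r ∈ K := fun s hs =>
    hb (by rw [segment_eq_image']; exact ⟨s, hs, by simp⟩)
  refine norm_fderiv_sub_bond_le hw ht (fun s hs => ?_) ENNReal.toReal_nonneg
  have h1 := h.linfHull hw hK (hmem s hs) (hmem t ht)
  have e1 : x + t • r - (x + s • r) = (t - s) • r := by rw [sub_smul]; abel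
  rw [e1, ← ofReal_norm ((t - s) • r), enorm_le_mul_iff htop (norm_nonneg _), norm_smul,
    Real.norm_eq_abs] at h1
  exact h1

/-- A linear map that is small on two vectors is small if the angle between them is not. -/
lemma norm_apply_le_of_angle {M : E2 →L[ℝ] E2} {e₁ e₂ : E2} {σ A : ℝ} (hσ : 0 < σ)
    (hsin : σ ≤ Real.sin (InnerProductGeometry.angle e₁ e₂)) (h1 : ‖M e₁‖ ≤ A * ‖e₁‖)
    (h2 : ‖M e₂‖ ≤ A * ‖e₂‖) (hA : 0 ≤ A) (α β : ℝ) :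
    ‖M (α • e₁ + β • e₂)‖ ≤ 2 / σ * A * ‖α • e₁ + β • e₂‖ := by
  set c := Real.cos (InnerProductGeometry.angle e₁ e₂) with hc
  set s := Real.sin (InnerProductGeometry.angle e₁ e₂) with hs
  have hsc : s ^ 2 + c ^ 2 = 1 := Real.sin_sq_add_cos_sq _
  have hin : inner ℝ e₁ e₂ = c * (‖e₁‖ * ‖e₂‖) :=
    (InnerProductGeometry.cos_angle_mul_norm_mul_norm e₁ e₂).symm
  have hn : ‖α • e₁ + β • e₂‖ ^ 2
      = (α * ‖e₁‖) ^ 2 + 2 * c * (α * ‖e₁‖) * (β * ‖e₂‖) + (β * ‖e₂‖) ^ 2 := by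
    rw [norm_add_sq_real, norm_smul, norm_smul, mul_pow, mul_pow, real_inner_smul_left,
      real_inner_smul_right, hin, Real.norm_eq_abs, Real.norm_eq_abs, sq_abs, sq_abs]
    ring
  -- The difference of the two sides is (ca + b)². Hence each coefficient of a combination of two
  -- unit vectors is controlled by the norm of the combination divided by the sine of their angle.
  have key : ∀ a b : ℝ, s ^ 2 * a ^ 2 ≤ a ^ 2 + 2 * c * a * b + b ^ 2 := by
    intro a b
    have : s ^ 2 = 1 - c ^ 2 := by linarith
    rw [this]
    nlinarith [sq_nonneg (c * a + b)]
  have hb : ∀ a : ℝ, s ^ 2 * a ^ 2 ≤ ‖α • e₁ + β • e₂‖ ^ 2 →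
      |a| ≤ ‖α • e₁ + β • e₂‖ / σ := by
    intro a ha
    rw [le_div_iff₀ hσ]
    have h3 : |a| * σ ≤ |a| * s := by gcongr
    refine h3.trans (le_of_sq_le_sq ?_ (norm_nonneg _))
    rw [mul_pow, sq_abs]; linarith
  have hα := hb (α * ‖e₁‖) (by rw [hn]; exact key _ _)
  have hβ := hb (β * ‖e₂‖) (by rw [hn]; have := key (β * ‖e₂‖) (α * ‖e₁‖); linarith)
  rw [abs_mul, abs_norm] at hα hβ
  calc ‖M (α • e₁ + β • e₂)‖ ≤ |α| * ‖M e₁‖ + |β| * ‖M e₂‖ := by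
        rw [map_add, map_smul, map_smul]
        refine (norm_add_le _ _).trans_eq ?_
        rw [norm_smul, norm_smul, Real.norm_eq_abs, Real.norm_eq_abs]
    _ ≤ |α| * (A * ‖e₁‖) + |β| * (A * ‖e₂‖) := by gcongr
    _ = A * (|α| * ‖e₁‖) + A * (|β| * ‖e₂‖) := by ring
    _ ≤ A * (‖α • e₁ + β • e₂‖ / σ) + A * (‖α • e₁ + β • e₂‖ / σ) := by gcongr
    _ = _ := by ring

/-- The error of linear interpolation on a triangle. -/
lemma norm_interp_sub_le {w : E2 → E2} (hw : ContDiff ℝ 1 w) {T : Set E2} (hT : Convex ℝ T)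
    (hTb : Bornology.IsBounded T) {v₀ e₁ e₂ P : E2} (h0 : v₀ ∈ T) (h1 : v₀ + e₁ ∈ T)
    (h2 : v₀ + e₂ ∈ T) (hP : P ∈ T) {σ A : ℝ} (hσ : 0 < σ)
    (hsin : σ ≤ Real.sin (InnerProductGeometry.angle e₁ e₂)) (hA0 : 0 ≤ A)
    (hA : ∀ Q ∈ T, ‖fderiv ℝ w Q - fderiv ℝ w P‖ ≤ A * ‖Q - P‖) {L : E2 →L[ℝ] E2}
    (hL1 : L e₁ = w (v₀ + e₁) - w v₀) (hL2 : L e₂ = w (v₀ + e₂) - w v₀) (α β : ℝ) :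
    ‖L (α • e₁ + β • e₂) - fderiv ℝ w P (α • e₁ + β • e₂)‖ ≤
      2 / σ * (Metric.diam T * A) * ‖α • e₁ + β • e₂‖ := by
  have hb : ∀ Q ∈ T, ‖fderiv ℝ w Q - fderiv ℝ w P‖ ≤ Metric.diam T * A := by
    intro Q hQ
    refine (hA Q hQ).trans ?_
    rw [mul_comm, ← dist_eq_norm]
    gcongr
    exact Metric.dist_le_diam_of_mem hTb hQ hP
  have hmv : ∀ x ∈ T, ∀ y ∈ T,
      ‖w y - w x - fderiv ℝ w P (y - x)‖ ≤ Metric.diam T * A * ‖y - x‖ := fun x hx y hy =>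
    hT.norm_image_sub_le_of_norm_fderiv_le' (𝕜 := ℝ)
      (fun z _ => (hw.differentiable (by norm_num)) z) hb hx hy
  have hm1 := hmv _ h0 _ h1
  have hm2 := hmv _ h0 _ h2
  rw [add_sub_cancel_left] at hm1 hm2
  exact norm_apply_le_of_angle (M := L - fderiv ℝ w P) hσ hsin
    (by simpa [hL1] using hm1) (by simpa [hL2] using hm2) (by positivity) α β


/-! ### Lattice coordinates -/

/-- First lattice coordinate. -/
noncomputable def cα : E2 →L[ℝ] ℝ :=
  EuclideanSpace.proj 0 - (1 / √3) • EuclideanSpace.proj 1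

/-- Second lattice coordinate. -/
noncomputable def cβ : E2 →L[ℝ] ℝ := (2 / √3) • EuclideanSpace.proj 1

lemma cα_apply (x : E2) : cα x = x 0 - 1 / √3 * x 1 := by simp [cα]
lemma cβ_apply (x : E2) : cβ x = 2 / √3 * x 1 := by simp [cβ]

@[simp] lemma cα_a1 : cα a1 = 1 := by simp [cα_apply, a1]
@[simp] lemma cβ_a1 : cβ a1 = 0 := by simp [cβ_apply, a1]
@[simp] lemma cα_a2 : cα a2 = 0 := by
  have : √3 ≠ 0 := by positivity
  simp [cα_apply, a2]; field_simp; norm_num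
@[simp] lemma cβ_a2 : cβ a2 = 1 := by
  have : √3 ≠ 0 := by positivity
  simp [cβ_apply, a2]

lemma eq_lat_coord (x : E2) : x = cα x • a1 + cβ x • a2 := by
  have : √3 ≠ 0 := by positivity
  ext i; fin_cases i
  · simp [cα_apply, cβ_apply, a1, a2]; ring
  · simp [cα_apply, cβ_apply, a1, a2]; field_simp

lemma ext_lat {x y : E2} (h1 : cα x = cα y) (h2 : cβ x = cβ y) : x = y := by
  rw [eq_lat_coord x, eq_lat_coord y, h1, h2]

lemma norm_sq_lat (x : E2) : ‖x‖ ^ 2 = cα x ^ 2 + cα x * cβ x + cβ x ^ 2 := by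
  have h3 : √3 ^ 2 = 3 := Real.sq_sqrt (by norm_num)
  have : √3 ≠ 0 := by positivity
  rw [EuclideanSpace.norm_sq_eq, Fin.sum_univ_two, cα_apply, cβ_apply]
  simp only [Real.norm_eq_abs, sq_abs]
  have h4 : (1 / √3) ^ 2 = 1 / 3 := by rw [div_pow, h3]; norm_num
  have h5 : 2 / √3 = 2 * (1 / √3) := by ring
  rw [h5]
  linear_combination (-(x 1) ^ 2 * 3) * h4

lemma mem_Lat_iff {x : E2} : x ∈ Lat ↔ ∃ i j : ℤ, cα x = i ∧ cβ x = j := by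
  constructor
  · rintro ⟨i, j, rfl⟩
    exact ⟨i, j, by simp, by simp⟩
  · rintro ⟨i, j, hi, hj⟩
    exact ⟨i, j, by rw [← hi, ← hj]; exact eq_lat_coord x⟩

/-- The lattice as a group. -/
def latG : AddSubgroup E2 where
  carrier := Lat
  zero_mem' := mem_Lat_iff.2 ⟨0, 0, by simp, by simp⟩
  add_mem' := by
    intro x y hx hy
    obtain ⟨i, j, hi, hj⟩ := mem_Lat_iff.1 hx
    obtain ⟨k, l, hk, hl⟩ := mem_Lat_iff.1 hy
    exact mem_Lat_iff.2 ⟨i + k, j + l, by simp [hi, hk], by simp [hj, hl]⟩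
  neg_mem' := by
    intro x hx
    obtain ⟨i, j, hi, hj⟩ := mem_Lat_iff.1 hx
    exact mem_Lat_iff.2 ⟨-i, -j, by simp [hi], by simp [hj]⟩

lemma mem_perLat_iff {N : ℕ} {x : E2} :
    x ∈ perLat N ↔ ∃ i j : ℤ, cα x = i * N ∧ cβ x = j * N := by
  constructor
  · rintro ⟨i, j, rfl⟩
    exact ⟨i, j, by simp, by simp⟩
  · rintro ⟨i, j, hi, hj⟩
    exact ⟨i, j, by rw [← hi, ← hj]; exact eq_lat_coord x⟩

/-- The group of periods. -/
def perG (N : ℕ) : AddSubgroup E2 where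
  carrier := perLat N
  zero_mem' := mem_perLat_iff.2 ⟨0, 0, by simp, by simp⟩
  add_mem' := by
    intro x y hx hy
    obtain ⟨i, j, hi, hj⟩ := mem_perLat_iff.1 hx
    obtain ⟨k, l, hk, hl⟩ := mem_perLat_iff.1 hy
    exact mem_perLat_iff.2 ⟨i + k, j + l, by simp [hi, hk, add_mul], by simp [hj, hl, add_mul]⟩
  neg_mem' := by
    intro x hx
    obtain ⟨i, j, hi, hj⟩ := mem_perLat_iff.1 hx
    exact mem_perLat_iff.2 ⟨-i, -j, by simp [hi], by simp [hj]⟩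

lemma perLat_sub_Lat (N : ℕ) : perLat N ⊆ Lat := by
  intro x hx
  obtain ⟨i, j, hi, hj⟩ := mem_perLat_iff.1 hx
  exact mem_Lat_iff.2 ⟨i * N, j * N, by simp [hi], by simp [hj]⟩

lemma mem_cell_iff {N : ℕ} {x : E2} :
    x ∈ cell N ↔ cα x ∈ Ioc (0 : ℝ) N ∧ cβ x ∈ Ioc (0 : ℝ) N := by
  constructor
  · rintro ⟨s, hs, t, ht, rfl⟩
    simpa using ⟨hs, ht⟩
  · rintro ⟨h1, h2⟩
    exact ⟨_, h1, _, h2, eq_lat_coord x⟩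

instance countable_Lat : Countable Lat := by
  refine (Set.countable_range fun p : ℤ × ℤ => (p.1 : ℝ) • a1 + (p.2 : ℝ) • a2).mono ?_
  rintro x ⟨i, j, rfl⟩
  exact ⟨(i, j), rfl⟩

instance countable_latG : Countable latG := countable_Lat

instance countable_perLat (N : ℕ) : Countable (perLat N) :=
  Set.Countable.mono (perLat_sub_Lat N) (countable_Lat : Lat.Countable)

/-! ### The density of lattice bonds -/

/-- The unit cell of the lattice. -/
def unitCell : Set E2 := {x | cα x ∈ Ico (0 : ℝ) 1 ∧ cβ x ∈ Ico (0 : ℝ) 1}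

lemma measurableSet_unitCell : MeasurableSet unitCell :=
  (cα.measurable measurableSet_Ico).inter (cβ.measurable measurableSet_Ico)

lemma volume_unitCell : volume unitCell = ENNReal.ofReal (√3 / 2) := by
  have h3 : √3 ≠ 0 := by positivity
  set A : Matrix (Fin 2) (Fin 2) ℝ := !![1, -(1 / √3); 0, 2 / √3] with hA
  have hdet : LinearMap.det (Matrix.toLin' A) = 2 / √3 := by
    rw [LinearMap.det_toLin', hA, Matrix.det_fin_two_of]; ring
  have h1 := Measure.addHaar_preimage_linearMap (volume : Measure (Fin 2 → ℝ))
    (f := Matrix.toLin' A) (by rw [hdet]; positivity) (Set.pi univ fun _ => Ico 0 1)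
  rw [hdet, Real.volume_pi_Ico] at h1
  have hm : MeasurableSet (Matrix.toLin' A ⁻¹' Set.pi univ fun _ => Ico (0 : ℝ) 1) :=
    (LinearMap.continuous_of_finiteDimensional _).measurable
      (MeasurableSet.univ_pi fun _ => measurableSet_Ico)
  have h2 := (PiLp.volume_preserving_ofLp (Fin 2)).measure_preimage hm.nullMeasurableSet
  rw [h1] at h2
  have h4 : unitCell
      = WithLp.ofLp ⁻¹' (Matrix.toLin' A ⁻¹' Set.pi univ fun _ => Ico (0 : ℝ) 1) := by
    ext x
    simp [unitCell, cα_apply, cβ_apply, hA, Fin.forall_fin_two, dotProduct,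
      Fin.sum_univ_two, sub_lt_iff_lt_add']
    intros
    rw [add_comm]
  rw [h4, h2, abs_of_nonneg (by positivity)]
  simp

lemma isAddFundamentalDomain_unitCell : IsAddFundamentalDomain latG unitCell volume := by
  refine IsAddFundamentalDomain.mk' measurableSet_unitCell.nullMeasurableSet fun x => ?_
  have hz : -((⌊cα x⌋ : ℝ) • a1 + (⌊cβ x⌋ : ℝ) • a2) ∈ latG :=
    neg_mem (⟨_, _, rfl⟩ : _ ∈ Lat)
  refine ⟨⟨_, hz⟩, ?_, ?_⟩
  · constructor
    · simp [AddSubgroup.vadd_def, Int.floor_le]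
    · simp [AddSubgroup.vadd_def, Int.floor_le]
  · rintro ⟨z, hz'⟩ ⟨h1, h2⟩
    obtain ⟨i, j, hi, hj⟩ := mem_Lat_iff.1 hz'
    simp only [AddSubgroup.vadd_def, vadd_eq_add, map_add, hi, hj] at h1 h2
    have e1 : ⌊cα x⌋ = -i := by
      rw [Int.floor_eq_iff]; push_cast; constructor <;> linarith [h1.1, h1.2]
    have e2 : ⌊cβ x⌋ = -j := by
      rw [Int.floor_eq_iff]; push_cast; constructor <;> linarith [h2.1, h2.2]
    refine Subtype.ext (ext_lat ?_ ?_)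
    · simp [hi, e1]
    · simp [hj, e2]


/-- The open triangle. -/
def triOpen (b : AffineBasis (Fin 3) ℝ E2) : Set E2 := {P | ∀ i, 0 < b.coord i P}

/-- The closed triangle without its vertices. -/
def triMid (b : AffineBasis (Fin 3) ℝ E2) : Set E2 :=
  {P | ∀ i, 0 ≤ b.coord i P} \ range b

/-- The weight of a point with respect to a triangle: one inside, one half on the edges. -/
noncomputable def triWeight (b : AffineBasis (Fin 3) ℝ E2) (P : E2) : ℝ≥0∞ :=
  2⁻¹ * ((triOpen b).indicator 1 P + (triMid b).indicator 1 P)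

section density

variable (b : AffineBasis (Fin 3) ℝ E2)

lemma continuous_coord (i : Fin 3) : Continuous (b.coord i) :=
  (b.coord i).continuous_of_finiteDimensional

lemma isOpen_triOpen : IsOpen (triOpen b) := by
  simp only [triOpen, ofPred_forall]
  exact isOpen_iInter_of_finite fun i => isOpen_lt continuous_const (continuous_coord b i)

lemma measurableSet_triMid : MeasurableSet (triMid b) := by
  refine MeasurableSet.diff ?_ (Set.finite_range b).measurableSet
  simp only [ofPred_forall]
  exact MeasurableSet.iInter fun i =>
    (isClosed_le continuous_const (continuous_coord b i)).measurableSet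

lemma coord_sum (P : E2) : b.coord 0 P + b.coord 1 P + b.coord 2 P = 1 := by
  have := b.sum_coord_apply_eq_one P
  rwa [Fin.sum_univ_three] at this

lemma ext_coord {P Q : E2} (h1 : b.coord 1 P = b.coord 1 Q) (h2 : b.coord 2 P = b.coord 2 Q) :
    P = Q := by
  rw [← b.linear_combination_coord_eq_self P, ← b.linear_combination_coord_eq_self Q]
  simp only [Fin.sum_univ_three, h1, h2]
  have := coord_sum b P
  have := coord_sum b Q
  congr 3
  linarith

/-- The linear part of a barycentric coordinate. -/
noncomputable def cl (i : Fin 3) : E2 →L[ℝ] ℝ :=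
  LinearMap.toContinuousLinearMap (b.coord i).linear

lemma coord_add_vec (i : Fin 3) (z P : E2) : b.coord i (z + P) = cl b i z + b.coord i P :=
  (b.coord i).map_vadd P z

lemma cl_sub (i : Fin 3) (P Q : E2) : cl b i (P - Q) = b.coord i P - b.coord i Q := by
  have := coord_add_vec b i (P - Q) Q
  rw [sub_add_cancel] at this
  linarith

lemma coord_add (i : Fin 3) (P Q R : E2) :
    b.coord i (P + Q - R) = b.coord i P + b.coord i Q - b.coord i R := by
  have := coord_add_vec b i (P - R) Q
  rw [cl_sub] at this
  rw [show P + Q - R = P - R + Q by abel, this]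
  ring

/-- The reflection of a triangle to the second half of a parallelogram. -/
noncomputable def refl12 (P : E2) : E2 := b 1 + b 2 - P

lemma coord_refl (P : E2) : b.coord 1 (refl12 b P) = 1 - b.coord 1 P ∧
    b.coord 2 (refl12 b P) = 1 - b.coord 2 P ∧
    b.coord 0 (refl12 b P) = b.coord 1 P + b.coord 2 P - 1 := by
  have := coord_sum b P
  refine ⟨?_, ?_, ?_⟩ <;> (rw [refl12, coord_add]; simp; try linarith)

/-- The parallelogram, half open. -/
def par : Set E2 := {P | b.coord 1 P ∈ Ico (0 : ℝ) 1 ∧ b.coord 2 P ∈ Ico (0 : ℝ) 1}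

/-- The parallelogram, half open on the other sides. -/
def par' : Set E2 := {P | b.coord 1 P ∈ Ioc (0 : ℝ) 1 ∧ b.coord 2 P ∈ Ioc (0 : ℝ) 1}

lemma measurableSet_par : MeasurableSet (par b) :=
  ((continuous_coord b 1).measurable measurableSet_Ico).inter
    ((continuous_coord b 2).measurable measurableSet_Ico)

lemma measurableSet_par' : MeasurableSet (par' b) :=
  ((continuous_coord b 1).measurable measurableSet_Ioc).inter
    ((continuous_coord b 2).measurable measurableSet_Ioc)

/-- The counting behind the tiling by a triangle and its reflection. The intended reading: p, q are
membership in the open and the punctured closed triangle, r, s the same for the reflected point, and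
t, u membership in the two half-open parallelograms. -/
lemma six_indicator {p q r s t u : Prop} [Decidable p] [Decidable q] [Decidable r] [Decidable s]
    [Decidable t] [Decidable u] (h1 : p → ¬ r ∧ ¬ s ∧ t ∧ u) (h2 : r → ¬ q ∧ t ∧ u)
    (h3 : q → s → t ∧ u) (h4 : q → t ∨ u) (h5 : s → t ∨ u) :
    ((if p then 1 else 0) + (if q then 1 else 0) + ((if r then 1 else 0) + (if s then 1 else 0))
      : ℝ≥0∞) ≤ (if t then 1 else 0) + (if u then 1 else 0) := by
  by_cases hp : p <;> by_cases hq : q <;> by_cases hr : r <;> by_cases hs : s <;>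
    by_cases ht : t <;> by_cases hu : u <;> simp_all

/-- A point inside either triangle is counted twice and lies in both half-open parallelograms. A
point inside the common diagonal is counted once for each triangle and also lies in both. A point on
an outer side is counted once and lies in at least one. The vertices b 1 and b 2 lie in neither
parallelogram, which is why vertices are removed from the closed triangle. -/
lemma tri_tiling (P : E2) :
    (triOpen b).indicator 1 P + (triMid b).indicator 1 P +
      ((triOpen b).indicator 1 (refl12 b P) + (triMid b).indicator 1 (refl12 b P)) ≤
    (par b).indicator 1 P + (par' b).indicator (1 : E2 → ℝ≥0∞) P := by
  classical
  obtain ⟨r1, r2, r0⟩ := coord_refl b P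
  have hs := coord_sum b P
  have hv : ∀ X : E2, X ∉ range b → ¬ (b.coord 1 X = 0 ∧ b.coord 2 X = 0) ∧
      ¬ (b.coord 1 X = 1 ∧ b.coord 2 X = 0) ∧ ¬ (b.coord 1 X = 0 ∧ b.coord 2 X = 1) := by
    intro X hX
    refine ⟨fun h => hX ⟨0, ?_⟩, fun h => hX ⟨1, ?_⟩, fun h => hX ⟨2, ?_⟩⟩ <;>
      refine ext_coord b ?_ ?_ <;> simp [h.1, h.2]
  have hvP := hv P
  have hvR := hv (refl12 b P)
  rw [r1, r2] at hvR
  simp only [Set.indicator_apply, Pi.one_apply]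
  have m0 : ∀ X : E2, X ∈ triOpen b ↔ 0 < b.coord 0 X ∧ 0 < b.coord 1 X ∧ 0 < b.coord 2 X := by
    intro X; simp [triOpen, Fin.forall_fin_succ]
  have m1 : ∀ X : E2, X ∈ triMid b ↔ (0 ≤ b.coord 0 X ∧ 0 ≤ b.coord 1 X ∧ 0 ≤ b.coord 2 X) ∧
      X ∉ range b := by
    intro X; simp [triMid, Fin.forall_fin_succ]
  have m2 : P ∈ par b ↔ (0 ≤ b.coord 1 P ∧ b.coord 1 P < 1) ∧
    (0 ≤ b.coord 2 P ∧ b.coord 2 P < 1) := Iff.rfl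
  have m3 : P ∈ par' b ↔ (0 < b.coord 1 P ∧ b.coord 1 P ≤ 1) ∧
    (0 < b.coord 2 P ∧ b.coord 2 P ≤ 1) := Iff.rfl
  obtain ⟨c, hc⟩ : ∃ c, b.coord 1 P = c := ⟨_, rfl⟩
  obtain ⟨d, hd⟩ : ∃ d, b.coord 2 P = d := ⟨_, rfl⟩
  rw [hc] at r1 m2 m3 r0
  rw [hd] at r2 m2 m3 r0
  rw [hc, hd] at hvP hs hvR
  have h0 : b.coord 0 P = 1 - c - d := by linarith
  refine six_indicator ?_ ?_ ?_ ?_ ?_ <;> simp only [m0, m1, m2, m3, r0, r1, r2, h0, hc, hd]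
  · rintro ⟨h1, h2, h3⟩
    refine ⟨fun h => ?_, fun h => ?_, ⟨⟨?_, ?_⟩, ?_, ?_⟩, ⟨?_, ?_⟩, ?_, ?_⟩
    · linarith [h.1]
    · linarith [h.1.1]
    all_goals linarith
  · rintro ⟨h1, h2, h3⟩
    refine ⟨fun h => ?_, ⟨⟨?_, ?_⟩, ?_, ?_⟩, ⟨?_, ?_⟩, ?_, ?_⟩
    · linarith [h.1.1]
    all_goals linarith
  · rintro ⟨⟨h1, h2, h3⟩, h4⟩ ⟨⟨h5, h6, h7⟩, h8⟩
    obtain ⟨k1, k2, k3⟩ := hvP h4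
    have hcd : c + d = 1 := by linarith
    have c0 : 0 < c := lt_of_le_of_ne h2 fun h => k3 ⟨h.symm, by linarith⟩
    have d0 : 0 < d := lt_of_le_of_ne h3 fun h => k2 ⟨by linarith, h.symm⟩
    refine ⟨⟨⟨?_, ?_⟩, ?_, ?_⟩, ⟨?_, ?_⟩, ?_, ?_⟩ <;> linarith
  · rintro ⟨⟨h1, h2, h3⟩, h4⟩
    obtain ⟨k1, k2, k3⟩ := hvP h4
    by_cases hc : c = 1
    · exact absurd ⟨hc, by linarith⟩ k2
    by_cases hd : d = 1
    · exact absurd ⟨by linarith, hd⟩ k3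
    left
    have : c < 1 := lt_of_le_of_ne (by linarith) hc
    have : d < 1 := lt_of_le_of_ne (by linarith) hd
    refine ⟨⟨?_, ?_⟩, ?_, ?_⟩ <;> linarith
  · rintro ⟨⟨h1, h2, h3⟩, h4⟩
    obtain ⟨k1, k2, k3⟩ := hvR h4
    by_cases hc : c = 0
    · exact absurd ⟨by linarith, by linarith⟩ k2
    by_cases hd : d = 0
    · exact absurd ⟨by linarith, by linarith⟩ k3
    right
    have : 0 < c := lt_of_le_of_ne (by linarith) (Ne.symm hc)
    have : 0 < d := lt_of_le_of_ne (by linarith) (Ne.symm hd)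
    refine ⟨⟨?_, ?_⟩, ?_, ?_⟩ <;> linarith

/-- The sublattice that is spanned by the edges of the triangle. -/
def subLat : AddSubgroup latG where
  carrier := {z | ∃ i j : ℤ, cl b 1 (z : E2) = i ∧ cl b 2 (z : E2) = j}
  zero_mem' := ⟨0, 0, by simp, by simp⟩
  add_mem' := by
    rintro x y ⟨i, j, hi, hj⟩ ⟨k, l, hk, hl⟩
    exact ⟨i + k, j + l, by simp [hi, hk], by simp [hj, hl]⟩
  neg_mem' := by
    rintro x ⟨i, j, hi, hj⟩
    exact ⟨-i, -j, by simp [hi], by simp [hj]⟩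

/-- The number of cosets of the sublattice. -/
noncomputable def latIndex : ℝ≥0∞ := ∑' _ : latG ⧸ subLat b, 1

variable {b} in
/-- Any set that contains exactly one point of each orbit of the sublattice is met by the lattice
with constant density. -/
lemma tsum_indicator_eq_latIndex {A : Set E2} {I : Set ℝ}
    (hA : A = {P | b.coord 1 P ∈ I ∧ b.coord 2 P ∈ I})
    (hI : ∀ c : ℝ, ∃! i : ℤ, c + i ∈ I) (hb : ∀ i, b i ∈ Lat) (P : E2) :
    ∑' x : latG, A.indicator (1 : E2 → ℝ≥0∞) (x + P) = latIndex b := by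
  -- The lattice is split into cosets of the sublattice spanned by the edges; each coset has exactly
  -- one point whose translate by P lies in A.
  rw [← (Equiv.sigmaFiberEquiv (QuotientAddGroup.mk (s := subLat b))).tsum_eq, ENNReal.tsum_sigma',
    latIndex]
  refine tsum_congr fun q => ?_
  obtain ⟨x0, rfl⟩ := QuotientAddGroup.mk_surjective q
  have hmem : ∀ x : latG, (QuotientAddGroup.mk x : latG ⧸ subLat b) = QuotientAddGroup.mk x0 ↔
      ∃ i j : ℤ, cl b 1 (x : E2) = cl b 1 (x0 : E2) + i ∧
        cl b 2 (x : E2) = cl b 2 (x0 : E2) + j := by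
    intro x
    rw [eq_comm, QuotientAddGroup.eq]
    have : -x0 + x ∈ subLat b ↔ ∃ i j : ℤ, cl b 1 ((-x0 + x : latG) : E2) = i ∧
        cl b 2 ((-x0 + x : latG) : E2) = j := Iff.rfl
    rw [this]
    refine exists_congr fun i => exists_congr fun j => ?_
    rw [AddSubgroup.coe_add, AddSubgroup.coe_neg, map_add, map_add, map_neg, map_neg]
    constructor <;> rintro ⟨h1, h2⟩ <;> constructor <;> linarith
  obtain ⟨i, hi, hiu⟩ := hI (b.coord 1 (x0 + P))
  obtain ⟨j, hj, hju⟩ := hI (b.coord 2 (x0 + P))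
  -- Adding integer multiples of the edges shifts the barycentric coordinates 1 and 2 independently
  -- by integers, so i and j are the unique shifts into I.
  have hz : (x0 : E2) + (i : ℝ) • (b 1 - b 0) + (j : ℝ) • (b 2 - b 0) ∈ latG := by
    rw [Int.cast_smul_eq_zsmul, Int.cast_smul_eq_zsmul]
    exact add_mem (add_mem x0.2 (zsmul_mem (sub_mem (hb 1) (hb 0)) _))
      (zsmul_mem (sub_mem (hb 2) (hb 0)) _)
  set z : latG := ⟨_, hz⟩ with hzd
  have z1 : cl b 1 (z : E2) = cl b 1 (x0 : E2) + i := by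
    simp only [hzd, map_add, map_smul, cl_sub]; simp
  have z2 : cl b 2 (z : E2) = cl b 2 (x0 : E2) + j := by
    simp only [hzd, map_add, map_smul, cl_sub]; simp
  have hzm := (hmem z).2 ⟨i, j, z1, z2⟩
  rw [tsum_eq_single ⟨z, hzm⟩]
  · rw [Set.indicator_of_mem, Pi.one_apply]
    rw [hA, mem_ofPred_eq]
    simp only [Equiv.sigmaFiberEquiv_apply, coord_add_vec, z1, z2] at hi hj ⊢
    exact ⟨by convert hi using 1; ring, by convert hj using 1; ring⟩
  · rintro ⟨x, hx⟩ hne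
    rw [Set.indicator_of_notMem]
    rw [hA, mem_ofPred_eq]
    rintro ⟨h1, h2⟩
    obtain ⟨k, l, hk, hl'⟩ := (hmem x).1 hx
    apply hne
    simp only [Equiv.sigmaFiberEquiv_apply, coord_add_vec, hk, hl'] at h1 h2 hiu hju
    have e1 : k = i := hiu k (by convert h1 using 1; ring)
    have e2 : l = j := hju l (by convert h2 using 1; ring)
    refine Subtype.ext (Subtype.ext ?_)
    have k1 := coord_add_vec b 1 x 0
    have k2 := coord_add_vec b 2 x 0
    have k3 := coord_add_vec b 1 z 0
    have k4 := coord_add_vec b 2 z 0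
    rw [add_zero] at k1 k2 k3 k4
    exact ext_coord b (by rw [k1, k3, hk, z1, e1]) (by rw [k2, k4, hl', z2, e2])

lemma existsUnique_add_int_Ico (c : ℝ) : ∃! i : ℤ, c + i ∈ Ico (0 : ℝ) 1 := by
  refine ⟨-⌊c⌋, ⟨by push_cast; linarith [Int.floor_le c],
    by push_cast; linarith [Int.lt_floor_add_one c]⟩, fun i hi => ?_⟩
  have : ⌊c⌋ = -i := by
    rw [Int.floor_eq_iff]; push_cast; constructor <;> linarith [hi.1, hi.2]
  omega

lemma existsUnique_add_int_Ioc (c : ℝ) : ∃! i : ℤ, c + i ∈ Ioc (0 : ℝ) 1 := by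
  refine ⟨1 - ⌈c⌉, ⟨by push_cast; linarith [Int.ceil_lt_add_one c],
    by push_cast; linarith [Int.le_ceil c]⟩, fun i hi => ?_⟩
  have : ⌈c⌉ = 1 - i := by
    rw [Int.ceil_eq_iff]; push_cast; constructor <;> linarith [hi.1, hi.2]
  omega

lemma tri_eq_nonneg_coord : convexHull ℝ (range b) = {P | ∀ i, 0 ≤ b.coord i P} :=
  b.convexHull_eq_nonneg_coord

lemma volume_par_le : volume (par b) ≤ 2 * volume (convexHull ℝ (range b)) := by
  have hsub : par b ⊆ convexHull ℝ (range b) ∪ refl12 b ⁻¹' convexHull ℝ (range b) := by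
    rintro P ⟨h1, h2⟩
    obtain ⟨r1, r2, r0⟩ := coord_refl b P
    have hs := coord_sum b P
    rw [tri_eq_nonneg_coord, mem_union, mem_preimage, mem_ofPred_eq, mem_ofPred_eq]
    rcases le_total (b.coord 1 P + b.coord 2 P) 1 with h | h
    · left
      intro i; fin_cases i
      · show 0 ≤ b.coord 0 P; linarith
      · exact h1.1
      · exact h2.1
    · right
      intro i; fin_cases i
      · show 0 ≤ b.coord 0 (refl12 b P); linarith
      · show 0 ≤ b.coord 1 (refl12 b P); linarith [h1.2]
      · show 0 ≤ b.coord 2 (refl12 b P); linarith [h2.2]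
  have hmeas : MeasurableSet (convexHull ℝ (range b)) :=
    ((Set.finite_range b).isCompact_convexHull ℝ).isClosed.measurableSet
  refine (measure_mono hsub).trans ((measure_union_le _ _).trans_eq ?_)
  rw [two_mul]
  congr 1
  exact (Measure.measurePreserving_sub_left volume (b 1 + b 2)).measure_preimage
    hmeas.nullMeasurableSet

/-- The number of lattice translates of a point that fall into the parallelogram does not depend on
the point. Integrating it over the unit cell unfolds to the area of the parallelogram. -/
lemma latIndex_mul_volume (hb : ∀ i, b i ∈ Lat) :
    latIndex b * volume unitCell ≤ 2 * volume (convexHull ℝ (range b)) := by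
  have h1 := isAddFundamentalDomain_unitCell.lintegral_eq_tsum'
    ((par b).indicator (1 : E2 → ℝ≥0∞))
  rw [lintegral_indicator_one (measurableSet_par b)] at h1
  refine le_trans (le_of_eq ?_) (volume_par_le b)
  rw [h1, ← lintegral_tsum]
  · have : ∀ P : E2, ∑' x : latG, (par b).indicator (1 : E2 → ℝ≥0∞) (-x +ᵥ P) = latIndex b := by
      intro P
      rw [← tsum_indicator_eq_latIndex (A := par b) (I := Ico 0 1) rfl existsUnique_add_int_Ico hb P,
        ← (Equiv.neg latG).tsum_eq]
      exact tsum_congr fun x => by simp [AddSubgroup.vadd_def]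
    simp_rw [this]
    rw [lintegral_const, Measure.restrict_apply_univ]
  · intro x
    exact ((measurable_one.indicator (measurableSet_par b)).comp
      (measurable_const_vadd _)).aemeasurable

/-- The point reflection takes a lattice bond of direction r to another lattice bond of the same
direction run through backwards: x becomes b 1 + b 2 − r − x and t becomes 1 − t. -/
lemma tsum_lintegral_refl {A : Set E2} (hb : ∀ i, b i ∈ Lat) {r : E2} (hr : r ∈ Lat) :
    ∑' x : latG, ∫⁻ t in Icc (0 : ℝ) 1, A.indicator (1 : E2 → ℝ≥0∞) (refl12 b (x + t • r)) =
      ∑' x : latG, ∫⁻ t in Icc (0 : ℝ) 1, A.indicator (1 : E2 → ℝ≥0∞) (x + t • r) := by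
  set p : latG := ⟨b 1 + b 2 - r, sub_mem (add_mem (hb 1) (hb 2)) hr⟩ with hp
  rw [← (Equiv.subLeft p).tsum_eq (fun x : latG =>
    ∫⁻ t in Icc (0 : ℝ) 1, A.indicator (1 : E2 → ℝ≥0∞) (x + t • r))]
  refine tsum_congr fun x => ?_
  have h := (Measure.measurePreserving_sub_left (volume : Measure ℝ) 1).setLIntegral_comp_preimage_emb
    (MeasurableEquiv.subLeft (1 : ℝ)).measurableEmbedding
    (fun t => A.indicator (1 : E2 → ℝ≥0∞) ((p - x : latG) + t • r)) (Icc 0 1)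
  rw [preimage_const_sub_Icc, sub_self, sub_zero] at h
  simp only [Equiv.subLeft_apply]
  rw [← h]
  refine lintegral_congr fun t => ?_
  congr 1
  rw [refl12, AddSubgroup.coe_sub, hp]
  simp only [sub_smul, one_smul]
  abel

/-- The weights of a lattice triangle at the points of all lattice bonds of a given direction add
up to its area. -/
theorem tsum_lintegral_triWeight_le (hb : ∀ i, b i ∈ Lat) {r : E2} (hr : r ∈ Lat) :
    ∑' x : latG, ∫⁻ t in Icc (0 : ℝ) 1, triWeight b (x + t • r) ≤
      volume (convexHull ℝ (range b)) / volume unitCell := by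
  have hm0 := (isOpen_triOpen b).measurableSet
  have hm1 := measurableSet_triMid b
  have hmeas : ∀ {A : Set E2}, MeasurableSet A → ∀ x : latG,
      Measurable fun t : ℝ => A.indicator (1 : E2 → ℝ≥0∞) (x + t • r) := fun hA x =>
    (measurable_one.indicator hA).comp (by fun_prop)
  have hmeasr : ∀ {A : Set E2}, MeasurableSet A → ∀ x : latG,
      Measurable fun t : ℝ => A.indicator (1 : E2 → ℝ≥0∞) (refl12 b (x + t • r)) := fun hA x =>
    (measurable_one.indicator hA).comp (by unfold refl12; fun_prop)
  have hm01 : ∀ x : latG, Measurable fun t : ℝ =>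
      (triOpen b).indicator (1 : E2 → ℝ≥0∞) (x + t • r) + (triMid b).indicator 1 (x + t • r) :=
    fun x => (hmeas hm0 x).add (hmeas hm1 x)
  set S : Set E2 → ℝ≥0∞ := fun A =>
    ∑' x : latG, ∫⁻ t in Icc (0 : ℝ) 1, A.indicator (1 : E2 → ℝ≥0∞) (x + t • r) with hS
  have hpar : ∀ {A : Set E2} {I : Set ℝ}, MeasurableSet A →
      A = {P | b.coord 1 P ∈ I ∧ b.coord 2 P ∈ I} → (∀ c : ℝ, ∃! i : ℤ, c + i ∈ I) →
      S A = latIndex b := by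
    intro A I hAm hA hI
    simp only [hS]
    rw [← lintegral_tsum fun x => (hmeas hAm x).aemeasurable]
    simp_rw [tsum_indicator_eq_latIndex hA hI hb]
    simp
  -- By reflection symmetry one of the two equal halves may be evaluated on the reflected triangle;
  -- then the pointwise tiling inequality applies.
  have hsum : S (triOpen b) + S (triMid b) + (S (triOpen b) + S (triMid b)) ≤
      S (par b) + S (par' b) := by
    have e1 : S (triOpen b) + S (triMid b) + (S (triOpen b) + S (triMid b)) =
        ∑' x : latG, ∫⁻ t in Icc (0 : ℝ) 1, ((triOpen b).indicator 1 ((x : E2) + t • r) +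
          (triMid b).indicator 1 (x + t • r) +
          ((triOpen b).indicator 1 (refl12 b (x + t • r)) +
            (triMid b).indicator 1 (refl12 b (x + t • r)))) := by
      conv_lhs =>
        rhs
        simp only [hS]
        rw [← tsum_lintegral_refl b hb hr, ← tsum_lintegral_refl b hb hr]
      simp only [hS]
      rw [← ENNReal.tsum_add, ← ENNReal.tsum_add, ← ENNReal.tsum_add]
      refine tsum_congr fun x => ?_
      rw [lintegral_add_left (hm01 x),
        lintegral_add_left (hmeas hm0 x), lintegral_add_left (hmeasr hm0 x)]
    have e2 : S (par b) + S (par' b) = ∑' x : latG, ∫⁻ t in Icc (0 : ℝ) 1,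
        ((par b).indicator 1 ((x : E2) + t • r) + (par' b).indicator 1 (x + t • r)) := by
      simp only [hS]
      rw [← ENNReal.tsum_add]
      refine tsum_congr fun x => ?_
      rw [lintegral_add_left (hmeas (measurableSet_par b) x)]
    rw [e1, e2]
    exact ENNReal.tsum_le_tsum fun x => lintegral_mono fun t => tri_tiling b _
  rw [hpar (measurableSet_par b) rfl existsUnique_add_int_Ico,
    hpar (measurableSet_par' b) rfl existsUnique_add_int_Ioc, ← two_mul, ← two_mul] at hsum
  have h2 : S (triOpen b) + S (triMid b) ≤ latIndex b :=
    (ENNReal.mul_le_mul_iff_right (by norm_num) (by norm_num)).1 hsum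
  have e3 : ∑' x : latG, ∫⁻ t in Icc (0 : ℝ) 1, triWeight b (x + t • r)
      = 2⁻¹ * (S (triOpen b) + S (triMid b)) := by
    simp only [hS]
    rw [← ENNReal.tsum_add, ← ENNReal.tsum_mul_left]
    refine tsum_congr fun x => ?_
    simp only [triWeight]
    rw [lintegral_const_mul _ (hm01 x),
      lintegral_add_left (hmeas hm0 x)]
  have hv : volume unitCell ≠ 0 := by
    rw [volume_unitCell]; simp
  have hv' : volume unitCell ≠ ⊤ := by rw [volume_unitCell]; exact ENNReal.ofReal_ne_top
  rw [e3, ENNReal.le_div_iff_mul_le (Or.inl hv) (Or.inl hv')]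
  calc 2⁻¹ * (S (triOpen b) + S (triMid b)) * volume unitCell
      ≤ 2⁻¹ * latIndex b * volume unitCell := by gcongr
    _ = 2⁻¹ * (latIndex b * volume unitCell) := by ring
    _ ≤ 2⁻¹ * (2 * volume (convexHull ℝ (range b))) := mul_le_mul' le_rfl (latIndex_mul_volume b hb)
    _ = _ := by rw [← mul_assoc, ENNReal.inv_mul_cancel (by norm_num) (by norm_num), one_mul]

end density


/-! ### Piecewise affine functions -/

/-- A locally finite covering of the plane by closed convex sets. -/
structure IsCover {J : Type} (K : J → Set E2) : Prop where
  closed : ∀ j, IsClosed (K j)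
  convex : ∀ j, Convex ℝ (K j)
  locFin : LocallyFinite K
  cover : ⋃ j, K j = univ

/-- `v` is affine with gradient `L j` on each of the sets `K j`. -/
def IsPA {J : Type} (K : J → Set E2) (v : E2 → E2) (L : J → E2 →L[ℝ] E2) : Prop :=
  ∀ j, ∀ P ∈ K j, ∀ Q ∈ K j, v Q - v P = L j (Q - P)

section PA

variable {J : Type} {K : J → Set E2}

-- By local finiteness one piece contains P + s r for arbitrarily small positive s. It contains P
-- because it is closed and the whole initial segment because it is convex. So one-sided directional
-- derivatives of piecewise affine maps exist everywhere, also on edges.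
open Filter Topology in
lemma IsCover.exists_dir (h : IsCover K) (P r : E2) :
    ∃ j, ∃ δ > 0, ∀ s ∈ Icc (0 : ℝ) δ, P + s • r ∈ K j := by
  obtain ⟨U, hU, hF⟩ := h.locFin P
  have hcont : Tendsto (fun s : ℝ => P + s • r) (𝓝[>] 0) (𝓝 P) := by
    have : Continuous fun s : ℝ => P + s • r := by fun_prop
    simpa using (this.tendsto 0).mono_left nhdsWithin_le_nhds
  have hex : ∃ j, ∃ᶠ s in 𝓝[>] (0 : ℝ), P + s • r ∈ K j := by
    by_contra hno
    simp only [not_exists, not_frequently] at hno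
    have h1 : ∀ᶠ s in 𝓝[>] (0 : ℝ), ∀ j ∈ {j | (K j ∩ U).Nonempty}, P + s • r ∉ K j :=
      (eventually_all_finite hF).2 fun j _ => hno j
    obtain ⟨s, hs1, hs2⟩ := (h1.and (hcont.eventually hU)).exists
    obtain ⟨j, hj⟩ := mem_iUnion.1 (h.cover ▸ mem_univ (P + s • r))
    exact hs1 j ⟨_, hj, hs2⟩ hj
  obtain ⟨j, hj⟩ := hex
  have hP : P ∈ K j := by
    rw [← (h.closed j).closure_eq]
    exact mem_closure_of_frequently_of_tendsto hj hcont
  obtain ⟨δ, hδ, hδ0⟩ := (hj.and_eventually self_mem_nhdsWithin).exists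
  refine ⟨j, δ, hδ0, fun s hs => ?_⟩
  have hδ0' : (0 : ℝ) < δ := hδ0
  have := (h.convex j).add_smul_sub_mem hP hδ (t := s / δ)
    ⟨div_nonneg hs.1 hδ0'.le, (div_le_one hδ0').2 hs.2⟩
  rwa [add_sub_cancel_left, smul_smul, div_mul_cancel₀ _ hδ0'.ne'] at this

lemma IsPA.continuous {v : E2 → E2} {L : J → E2 →L[ℝ] E2} (hv : IsPA K v L) (h : IsCover K) :
    Continuous v := by
  refine h.locFin.continuous h.cover h.closed fun j => ?_
  rcases (K j).eq_empty_or_nonempty with he | ⟨P, hP⟩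
  · rw [he]; exact continuousOn_empty v
  · have : Continuous fun Q => v P + L j (Q - P) := by fun_prop
    refine this.continuousOn.congr fun Q hQ => ?_
    show v Q = v P + L j (Q - P)
    rw [← hv j P hP Q hQ]; abel

lemma IsPA.hasDerivWithinAt {v : E2 → E2} {L : J → E2 →L[ℝ] E2} (hv : IsPA K v L) {j : J}
    {P r : E2} {δ : ℝ} (hδ : 0 < δ) (h : ∀ s ∈ Icc (0 : ℝ) δ, P + s • r ∈ K j) :
    HasDerivWithinAt (fun s : ℝ => v (P + s • r)) (L j r) (Ici 0) 0 := by
  have h1 : HasDerivWithinAt (fun s : ℝ => v P + s • L j r) (L j r) (Ici 0) 0 := by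
    have := (((hasDerivAt_id (0 : ℝ)).smul_const (L j r)).const_add (v P)).hasDerivWithinAt
      (s := Ici 0)
    simpa using this
  have h0 := h 0 (left_mem_Icc.2 hδ.le)
  rw [zero_smul, add_zero] at h0
  refine h1.congr_of_eventuallyEq ?_ (by simp)
  filter_upwards [Icc_mem_nhdsGE hδ] with s hs
  have := hv j P h0 _ (h s hs)
  rw [add_sub_cancel_left, map_smul] at this
  rw [← this]; abel

lemma IsPA.Dc_eq {v : E2 → E2} {L : J → E2 →L[ℝ] E2} (hv : IsPA K v L) {j : J}
    {P r : E2} {δ : ℝ} (hδ : 0 < δ) (h : ∀ s ∈ Icc (0 : ℝ) δ, P + s • r ∈ K j) :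
    Dc r v P = L j r :=
  (hv.hasDerivWithinAt hδ h).derivWithin (uniqueDiffWithinAt_Ici 0)

lemma IsPA.hasDerivWithinAt_line {v : E2 → E2} {L : J → E2 →L[ℝ] E2} (hv : IsPA K v L)
    (h : IsCover K) (x r : E2) (t : ℝ) :
    HasDerivWithinAt (fun s : ℝ => v (x + s • r)) (Dc r v (x + t • r)) (Ici t) t := by
  obtain ⟨j, δ, hδ, hj⟩ := h.exists_dir (x + t • r) r
  have h1 := hv.hasDerivWithinAt hδ hj
  rw [hv.Dc_eq hδ hj]
  have h2 : HasDerivWithinAt (fun s : ℝ => s - t) 1 (Ici t) t :=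
    ((hasDerivAt_id t).sub_const t).hasDerivWithinAt
  have h3 := HasDerivWithinAt.scomp (h := fun s : ℝ => s - t) t (t' := Ici 0)
    (g₁ := fun s : ℝ => v (x + t • r + s • r)) (by simpa using h1) h2
    (fun s hs => by simpa using hs)
  rw [one_smul] at h3
  refine h3.congr_of_eventuallyEq (Filter.Eventually.of_forall fun s => ?_) ?_ <;>
    simp only [Function.comp_apply, sub_smul] <;> congr 1 <;> abel

lemma IsPA.measurable_Dc {v : E2 → E2} {L : J → E2 →L[ℝ] E2} (hv : IsPA K v L)
    (h : IsCover K) (x r : E2) : Measurable fun t : ℝ => Dc r v (x + t • r) := by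
  have := measurable_derivWithin_Ici (fun s : ℝ => v (x + s • r))
  have e1 : (fun t : ℝ => Dc r v (x + t • r)) =
      fun t => derivWithin (fun s : ℝ => v (x + s • r)) (Ici t) t := by
    ext1 t
    exact ((hv.hasDerivWithinAt_line h x r t).derivWithin (uniqueDiffWithinAt_Ici t)).symm
  rw [e1]; exact this

lemma IsPA.norm_Dc_le {v : E2 → E2} {L : J → E2 →L[ℝ] E2} (hv : IsPA K v L)
    (h : IsCover K) {C : ℝ} (hC : ∀ j, ‖L j‖ ≤ C) (P r : E2) : ‖Dc r v P‖ ≤ C * ‖r‖ := by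
  obtain ⟨j, δ, hδ, hj⟩ := h.exists_dir P r
  rw [hv.Dc_eq hδ hj]
  exact (L j).le_of_opNorm_le (hC j) r

lemma IsPA.integrable_Dc {v : E2 → E2} {L : J → E2 →L[ℝ] E2} (hv : IsPA K v L)
    (h : IsCover K) {C : ℝ} (hC : ∀ j, ‖L j‖ ≤ C) (x r : E2) (a b : ℝ) :
    IntervalIntegrable (fun t : ℝ => Dc r v (x + t • r)) volume a b := by
  refine (intervalIntegrable_const (c := C * ‖r‖)).mono_fun
    (hv.measurable_Dc h x r).aestronglyMeasurable ?_
  refine Filter.Eventually.of_forall fun t => ?_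
  exact (hv.norm_Dc_le h hC _ r).trans (le_abs_self _)

/-- The fundamental theorem of calculus for a continuous function with an integrable right
derivative; no analysis of the kinks of v along the line is needed. -/
lemma IsPA.integral_Dc {v : E2 → E2} {L : J → E2 →L[ℝ] E2} (hv : IsPA K v L)
    (h : IsCover K) {C : ℝ} (hC : ∀ j, ‖L j‖ ≤ C) (x r : E2) :
    ∫ t in (0 : ℝ)..1, Dc r v (x + t • r) = v (x + r) - v x := by
  have hc : Continuous fun s : ℝ => v (x + s • r) := (hv.continuous h).comp (by fun_prop)
  have := intervalIntegral.integral_eq_sub_of_hasDeriv_right (a := 0) (b := 1) hc.continuousOn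
    (fun t _ => (hv.hasDerivWithinAt_line h x r t).mono Ioi_subset_Ici_self)
    (hv.integrable_Dc h hC x r 0 1)
  simpa using this

lemma IsPA.norm_bond_le {v : E2 → E2} {L : J → E2 →L[ℝ] E2} (hv : IsPA K v L)
    (h : IsCover K) {C : ℝ} (hC : ∀ j, ‖L j‖ ≤ C) (x r : E2) : ‖v (x + r) - v x‖ ≤ C * ‖r‖ := by
  rw [← hv.integral_Dc h hC]
  have := intervalIntegral.norm_integral_le_of_norm_le_const (a := 0) (b := 1)
    (f := fun t : ℝ => Dc r v (x + t • r)) (C := C * ‖r‖) fun t _ => hv.norm_Dc_le h hC _ r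
  simpa using this

lemma IsPA.add_smul {v u : E2 → E2} {L M : J → E2 →L[ℝ] E2} (hv : IsPA K v L)
    (hu : IsPA K u M) (t : ℝ) : IsPA K (v + t • u) fun j => L j + t • M j := by
  intro j P hP Q hQ
  have h1 := hv j P hP Q hQ
  have h2 := hu j P hP Q hQ
  simp only [Pi.add_apply, Pi.smul_apply, add_apply, smul_apply]
  rw [← h1, ← h2, smul_sub]; abel

lemma IsPA.Dc_add_smul {v u : E2 → E2} {L M : J → E2 →L[ℝ] E2} (hv : IsPA K v L)
    (hu : IsPA K u M) (h : IsCover K) (t : ℝ) (P r : E2) :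
    Dc r (v + t • u) P = Dc r v P + t • Dc r u P := by
  obtain ⟨j, δ, hδ, hj⟩ := h.exists_dir P r
  rw [(hv.add_smul hu t).Dc_eq hδ hj, hv.Dc_eq hδ hj, hu.Dc_eq hδ hj]
  rfl

/-- Almost every point of a line is in the relative interior of each of countably many closed
convex sets that contain it. -/
lemma ae_line_interior {ι : Type} [Countable ι] {A : ι → Set E2} (hA : ∀ i, IsClosed (A i))
    (hA' : ∀ i, Convex ℝ (A i)) (x r : E2) :
    ∀ᵐ t : ℝ, ∀ i, x + t • r ∈ A i → ∃ δ > 0, ∀ s : ℝ, |s| ≤ δ → x + t • r + s • r ∈ A i := by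
  rw [ae_all_iff]
  intro i
  set S : Set ℝ := {t | x + t • r ∈ A i} with hS
  have hSc : IsClosed S := (hA i).preimage (by fun_prop)
  have hSv : Convex ℝ S := by
    intro a ha b hb α β hα hβ hαβ
    rw [hS, mem_ofPred_eq] at *
    have := hA' i ha hb hα hβ hαβ
    convert this using 1
    rw [smul_add, smul_add, add_add_add_comm, ← add_smul, hαβ, one_smul, smul_smul, smul_smul,
      ← add_smul, smul_eq_mul, smul_eq_mul]
  have h0 : volume (frontier S) = 0 := hSv.addHaar_frontier volume
  have h1 : ∀ᵐ t : ℝ, t ∉ frontier S := measure_eq_zero_iff_ae_notMem.1 h0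
  filter_upwards [h1] with t ht htA
  have hti : t ∈ interior S := by
    by_contra hn
    exact ht (hSc.frontier_eq ▸ ⟨htA, hn⟩)
  obtain ⟨ε, hε, hεS⟩ := Metric.isOpen_iff.1 isOpen_interior t hti
  refine ⟨ε / 2, by positivity, fun s hs => ?_⟩
  have : t + s ∈ S := interior_subset (hεS (by
    rw [Metric.mem_ball, dist_eq_norm, add_sub_cancel_left, Real.norm_eq_abs]; linarith))
  rw [hS, mem_ofPred_eq, add_smul] at this
  rwa [add_assoc]

/-- Almost everywhere on a line the directional derivative is given by each of the adjacent
pieces. -/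
lemma IsCover.ae_Dc [Countable J] (h : IsCover K) (x r : E2) :
    ∀ᵐ t : ℝ, ∀ j, x + t • r ∈ K j → ∀ v L, IsPA K v L → Dc r v (x + t • r) = L j r := by
  filter_upwards [ae_line_interior h.closed h.convex x r] with t ht j hj v L hv
  obtain ⟨δ, hδ, hs⟩ := ht j hj
  exact hv.Dc_eq hδ fun s hs' => hs s (by rw [abs_of_nonneg hs'.1]; exact hs'.2)

end PA


/-! ### Lattice triangles -/

/-- `b` lists the vertices of the lattice triangle `s`. -/
def IsBas (b : AffineBasis (Fin 3) ℝ E2) (s : Finset E2) : Prop :=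
  range b = (s : Set E2) ∧ ∀ i, b i ∈ Lat

lemma exists_affineBasis {f : Fin 3 → E2} (hf : AffineIndependent ℝ f) :
    ∃ b : AffineBasis (Fin 3) ℝ E2, ⇑b = f := by
  refine ⟨⟨f, hf, ?_⟩, rfl⟩
  rw [hf.affineSpan_eq_top_iff_card_eq_finrank_add_one]
  simp

lemma exists_isBas_of_card {s : Finset E2} (hc : s.card = 3)
    (hi : AffineIndependent ℝ (fun v : s => (v : E2))) (hl : (s : Set E2) ⊆ Lat) :
    ∃ b, IsBas b s := by
  obtain ⟨b, hb⟩ := exists_affineBasis (hi.comp_embedding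
    (s.equivFinOfCardEq hc).symm.toEmbedding)
  have hr : range b = (s : Set E2) := by
    rw [hb, range_comp]
    simp
  exact ⟨b, hr, fun i => hl (hr ▸ mem_range_self i)⟩

/-- The scale c = 1 or −1 serves the two orientations of micro-triangles. -/
lemma affineIndependent_of_coord {x : E2} {c : ℝ} (hc : c ≠ 0) {f : Fin 3 → E2}
    (h0 : f 0 = x) (h1 : f 1 = x + c • a1) (h2 : f 2 = x + c • a2) :
    AffineIndependent ℝ f := by
  rw [affineIndependent_iff_of_fintype]
  intro w hw hs
  rw [Finset.univ.weightedVSub_eq_linear_combination (w := w) (p := f) hw] at hs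
  rw [Fin.sum_univ_three] at hw hs
  rw [h0, h1, h2] at hs
  have e1 := congrArg cα hs
  have e2 := congrArg cβ hs
  simp only [map_add, map_smul, map_zero, smul_eq_mul, cα_a1, cα_a2, cβ_a1, cβ_a2] at e1 e2
  have g1 : c * w 1 = 0 := by linear_combination e1 - cα x * hw
  have g2 : c * w 2 = 0 := by linear_combination e2 - cβ x * hw
  have g1 : w 1 = 0 := by simpa [hc] using g1
  have g2 : w 2 = 0 := by simpa [hc] using g2
  intro i; fin_cases i
  · show w 0 = 0; linarith
  · exact g1
  · exact g2

lemma a1_mem : a1 ∈ Lat := mem_Lat_iff.2 ⟨1, 0, by simp, by simp⟩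
lemma a2_mem : a2 ∈ Lat := mem_Lat_iff.2 ⟨0, 1, by simp, by simp⟩

lemma exists_isBas_of_micro {s : Finset E2} (hs : s ∈ micro) : ∃ b, IsBas b s := by
  obtain ⟨x, hx, h | h⟩ := hs
  · obtain ⟨b, hb⟩ := exists_affineBasis (affineIndependent_of_coord (x := x) one_ne_zero
      (f := ![x, x + a1, x + a2]) rfl (by simp) (by simp))
    have hr : range b = (s : Set E2) := by rw [hb, h]; ext z; simp [eq_comm]; tauto
    refine ⟨b, hr, fun i => ?_⟩
    rw [hb]
    fin_cases i
    · exact hx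
    · exact latG.add_mem hx a1_mem
    · exact latG.add_mem hx a2_mem
  · obtain ⟨b, hb⟩ := exists_affineBasis (affineIndependent_of_coord (x := x + a1 + a2)
      (c := -1) (by norm_num) (f := ![x + a1 + a2, x + a2, x + a1]) rfl
      (by simp; abel) (by simp))
    have hr : range b = (s : Set E2) := by
      rw [hb, h]; ext z; simp
    refine ⟨b, hr, fun i => ?_⟩
    rw [hb]
    fin_cases i
    · exact latG.add_mem (latG.add_mem hx a1_mem) a2_mem
    · exact latG.add_mem hx a2_mem
    · exact latG.add_mem hx a1_mem

section triangle

variable {b : AffineBasis (Fin 3) ℝ E2} {s : Finset E2}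

lemma IsBas.tri_eq (hb : IsBas b s) : tri s = convexHull ℝ (range b) := by rw [tri, hb.1]

lemma IsBas.mem_tri_iff (hb : IsBas b s) {P : E2} : P ∈ tri s ↔ ∀ i, 0 ≤ b.coord i P := by
  rw [hb.tri_eq, tri_eq_nonneg_coord, mem_ofPred_eq]

lemma IsBas.interior_tri (hb : IsBas b s) : interior (tri s) = triOpen b := by
  rw [hb.tri_eq, b.interior_convexHull]; rfl

lemma IsBas.mem (hb : IsBas b s) (i : Fin 3) : b i ∈ s := by
  rw [← Finset.mem_coe, ← hb.1]; exact mem_range_self i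

lemma IsBas.exists_eq (hb : IsBas b s) {v : E2} (hv : v ∈ s) : ∃ i, b i = v := by
  rwa [← Finset.mem_coe, ← hb.1] at hv

lemma IsBas.sum (hb : IsBas b s) {F : Type*} [AddCommMonoid F] (f : E2 → F) :
    ∑ v ∈ s, f v = ∑ i, f (b i) := by
  classical
  have hs : s = Finset.univ.image b := by
    apply Finset.coe_injective; rw [← hb.1]; simp
  rw [hs, Finset.sum_image fun i _ j _ h => b.ind.injective h]

lemma coord_combination (b : AffineBasis (Fin 3) ℝ E2) {c : Fin 3 → ℝ} (hc : ∑ i, c i = 1)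
    (i : Fin 3) : b.coord i (∑ j, c j • b j) = c i := by
  rw [← Finset.affineCombination_eq_linear_combination _ _ _ hc]
  exact b.coord_apply_combination_of_mem (Finset.mem_univ i) hc

lemma IsBas.coord_eq (hb : IsBas b s) {c : E2 → ℝ} (hc : ∑ v ∈ s, c v = 1) (i : Fin 3) :
    b.coord i (∑ v ∈ s, c v • v) = c (b i) := by
  rw [hb.sum] at hc
  rw [hb.sum, coord_combination b hc]

lemma sum_coord_smul (b : AffineBasis (Fin 3) ℝ E2) (P : E2) : ∑ i, b.coord i P • b i = P :=
  b.linear_combination_coord_eq_self P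

lemma convex_tri (s : Finset E2) : Convex ℝ (tri s) := convex_convexHull ℝ _

lemma isCompact_tri (s : Finset E2) : IsCompact (tri s) := s.finite_toSet.isCompact_convexHull ℝ

lemma isClosed_tri (s : Finset E2) : IsClosed (tri s) := (isCompact_tri s).isClosed

lemma mem_tri_of_mem {s : Finset E2} {v : E2} (hv : v ∈ s) : v ∈ tri s :=
  subset_convexHull ℝ _ (Finset.mem_coe.2 hv)

lemma mem_tri_iff {s : Finset E2} {P : E2} : P ∈ tri s ↔
    ∃ c : E2 → ℝ, (∀ v ∈ s, 0 ≤ c v) ∧ ∑ v ∈ s, c v = 1 ∧ ∑ v ∈ s, c v • v = P := by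
  rw [tri, Finset.mem_convexHull']

lemma interior_tri_nonempty (hb : IsBas b s) : (interior (tri s)).Nonempty := by
  rw [hb.tri_eq, interior_convexHull_nonempty_iff_affineSpan_eq_top]; exact b.tot

lemma tri_eq_closure_interior (hb : IsBas b s) : tri s = closure (interior (tri s)) := by
  rw [(convex_tri s).closure_interior_eq_closure_of_nonempty_interior (interior_tri_nonempty hb),
    (isClosed_tri s).closure_eq]

end triangle

/-- The triangle `s` meets `s'` only in common faces. -/
def Reg (s s' : Finset E2) : Prop :=
  ∀ c : E2 → ℝ, (∀ v ∈ s, 0 ≤ c v) → ∑ v ∈ s, c v = 1 → ∑ v ∈ s, c v • v ∈ tri s' →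
    ∀ v ∈ s, 0 < c v → v ∈ s'

/-- The interpolant is affine on each triangle of a regular triangulation. -/
lemma p1_eq {𝒯 : Set (Finset E2)} {w : E2 → E2} {s : Finset E2} (hs : s ∈ 𝒯)
    (hreg : ∀ s' ∈ 𝒯, Reg s' s) {b : AffineBasis (Fin 3) ℝ E2} (hb : IsBas b s) {P : E2}
    (hP : P ∈ tri s) : p1 𝒯 w P = ∑ i, b.coord i P • w (b i) := by
  classical
  have hex : ∃ f : E2, ∃ s ∈ 𝒯, ∃ c : E2 → ℝ, (∀ v ∈ s, 0 ≤ c v) ∧ ∑ v ∈ s, c v = 1 ∧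
      ∑ v ∈ s, c v • v = P ∧ f = ∑ v ∈ s, c v • w v := by
    obtain ⟨c, h1, h2, h3⟩ := mem_tri_iff.1 hP
    exact ⟨_, s, hs, c, h1, h2, h3, rfl⟩
  rw [p1, dif_pos hex]
  obtain ⟨s', hs', c, h1, h2, h3, h4⟩ := hex.choose_spec
  rw [h4]
  -- The definition picks an arbitrary triangle s' and weights. Regularity confines the positive
  -- weights to the vertices common to s' and s; extended by zero they are barycentric coordinates
  -- in s, and these are unique.
  have hsup := hreg s' hs' c h1 h2 (h3 ▸ hP)
  set d : E2 → ℝ := fun v => if v ∈ s' then c v else 0 with hd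
  have key : ∀ {F : Type} [AddCommGroup F] [Module ℝ F] (f : E2 → F),
      ∑ v ∈ s', c v • f v = ∑ v ∈ s, d v • f v := by
    intro F _ _ f
    have e1 : ∑ v ∈ s', c v • f v = ∑ v ∈ s' ∩ s, c v • f v := by
      refine (Finset.sum_subset Finset.inter_subset_left fun v hv hv' => ?_).symm
      have hvs : v ∉ s := fun h => hv' (Finset.mem_inter.2 ⟨hv, h⟩)
      have : c v = 0 := le_antisymm (not_lt.1 fun h => hvs (hsup v hv h)) (h1 v hv)
      rw [this, zero_smul]
    have e2 : ∑ v ∈ s, d v • f v = ∑ v ∈ s' ∩ s, d v • f v := by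
      refine (Finset.sum_subset Finset.inter_subset_right fun v hv hv' => ?_).symm
      have hvs : v ∉ s' := fun h => hv' (Finset.mem_inter.2 ⟨h, hv⟩)
      simp [hd, hvs]
    rw [e1, e2]
    refine Finset.sum_congr rfl fun v hv => ?_
    simp [hd, (Finset.mem_inter.1 hv).1]
  have k1 : ∑ v ∈ s, d v = 1 := by
    have := key (F := ℝ) fun _ => 1
    simp only [smul_eq_mul, mul_one] at this
    rw [← this, h2]
  have k2 := key (F := E2) fun v => v
  rw [h3] at k2
  rw [key w, hb.sum]
  refine Finset.sum_congr rfl fun i _ => ?_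
  rw [← hb.coord_eq k1, ← k2]

/-! ### The canonical triangulation -/

/-- The product of three strips that is a triangle of the canonical triangulation. -/
def slab (i j k : ℤ) : Set E2 :=
  {P | cα P ∈ Icc (i : ℝ) (i + 1) ∧ cβ P ∈ Icc (j : ℝ) (j + 1) ∧
    cα P + cβ P ∈ Icc (k : ℝ) (k + 1)}

lemma convex_slab (i j k : ℤ) : Convex ℝ (slab i j k) :=
  ((convex_Icc _ _).linear_preimage cα.toLinearMap).inter
    (((convex_Icc _ _).linear_preimage cβ.toLinearMap).inter
      ((convex_Icc _ _).linear_preimage (cα + cβ).toLinearMap))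

/-- Two different unit strips with integer bounds have at most one value of f in common. If a convex
combination of points of one strip lands in another, it takes this extreme value, and then so does
every point with positive weight. -/
lemma slab_weights {s : Finset E2} {c : E2 → ℝ} (h0 : ∀ v ∈ s, 0 ≤ c v) (h1 : ∑ v ∈ s, c v = 1)
    (f : E2 →L[ℝ] ℝ) {l l' : ℤ} (hs : ∀ v ∈ s, f v ∈ Icc (l : ℝ) (l + 1))
    (hP : f (∑ v ∈ s, c v • v) ∈ Icc (l' : ℝ) (l' + 1)) {v : E2} (hv : v ∈ s) (hc : 0 < c v) :
    f v ∈ Icc (l' : ℝ) (l' + 1) := by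
  have hf : ∀ a : ℝ, f (∑ v ∈ s, c v • v) - a = ∑ v ∈ s, c v * (f v - a) := by
    intro a
    rw [map_sum]
    simp only [map_smul, smul_eq_mul, mul_sub, Finset.sum_sub_distrib]
    rw [← Finset.sum_mul, h1, one_mul]
  rcases lt_trichotomy l l' with h | h | h
  · have hl : (l : ℝ) + 1 ≤ l' := by exact_mod_cast h
    have h2 : ∀ u ∈ s, 0 ≤ c u * ((l + 1) - f u) := fun u hu =>
      mul_nonneg (h0 u hu) (by linarith [(hs u hu).2])
    have h3 : ∑ u ∈ s, c u * ((l + 1) - f u) ≤ 0 := by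
      have := hf (l + 1)
      have e : ∑ u ∈ s, c u * ((l + 1) - f u) = - ∑ u ∈ s, c u * (f u - (l + 1)) := by
        rw [← Finset.sum_neg_distrib]; refine Finset.sum_congr rfl fun u _ => by ring
      rw [e, ← this]; linarith [hP.1]
    have h4 := (Finset.sum_eq_zero_iff_of_nonneg h2).1 (le_antisymm h3 (Finset.sum_nonneg h2)) v hv
    have h6 : f v = l + 1 := by
      rcases mul_eq_zero.1 h4 with h | h
      · exact absurd h hc.ne'
      · linarith
    have h7 := hf (l + 1)
    have h8 : f (∑ v ∈ s, c v • v) ≤ l + 1 := by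
      have : ∑ u ∈ s, c u * (f u - (l + 1)) ≤ 0 := Finset.sum_nonpos fun u hu =>
        mul_nonpos_of_nonneg_of_nonpos (h0 u hu) (by linarith [(hs u hu).2])
      linarith
    constructor <;> linarith [hP.1]
  · rw [← h]; exact hs v hv
  · have hl : (l' : ℝ) + 1 ≤ l := by exact_mod_cast h
    have h2 : ∀ u ∈ s, 0 ≤ c u * (f u - l) := fun u hu =>
      mul_nonneg (h0 u hu) (by linarith [(hs u hu).1])
    have h3 : ∑ u ∈ s, c u * (f u - l) ≤ 0 := by
      rw [← hf]; linarith [hP.2]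
    have h4 := (Finset.sum_eq_zero_iff_of_nonneg h2).1 (le_antisymm h3 (Finset.sum_nonneg h2)) v hv
    have h6 : f v = l := by
      rcases mul_eq_zero.1 h4 with h | h
      · exact absurd h hc.ne'
      · linarith
    have h8 : (l : ℝ) ≤ f (∑ v ∈ s, c v • v) := by
      have := Finset.sum_nonneg h2
      rw [← hf] at this
      linarith
    constructor <;> linarith [hP.2]

lemma convex_three {C : Set E2} (hC : Convex ℝ C) {u v w : E2} (hu : u ∈ C) (hv : v ∈ C)
    (hw : w ∈ C) {p q r : ℝ} (hp : 0 ≤ p) (hq : 0 ≤ q) (hr : 0 ≤ r) (h : p + q + r = 1) :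
    p • u + q • v + r • w ∈ C := by
  have := hC.sum_mem (t := Finset.univ) (w := ![p, q, r]) (z := ![u, v, w])
    (by intro i _; fin_cases i <;> assumption) (by simpa [Fin.sum_univ_three] using h)
    (by intro i _; fin_cases i <;> assumption)
  simpa [Fin.sum_univ_three] using this

/-- Writing a micro-triangle as an intersection of three unit strips reduces regularity of the
canonical triangulation to one coordinate function at a time. -/
lemma micro_slab {s : Finset E2} (hs : s ∈ micro) : ∃ i j k : ℤ, tri s = slab i j k ∧
    ∀ v ∈ Lat, v ∈ tri s → v ∈ s := by
  obtain ⟨x, hx, h⟩ := hs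
  obtain ⟨i, j, hi, hj⟩ := mem_Lat_iff.1 hx
  have hmem : ∀ v, v ∈ s ↔ v ∈ (s : Set E2) := fun v => Finset.mem_coe.symm
  have hC : Convex ℝ (tri s) := convex_tri s
  rcases h with h | h
  · have m0 : x ∈ tri s := subset_convexHull ℝ _ (by rw [h]; simp)
    have m1 : x + a1 ∈ tri s := subset_convexHull ℝ _ (by rw [h]; simp)
    have m2 : x + a2 ∈ tri s := subset_convexHull ℝ _ (by rw [h]; simp)
    have htri : tri s = slab i j (i + j) := by
      apply subset_antisymm
      · refine convexHull_min ?_ (convex_slab _ _ _)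
        rw [h]
        rintro v (rfl | rfl | rfl) <;>
          simp only [slab, mem_ofPred_eq, mem_Icc, map_add, hi, hj, cα_a1, cα_a2, cβ_a1,
            cβ_a2] <;> push_cast <;>
          refine ⟨⟨?_, ?_⟩, ⟨?_, ?_⟩, ?_, ?_⟩ <;> linarith
      · rintro P ⟨h1, h2, h3⟩
        push_cast at h3
        have := convex_three hC m0 m1 m2 (p := 1 - (cα P - i) - (cβ P - j)) (q := cα P - i)
          (r := cβ P - j) (by linarith [h3.2]) (by linarith [h1.1]) (by linarith [h2.1]) (by ring)
        convert this using 1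
        apply ext_lat <;> simp [hi, hj] <;> ring
    refine ⟨i, j, i + j, htri, fun v hv hvs => ?_⟩
    rw [htri] at hvs
    obtain ⟨h1, h2, h3⟩ := hvs
    obtain ⟨k, l, hk, hl⟩ := mem_Lat_iff.1 hv
    rw [hk, hl] at h3
    rw [hk] at h1
    rw [hl] at h2
    have g1 : i ≤ k := by exact_mod_cast h1.1
    have g2 : j ≤ l := by exact_mod_cast h2.1
    have g3 : k + l ≤ i + j + 1 := by exact_mod_cast h3.2
    have hcases : (k = i ∧ l = j) ∨ (k = i + 1 ∧ l = j) ∨ (k = i ∧ l = j + 1) := by omega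
    rw [hmem, h]
    rcases hcases with ⟨rfl, rfl⟩ | ⟨rfl, rfl⟩ | ⟨rfl, rfl⟩
    · left; exact ext_lat (by rw [hk, hi]) (by rw [hl, hj])
    · right; left; exact ext_lat (by simp [hk, hi]) (by simp [hl, hj])
    · right; right; exact ext_lat (by simp [hk, hi]) (by simp [hl, hj])
  · have m0 : x + a1 + a2 ∈ tri s := subset_convexHull ℝ _ (by rw [h]; simp)
    have m1 : x + a1 ∈ tri s := subset_convexHull ℝ _ (by rw [h]; simp)
    have m2 : x + a2 ∈ tri s := subset_convexHull ℝ _ (by rw [h]; simp)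
    have htri : tri s = slab i j (i + j + 1) := by
      apply subset_antisymm
      · refine convexHull_min ?_ (convex_slab _ _ _)
        rw [h]
        rintro v (rfl | rfl | rfl) <;>
          simp only [slab, mem_ofPred_eq, mem_Icc, map_add, hi, hj, cα_a1, cα_a2, cβ_a1,
            cβ_a2] <;> push_cast <;>
          refine ⟨⟨?_, ?_⟩, ⟨?_, ?_⟩, ?_, ?_⟩ <;> linarith
      · rintro P ⟨h1, h2, h3⟩
        push_cast at h3
        have := convex_three hC m0 m1 m2 (p := (cα P - i) + (cβ P - j) - 1)
          (q := 1 - (cβ P - j)) (r := 1 - (cα P - i)) (by linarith [h3.1]) (by linarith [h2.2])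
          (by linarith [h1.2]) (by ring)
        convert this using 1
        apply ext_lat <;> simp [hi, hj] <;> ring
    refine ⟨i, j, i + j + 1, htri, fun v hv hvs => ?_⟩
    rw [htri] at hvs
    obtain ⟨h1, h2, h3⟩ := hvs
    obtain ⟨k, l, hk, hl⟩ := mem_Lat_iff.1 hv
    rw [hk, hl] at h3
    rw [hk] at h1
    rw [hl] at h2
    have g1 : k ≤ i + 1 := by exact_mod_cast h1.2
    have g2 : l ≤ j + 1 := by exact_mod_cast h2.2
    have g3 : i + j + 1 ≤ k + l := by exact_mod_cast h3.1
    have hcases : (k = i + 1 ∧ l = j) ∨ (k = i ∧ l = j + 1) ∨ (k = i + 1 ∧ l = j + 1) := by omega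
    rw [hmem, h]
    rcases hcases with ⟨rfl, rfl⟩ | ⟨rfl, rfl⟩ | ⟨rfl, rfl⟩
    · left; exact ext_lat (by simp [hk, hi]) (by simp [hl, hj])
    · right; left; exact ext_lat (by simp [hk, hi]) (by simp [hl, hj])
    · right; right; exact ext_lat (by simp [hk, hi]) (by simp [hl, hj])

lemma micro_vertex_mem {s : Finset E2} (hs : s ∈ micro) {v : E2} (hv : v ∈ s) : v ∈ Lat := by
  obtain ⟨b, hb⟩ := exists_isBas_of_micro hs
  obtain ⟨i, rfl⟩ := hb.exists_eq hv
  exact hb.2 i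

/-- A convex combination of lattice points in a common slab that is in a micro-triangle only
involves vertices of that triangle. -/
lemma micro_support {s s' : Finset E2} {i j k : ℤ} (hs : ∀ v ∈ s, v ∈ Lat ∧ v ∈ slab i j k)
    (hs' : s' ∈ micro) : Reg s s' := by
  intro c h0 h1 hP v hv hc
  obtain ⟨i', j', k', htri, hlat⟩ := micro_slab hs'
  refine hlat v (hs v hv).1 ?_
  rw [htri] at hP ⊢
  obtain ⟨p1, p2, p3⟩ := hP
  refine ⟨slab_weights h0 h1 cα (fun u hu => (hs u hu).2.1) p1 hv hc,
    slab_weights h0 h1 cβ (fun u hu => (hs u hu).2.2.1) p2 hv hc,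
    slab_weights h0 h1 (cα + cβ) (fun u hu => (hs u hu).2.2.2) p3 hv hc⟩

lemma reg_micro {s s' : Finset E2} (hs : s ∈ micro) (hs' : s' ∈ micro) : Reg s s' := by
  obtain ⟨i, j, k, htri, -⟩ := micro_slab hs
  exact micro_support (fun v hv => ⟨micro_vertex_mem hs hv, htri ▸ mem_tri_of_mem hv⟩) hs'

/-! ### The periodic cell -/

/-- Lattice coordinates as a homeomorphism. -/
noncomputable def latEquiv : E2 ≃L[ℝ] ℝ × ℝ :=
  ContinuousLinearEquiv.equivOfInverse (cα.prod cβ)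
    ((ContinuousLinearMap.fst ℝ ℝ ℝ).smulRight a1 + (ContinuousLinearMap.snd ℝ ℝ ℝ).smulRight a2)
    (fun x => (eq_lat_coord x).symm) (fun p => by ext <;> simp)

lemma cell_eq (N : ℕ) : cell N = latEquiv ⁻¹' (Ioc (0 : ℝ) N ×ˢ Ioc (0 : ℝ) N) := by
  ext x; rw [mem_cell_iff]; rfl

lemma mem_closure_cell_iff {N : ℕ} (hN : 0 < N) {x : E2} :
    x ∈ closure (cell N) ↔ cα x ∈ Icc (0 : ℝ) N ∧ cβ x ∈ Icc (0 : ℝ) N := by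
  have h0 : (0 : ℝ) ≠ N := by positivity
  rw [cell_eq, ← ContinuousLinearEquiv.coe_toHomeomorph, ← Homeomorph.preimage_closure,
    closure_prod_eq, closure_Ioc h0]
  rfl

lemma mem_interior_cell_iff {N : ℕ} {x : E2} :
    x ∈ interior (cell N) ↔ cα x ∈ Ioo (0 : ℝ) N ∧ cβ x ∈ Ioo (0 : ℝ) N := by
  rw [cell_eq, ← ContinuousLinearEquiv.coe_toHomeomorph, ← Homeomorph.preimage_interior,
    interior_prod_eq, interior_Ioc]
  rfl

lemma convex_cell (N : ℕ) : Convex ℝ (cell N) := by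
  rw [cell_eq]
  exact ((convex_Ioc _ _).prod (convex_Ioc _ _)).linear_preimage latEquiv.toLinearMap

lemma exists_sub_mem_cell {N : ℕ} (hN : 0 < N) (P : E2) : ∃ z ∈ perLat N, P - z ∈ cell N := by
  have hN' : (0 : ℝ) < N := by exact_mod_cast hN
  have key : ∀ a : ℝ, ∃ i : ℤ, a - i * N ∈ Ioc (0 : ℝ) N := by
    intro a
    -- Not the floor: the cell contains its upper sides but not its lower ones.
    refine ⟨⌈a / N⌉ - 1, ?_, ?_⟩
    · have := Int.ceil_lt_add_one (a / N)
      have : (⌈a / N⌉ - 1 : ℝ) * N < a := by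
        rw [← lt_div_iff₀ hN']; linarith
      push_cast; linarith
    · have := Int.le_ceil (a / N)
      rw [div_le_iff₀ hN'] at this
      push_cast; linarith
  obtain ⟨i, hi⟩ := key (cα P)
  obtain ⟨j, hj⟩ := key (cβ P)
  refine ⟨_, ⟨i, j, rfl⟩, mem_cell_iff.2 ?_⟩
  have e1 : cα (P - (((i : ℝ) * N) • a1 + ((j : ℝ) * N) • a2)) = cα P - i * N := by simp
  have e2 : cβ (P - (((i : ℝ) * N) • a1 + ((j : ℝ) * N) • a2)) = cβ P - j * N := by simp
  rw [e1, e2]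
  exact ⟨hi, hj⟩

lemma eq_zero_of_mem_cells {N : ℕ} {P z : E2} (hz : z ∈ perLat N) (h1 : P ∈ cell N)
    (h2 : P - z ∈ cell N) : z = 0 := by
  obtain ⟨i, j, hi, hj⟩ := mem_perLat_iff.1 hz
  rw [mem_cell_iff] at h1 h2
  rw [map_sub, map_sub, hi, hj] at h2
  have key : ∀ (a : ℝ) (i : ℤ), a ∈ Ioc (0 : ℝ) N → a - i * N ∈ Ioc (0 : ℝ) N → i = 0 := by
    intro a i h1 h2
    have hN : (0 : ℝ) < N := h1.1.trans_le h1.2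
    have g1 : (i : ℝ) < 1 := by
      by_contra h; push Not at h; nlinarith [h2.1, h1.2]
    have g2 : (-1 : ℝ) < i := by
      by_contra h; push Not at h; nlinarith [h2.2, h1.1]
    have g1 : i < 1 := by exact_mod_cast g1
    have g2 : -1 < i := by exact_mod_cast g2
    omega
  have e1 := key _ i h1.1 h2.1
  have e2 := key _ j h1.2 h2.2
  exact ext_lat (by simp [hi, e1]) (by simp [hj, e2])

/-- If P − z is interior to the cell, then so are nearby points, and some of them come from the cell
itself, where representatives are unique. As the atomistic region is in the interior of the cell,
this excludes any contact with its periodic images. -/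
lemma eq_zero_of_mem_interior_closure {N : ℕ} {P z : E2} (hz : z ∈ perLat N)
    (h1 : P ∈ closure (cell N)) (h2 : P - z ∈ interior (cell N)) : z = 0 := by
  set O : Set E2 := (fun Q => Q - z) ⁻¹' interior (cell N) with hO
  have hOo : IsOpen O := isOpen_interior.preimage (by fun_prop)
  obtain ⟨Q, hQO, hQ⟩ := mem_closure_iff.1 h1 O hOo h2
  exact eq_zero_of_mem_cells hz hQ (interior_subset hQO)

lemma finite_Lat_inter_cell (N : ℕ) : (Lat ∩ cell N).Finite := by
  refine ((Set.finite_Icc (0 : ℤ) N).prod (Set.finite_Icc (0 : ℤ) N) |>.image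
    fun p : ℤ × ℤ => (p.1 : ℝ) • a1 + (p.2 : ℝ) • a2).subset ?_
  rintro x ⟨⟨i, j, rfl⟩, hx⟩
  rw [mem_cell_iff] at hx
  simp only [map_add, map_smul, cα_a1, cα_a2, cβ_a1, cβ_a2, smul_eq_mul, mul_one, mul_zero,
    add_zero, zero_add, mem_Ioc] at hx
  refine ⟨(i, j), ⟨⟨?_, ?_⟩, ?_, ?_⟩, rfl⟩
  · exact_mod_cast hx.1.1.le
  · exact_mod_cast hx.1.2
  · exact_mod_cast hx.2.1.le
  · exact_mod_cast hx.2.2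

/-- Every point of the cell is in a micro-triangle of the cell. -/
lemma exists_mem_Ta {N : ℕ} (hN : 0 < N) {P : E2} (hP : P ∈ cell N) :
    ∃ s ∈ Ta N, P ∈ tri s := by
  classical
  rw [mem_cell_iff] at hP
  have key : ∀ a ∈ Ioc (0 : ℝ) N, ∃ i : ℤ, a ∈ Icc (i : ℝ) (i + 1) ∧ 0 ≤ i ∧ i + 1 ≤ N := by
    intro a ha
    refine ⟨⌈a⌉ - 1, ⟨?_, ?_⟩, ?_, ?_⟩
    · push_cast; linarith [Int.ceil_lt_add_one a]
    · push_cast; linarith [Int.le_ceil a]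
    · have := Int.ceil_pos.2 ha.1; omega
    · have : ⌈a⌉ ≤ N := Int.ceil_le.2 (by exact_mod_cast ha.2)
      omega
  obtain ⟨i, hi, hi0, hi1⟩ := key _ hP.1
  obtain ⟨j, hj, hj0, hj1⟩ := key _ hP.2
  have c1 : (i : ℝ) + 1 ≤ N := by exact_mod_cast hi1
  have c2 : (j : ℝ) + 1 ≤ N := by exact_mod_cast hj1
  have c3 : (0 : ℝ) ≤ i := by exact_mod_cast hi0
  have c4 : (0 : ℝ) ≤ j := by exact_mod_cast hj0
  set x : E2 := (i : ℝ) • a1 + (j : ℝ) • a2 with hx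
  have hxi : cα x = i := by simp [hx]
  have hxj : cβ x = j := by simp [hx]
  have hxL : x ∈ Lat := ⟨i, j, rfl⟩
  have hbox : ∀ s : Finset E2, (∀ v ∈ s, cα v ∈ Icc (i : ℝ) (i + 1) ∧ cβ v ∈ Icc (j : ℝ) (j + 1)) →
      tri s ⊆ closure (cell N) := by
    intro s hs
    refine convexHull_min (fun v hv => (mem_closure_cell_iff hN).2 ?_) (convex_cell N).closure
    obtain ⟨h1, h2⟩ := hs v hv
    exact ⟨⟨by linarith [h1.1], by linarith [h1.2]⟩, ⟨by linarith [h2.1], by linarith [h2.2]⟩⟩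
  rcases le_total (cα P + cβ P) (i + j + 1) with h | h
  · have hm : ({x, x + a1, x + a2} : Finset E2) ∈ micro := ⟨x, hxL, Or.inl (by simp)⟩
    refine ⟨_, ⟨hm, hbox _ ?_⟩, ?_⟩
    · intro v hv
      simp only [Finset.mem_insert, Finset.mem_singleton] at hv
      rcases hv with rfl | rfl | rfl <;> simp [hxi, hxj]
    · have := convex_three (convex_tri ({x, x + a1, x + a2} : Finset E2))
        (mem_tri_of_mem (v := x) (by simp)) (mem_tri_of_mem (v := x + a1) (by simp))
        (mem_tri_of_mem (v := x + a2) (by simp)) (p := 1 - (cα P - i) - (cβ P - j))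
        (q := cα P - i) (r := cβ P - j) (by linarith) (by linarith [hi.1]) (by linarith [hj.1])
        (by ring)
      convert this using 1
      apply ext_lat <;> simp [hxi, hxj] <;> ring
  · have hm : ({x + a1, x + a2, x + a1 + a2} : Finset E2) ∈ micro := ⟨x, hxL, Or.inr (by simp)⟩
    refine ⟨_, ⟨hm, hbox _ ?_⟩, ?_⟩
    · intro v hv
      simp only [Finset.mem_insert, Finset.mem_singleton] at hv
      rcases hv with rfl | rfl | rfl <;> simp [hxi, hxj]
    · have := convex_three (convex_tri ({x + a1, x + a2, x + a1 + a2} : Finset E2))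
        (mem_tri_of_mem (v := x + a1 + a2) (by simp)) (mem_tri_of_mem (v := x + a1) (by simp))
        (mem_tri_of_mem (v := x + a2) (by simp)) (p := (cα P - i) + (cβ P - j) - 1)
          (q := 1 - (cβ P - j)) (r := 1 - (cα P - i)) (by linarith) (by linarith [hj.2])
          (by linarith [hi.2]) (by ring)
      convert this using 1
      apply ext_lat <;> simp [hxi, hxj] <;> ring


/-! ### Translated triangles -/

lemma coe_shift (z : E2) (s : Finset E2) : (shift z s : Set E2) = z +ᵥ (s : Set E2) := by
  ext v
  simp only [shift, Finset.coe_map, mem_image, Finset.mem_coe, mem_vadd_set]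
  refine exists_congr fun x => and_congr_right fun _ => ?_
  rw [vadd_eq_add, add_comm]
  rfl

lemma mem_shift {z v : E2} {s : Finset E2} : v ∈ shift z s ↔ v - z ∈ s := by
  rw [← Finset.mem_coe, coe_shift, mem_vadd_set_iff_neg_vadd_mem, Finset.mem_coe, vadd_eq_add,
    neg_add_eq_sub]

lemma add_mem_shift {z v : E2} {s : Finset E2} (hv : v ∈ s) : v + z ∈ shift z s := by
  rw [mem_shift]; simpa

lemma mem_tri_shift {z P : E2} {s : Finset E2} : P ∈ tri (shift z s) ↔ P - z ∈ tri s := by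
  rw [tri, coe_shift, convexHull_vadd, mem_vadd_set_iff_neg_vadd_mem, vadd_eq_add,
    neg_add_eq_sub, tri]

lemma shift_zero (s : Finset E2) : shift 0 s = s := by
  ext v; rw [mem_shift, sub_zero]

lemma shift_shift (z z' : E2) (s : Finset E2) : shift z (shift z' s) = shift (z + z') s := by
  ext v; rw [mem_shift, mem_shift, mem_shift, sub_sub]

lemma card_shift (z : E2) (s : Finset E2) : (shift z s).card = s.card := Finset.card_map _

lemma IsBas.shift {b : AffineBasis (Fin 3) ℝ E2} {s : Finset E2} (hb : IsBas b s) {z : E2}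
    (hz : z ∈ Lat) : ∃ b' : AffineBasis (Fin 3) ℝ E2, IsBas b' (shift z s) ∧
      (∀ i, b' i = b i + z) ∧ ∀ i P, b'.coord i P = b.coord i (P - z) := by
  obtain ⟨b', hb'⟩ := exists_affineBasis (f := fun i => z +ᵥ b i)
    ((AffineMap.affineIndependent_iff (AffineEquiv.constVAdd ℝ E2 z).toAffineMap
      (AffineEquiv.constVAdd ℝ E2 z).injective).2 b.ind)
  have h : ∀ i, b' i = b i + z := fun i => by
    rw [hb', add_comm]; rfl
  refine ⟨b', ⟨?_, fun i => ?_⟩, h, fun i P => ?_⟩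
  · rw [coe_shift, ← hb.1]
    ext v
    simp only [mem_range, mem_vadd_set, h, vadd_eq_add, exists_exists_eq_and, add_comm]
  · rw [h]; exact latG.add_mem (hb.2 i) hz
  · have h1 := b.sum_coord_apply_eq_one (P - z)
    have : P = ∑ j, b.coord j (P - z) • b' j := by
      simp only [h, smul_add, Finset.sum_add_distrib, sum_coord_smul, ← Finset.sum_smul, h1]
      simp
    conv_lhs => rw [this]
    exact coord_combination b' h1 i

lemma Reg.shift {s s' : Finset E2} (h : Reg s s') (z : E2) :
    Reg (shift z s) (shift z s') := by
  intro c h0 h1 hP v hv hc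
  have hs : ∀ {F : Type} [AddCommMonoid F] (f : E2 → F),
      ∑ v ∈ ACVacancy.shift z s, f v = ∑ v ∈ s, f (v + z) := fun f => Finset.sum_map _ _ _
  rw [mem_tri_shift, hs] at hP
  rw [hs] at h1
  rw [mem_shift] at hv ⊢
  refine h (fun v => c (v + z)) (fun v hv => h0 _ (add_mem_shift hv)) h1 ?_ _ hv (by simpa)
  convert hP using 1
  simp only [smul_add, Finset.sum_add_distrib, ← Finset.sum_smul, h1]
  simp

lemma weights_unique {b : AffineBasis (Fin 3) ℝ E2} {s : Finset E2} (hb : IsBas b s)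
    {c d : E2 → ℝ} (hc : ∑ v ∈ s, c v = 1) (hd : ∑ v ∈ s, d v = 1)
    (h : ∑ v ∈ s, c v • v = ∑ v ∈ s, d v • v) {v : E2} (hv : v ∈ s) : c v = d v := by
  obtain ⟨i, rfl⟩ := hb.exists_eq hv
  rw [← hb.coord_eq hc, h, hb.coord_eq hd]

lemma sum_inter_eq {s t : Finset E2} [DecidableEq E2] {F : Type*} [AddCommMonoid F] [Module ℝ F]
    (d : E2 → ℝ) (f : E2 → F) :
    ∑ v ∈ s, (if v ∈ t then d v else 0) • f v = ∑ v ∈ s ∩ t, d v • f v := by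
  rw [← Finset.filter_mem_eq_inter, Finset.sum_filter]
  refine Finset.sum_congr rfl fun v _ => ?_
  split_ifs <;> simp

/-- The common point also has weights supported on the common vertices, and weights on an affinely
independent vertex set are unique. -/
lemma reg_of_face {b : AffineBasis (Fin 3) ℝ E2} {s s' : Finset E2} (hb : IsBas b s)
    (h : tri s ∩ tri s' ⊆ convexHull ℝ ((s : Set E2) ∩ (s' : Set E2))) : Reg s s' := by
  classical
  intro c h0 h1 hP v hv hc
  have hs := mem_tri_iff.2 ⟨c, h0, h1, rfl⟩
  have := h ⟨hs, hP⟩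
  rw [← Finset.coe_inter, Finset.mem_convexHull'] at this
  obtain ⟨d, d0, d1, d2⟩ := this
  by_contra hvs
  have e1 := sum_inter_eq (s := s) (t := s') d fun _ => (1 : ℝ)
  have e2 := sum_inter_eq (s := s) (t := s') d fun v => v
  simp only [smul_eq_mul, mul_one] at e1
  have := weights_unique hb h1 (e1.trans d1) (by rw [e2, d2]) hv
  rw [if_neg hvs] at this
  exact hc.ne' this

/-- The weights of a common point with respect to s live on common vertices, so they are also its
weights with respect to s'. Uniqueness on s' finishes the argument. -/
lemma Reg.symm {b' : AffineBasis (Fin 3) ℝ E2} {s s' : Finset E2}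
    (hb' : IsBas b' s') (h : Reg s s') : Reg s' s := by
  classical
  intro c h0 h1 hP v hv hc
  have hs' := mem_tri_iff.2 ⟨c, h0, h1, rfl⟩
  obtain ⟨d, d0, d1, d2⟩ := mem_tri_iff.1 hP
  have hsup := h d d0 d1 (d2 ▸ hs')
  by_contra hvs
  have key : ∀ {F : Type} [AddCommGroup F] [Module ℝ F] (f : E2 → F),
      ∑ v ∈ s', (if v ∈ s then d v else 0) • f v = ∑ v ∈ s, d v • f v := by
    intro F _ _ f
    rw [sum_inter_eq, Finset.inter_comm]
    refine Finset.sum_subset Finset.inter_subset_left fun v hv hv' => ?_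
    have : d v = 0 := le_antisymm
      (not_lt.1 fun h => hv' (Finset.mem_inter.2 ⟨hv, hsup v hv h⟩)) (d0 v hv)
    rw [this, zero_smul]
  have e1 := key fun _ => (1 : ℝ)
  have e2 := key fun v => v
  simp only [smul_eq_mul, mul_one] at e1
  have := weights_unique hb' h1 (e1.trans d1) (by rw [e2, d2]) hv
  rw [if_neg hvs] at this
  exact hc.ne' this

lemma Reg.subset_of_interior {b : AffineBasis (Fin 3) ℝ E2} {s s' : Finset E2} (hb : IsBas b s)
    (h : Reg s s') {P : E2} (hP : ∀ i, 0 < b.coord i P) (hP' : P ∈ tri s') : s ⊆ s' := by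
  have hs : P ∈ tri s := hb.mem_tri_iff.2 fun i => (hP i).le
  obtain ⟨c, h0, h1, rfl⟩ := mem_tri_iff.1 hs
  intro v hv
  obtain ⟨i, rfl⟩ := hb.exists_eq hv
  exact h c h0 h1 hP' _ hv (by rw [← hb.coord_eq h1]; exact hP i)

lemma IsBas.card {b : AffineBasis (Fin 3) ℝ E2} {s : Finset E2} (hb : IsBas b s) :
    s.card = 3 := by
  have := hb.sum fun _ => (1 : ℕ)
  simpa using this

/-! ### The mesh -/

namespace ACMesh

variable (m : ACMesh)

lemma mem_Th_iff {s : Finset E2} : s ∈ m.Th ↔ s ∈ m.Thc ∨ (s ∈ micro ∧ tri s ⊆ m.Ωa) := Iff.rfl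

lemma exists_isBas {s : Finset E2} (hs : s ∈ m.Th) : ∃ b, IsBas b s := by
  rcases m.mem_Th_iff.1 hs with h | h
  · exact exists_isBas_of_card (m.card_eq s h) (m.indep s h) (m.vertex_mem s h)
  · exact exists_isBas_of_micro h.1

/-- An enumeration of the vertices of a triangle of the mesh. -/
noncomputable def bas (s : m.Th) : AffineBasis (Fin 3) ℝ E2 := (m.exists_isBas s.2).choose

lemma isBas (s : m.Th) : IsBas (m.bas s) s.1 := (m.exists_isBas s.2).choose_spec

lemma closure_contRegion_sub : closure (contRegion m.N m.Ωa) ⊆ closure (cell m.N \ m.Ωa) :=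
  closure_minimal inter_subset_left isClosed_closure

lemma tri_sub_closure_contRegion {s : Finset E2} (hs : s ∈ m.Thc) :
    tri s ⊆ closure (contRegion m.N m.Ωa) := by
  rw [← m.cover]; exact subset_biUnion_of_mem (u := tri) hs

lemma tri_sub_closure_diff {s : Finset E2} (hs : s ∈ m.Thc) :
    tri s ⊆ closure (cell m.N \ m.Ωa) :=
  (m.tri_sub_closure_contRegion hs).trans m.closure_contRegion_sub

lemma tri_sub_closure_cell {s : Finset E2} (hs : s ∈ m.Th) : tri s ⊆ closure (cell m.N) := by
  rcases m.mem_Th_iff.1 hs with h | h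
  · exact (m.tri_sub_closure_diff h).trans (closure_mono sdiff_subset)
  · exact h.2.trans (m.Ωa_sub.trans (interior_subset.trans subset_closure))

lemma closure_diff_disjoint : Disjoint (closure (cell m.N \ m.Ωa)) (interior m.Ωa) := by
  refine Disjoint.closure_left ?_ isOpen_interior
  exact disjoint_left.2 fun x hx hx' => hx.2 (interior_subset hx')

lemma notMem_interior_of_mem {s : Finset E2} (hs : s ∈ m.Thc) {P : E2} (hP : P ∈ tri s) :
    P ∉ interior m.Ωa := fun h =>
  disjoint_left.1 m.closure_diff_disjoint (m.tri_sub_closure_diff hs hP) h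

lemma mem_Ωa_iff {P : E2} : P ∈ m.Ωa ↔ ∃ s ∈ micro, tri s ⊆ m.Ωa ∧ P ∈ tri s := by
  obtain ⟨A, hA, h⟩ := m.Ωa_aligned
  constructor
  · intro hP
    rw [h, mem_iUnion₂] at hP
    obtain ⟨s, hs, hP⟩ := hP
    refine ⟨s, hA hs, ?_, hP⟩
    rw [h]; exact subset_biUnion_of_mem (u := tri) hs
  · rintro ⟨s, -, hs, hP⟩
    exact hs hP

lemma finite_Th : m.Th.Finite := by
  refine (Finset.finite_toSet _).union ?_
  refine ((finite_Lat_inter_cell m.N).toFinset.powerset.finite_toSet).subset ?_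
  rintro s ⟨hs, hsub⟩
  rw [Finset.mem_coe, Finset.mem_powerset]
  intro v hv
  rw [Set.Finite.mem_toFinset]
  exact ⟨micro_vertex_mem hs hv, interior_subset (m.Ωa_sub (hsub (mem_tri_of_mem hv)))⟩

instance : Finite m.Th := m.finite_Th

/-- Being a union of full triangles, the atomistic region has no lower-dimensional parts. -/
lemma Ωa_sub_closure_interior : m.Ωa ⊆ closure (interior m.Ωa) := by
  intro P hP
  obtain ⟨s, hs, hsub, hP⟩ := m.mem_Ωa_iff.1 hP
  obtain ⟨b, hb⟩ := exists_isBas_of_micro hs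
  rw [tri_eq_closure_interior hb] at hP
  exact closure_mono (interior_mono hsub) hP

/-- The triangles of the periodic mesh, as sets. -/
def K (j : m.Th × perLat m.N) : Set E2 := {P | P - j.2.1 ∈ tri j.1.1}

lemma mem_K {j : m.Th × perLat m.N} {P : E2} : P ∈ m.K j ↔ P - j.2.1 ∈ tri j.1.1 := Iff.rfl

lemma exists_mem_K (P : E2) : ∃ j, P ∈ m.K j := by
  obtain ⟨z, hz, hP⟩ := exists_sub_mem_cell m.N_pos P
  by_cases h : P - z ∈ m.Ωa
  · obtain ⟨s, hs, hsub, hP⟩ := m.mem_Ωa_iff.1 h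
    exact ⟨⟨⟨s, m.mem_Th_iff.2 (Or.inr ⟨hs, hsub⟩)⟩, ⟨z, hz⟩⟩, hP⟩
  · have : P - z ∈ closure (contRegion m.N m.Ωa) :=
      subset_closure ⟨subset_closure ⟨hP, h⟩, hP⟩
    rw [← m.cover, mem_iUnion₂] at this
    obtain ⟨s, hs, hP⟩ := this
    exact ⟨⟨⟨s, m.mem_Th_iff.2 (Or.inl hs)⟩, ⟨z, hz⟩⟩, hP⟩

lemma finite_perLat_near (N : ℕ) (hN : 0 < N) (P : E2) (R : ℝ) :
    {z | z ∈ perLat N ∧ |cα z - cα P| ≤ R ∧ |cβ z - cβ P| ≤ R}.Finite := by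
  have hN' : (0 : ℝ) < N := by exact_mod_cast hN
  refine ((Set.finite_Icc ⌊(cα P - R) / N⌋ ⌈(cα P + R) / N⌉).prod
    (Set.finite_Icc ⌊(cβ P - R) / N⌋ ⌈(cβ P + R) / N⌉) |>.image
      fun p : ℤ × ℤ => ((p.1 : ℝ) * N) • a1 + ((p.2 : ℝ) * N) • a2).subset ?_
  rintro _ ⟨⟨i, j, rfl⟩, h1, h2⟩
  have key : ∀ (a : ℝ) (i : ℤ), |i * N - a| ≤ R → i ∈ Icc ⌊(a - R) / N⌋ ⌈(a + R) / N⌉ := by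
    intro a i h
    rw [abs_le] at h
    constructor
    · have : (⌊(a - R) / N⌋ : ℝ) ≤ i :=
        (Int.floor_le _).trans ((div_le_iff₀ hN').2 (by linarith))
      exact_mod_cast this
    · have : (i : ℝ) ≤ ⌈(a + R) / N⌉ :=
        ((le_div_iff₀ hN').2 (by linarith)).trans (Int.le_ceil _)
      exact_mod_cast this
  have e1 : cα (((i : ℝ) * N) • a1 + ((j : ℝ) * N) • a2) = i * N := by simp
  have e2 : cβ (((i : ℝ) * N) • a1 + ((j : ℝ) * N) • a2) = j * N := by simp
  rw [e1] at h1
  rw [e2] at h2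
  exact ⟨(i, j), ⟨key _ _ h1, key _ _ h2⟩, rfl⟩

lemma isCover : IsCover m.K where
  closed j := (isClosed_tri j.1.1).preimage (by fun_prop)
  convex j := by
    have : m.K j = tri (shift j.2.1 j.1.1) := by ext P; rw [mem_tri_shift]; rfl
    rw [this]; exact convex_tri _
  cover := eq_univ_of_forall fun P => mem_iUnion.2 (m.exists_mem_K P)
  locFin := by
    intro P
    refine ⟨{Q | |cα Q - cα P| < 1 ∧ |cβ Q - cβ P| < 1}, ?_, ?_⟩
    · refine IsOpen.mem_nhds ?_ (by simp)
      have h1 : Continuous fun Q => |cα Q - cα P| := by fun_prop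
      have h2 : Continuous fun Q => |cβ Q - cβ P| := by fun_prop
      exact (isOpen_lt h1 continuous_const).inter (isOpen_lt h2 continuous_const)
    -- A triangle lies in a closed cell of width N in each lattice coordinate, and the neighbourhood
    -- has radius 1; hence N + 1.
    · have hf := finite_perLat_near m.N m.N_pos P (m.N + 1)
      have : Finite {z | z ∈ perLat m.N ∧ |cα z - cα P| ≤ m.N + 1 ∧ |cβ z - cβ P| ≤ m.N + 1} := hf
      refine Set.Finite.subset (Set.Finite.prod (Set.finite_univ (α := m.Th))
        (hf.preimage (Subtype.val_injective.injOn))) ?_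
      rintro ⟨s, z⟩ ⟨Q, hQ, hQ1, hQ2⟩
      refine ⟨mem_univ _, z.2, ?_⟩
      have hQ := m.tri_sub_closure_cell s.2 hQ
      rw [mem_closure_cell_iff m.N_pos, map_sub, map_sub] at hQ
      obtain ⟨⟨g1, g2⟩, g3, g4⟩ := hQ
      simp only at g1 g2 g3 g4
      rw [abs_lt] at hQ1 hQ2
      rw [abs_le, abs_le]
      refine ⟨⟨?_, ?_⟩, ?_, ?_⟩ <;> linarith

instance : Countable (m.Th × perLat m.N) := inferInstance

end ACMesh


/-! ### Regularity of the mesh across the boundary of the atomistic region -/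

/-- Unions of locally finite families of closed sets are closed. Applied to the complement of one
piece, this produces a neighbouring piece at each of its boundary points. -/
lemma IsCover.exists_mem_of_closure {J : Type} {K : J → Set E2} (h : IsCover K) {S : Set J}
    {U : Set E2} (hU : ∀ P ∈ U, ∃ j ∈ S, P ∈ K j) {P : E2} (hP : P ∈ closure U) :
    ∃ j ∈ S, P ∈ K j := by
  have hc : IsClosed (⋃ j : S, K j) :=
    (h.locFin.comp_injective Subtype.val_injective).isClosed_iUnion fun j => h.closed j
  have hsub : U ⊆ ⋃ j : S, K j := fun Q hQ => by
    obtain ⟨j, hj, hQ⟩ := hU Q hQ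
    exact mem_iUnion.2 ⟨⟨j, hj⟩, hQ⟩
  obtain ⟨j, hj⟩ := mem_iUnion.1 (closure_minimal hsub hc hP)
  exact ⟨j, j.2, hj⟩

lemma fin3_others : ∀ i : Fin 3, ∃ k l, k ≠ l ∧ i ≠ k ∧ i ≠ l := by decide

lemma fin3_third : ∀ k l : Fin 3, k ≠ l → ∃ i, i ≠ k ∧ i ≠ l := by decide

lemma fin3_cases {i k l : Fin 3} (h1 : k ≠ l) (h2 : i ≠ k) (h3 : i ≠ l) (x : Fin 3) :
    x = i ∨ x = k ∨ x = l := by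
  revert i k l x; decide

lemma sum_fin3 {F : Type*} [AddCommMonoid F] {i k l : Fin 3} (h1 : k ≠ l) (h2 : i ≠ k)
    (h3 : i ≠ l) (f : Fin 3 → F) : ∑ x, f x = f i + (f k + f l) := by
  have : (Finset.univ : Finset (Fin 3)) = {i, k, l} := by
    ext x; simpa using fin3_cases h1 h2 h3 x
  rw [this, Finset.sum_insert (by simp [h2, h3]), Finset.sum_pair h1]

lemma coord_edge {b : AffineBasis (Fin 3) ℝ E2} {i k l : Fin 3} (h1 : k ≠ l) (h2 : i ≠ k)
    (h3 : i ≠ l) {α β : ℝ} (h : α + β = 1) :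
    b.coord i (α • b k + β • b l) = 0 ∧ b.coord k (α • b k + β • b l) = α ∧
      b.coord l (α • b k + β • b l) = β := by
  set c : Fin 3 → ℝ := fun x => if x = i then 0 else if x = k then α else β with hc
  have c1 : c i = 0 := by simp [hc]
  have c2 : c k = α := by simp [hc, h2.symm]
  have c3 : c l = β := by simp [hc, h3.symm, h1.symm]
  have e1 : ∑ x, c x = 1 := by rw [sum_fin3 h1 h2 h3, c1, c2, c3, zero_add, h]
  have e2 : α • b k + β • b l = ∑ x, c x • b x := by
    rw [sum_fin3 h1 h2 h3, c1, c2, c3, zero_smul, zero_add]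
  rw [e2, coord_combination b e1, coord_combination b e1, coord_combination b e1]
  exact ⟨c1, c2, c3⟩

lemma eq_edge {b : AffineBasis (Fin 3) ℝ E2} {i k l : Fin 3} (h1 : k ≠ l) (h2 : i ≠ k)
    (h3 : i ≠ l) {P : E2} (hP : b.coord i P = 0) :
    P = b.coord k P • b k + b.coord l P • b l ∧ b.coord k P + b.coord l P = 1 := by
  have e1 := sum_coord_smul b P
  have e2 := b.sum_coord_apply_eq_one P
  rw [sum_fin3 h1 h2 h3, hP, zero_smul, zero_add] at e1
  rw [sum_fin3 h1 h2 h3, hP, zero_add] at e2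
  exact ⟨e1.symm, e2⟩

lemma Reg.mem_of_coord_pos {b : AffineBasis (Fin 3) ℝ E2} {s s' : Finset E2} (hb : IsBas b s)
    (h : Reg s s') {P : E2} (hP : P ∈ tri s) (hP' : P ∈ tri s') {i : Fin 3}
    (hi : 0 < b.coord i P) : b i ∈ s' := by
  obtain ⟨c, h0, h1, rfl⟩ := mem_tri_iff.1 hP
  exact h c h0 h1 hP' _ (hb.mem i) (by rwa [← hb.coord_eq h1])

/-- The integer equation p² + pq + q² = 1 forces p, q and p + q to be at most one in modulus, so an
edge of length one fits into unit strips of all three families. -/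
lemma exists_slab_of_dist {u v : E2} (hu : u ∈ Lat) (hv : v ∈ Lat) (h : dist u v = 1) :
    ∃ i j k : ℤ, u ∈ slab i j k ∧ v ∈ slab i j k := by
  obtain ⟨p, q, hp, hq⟩ := mem_Lat_iff.1 hu
  obtain ⟨p', q', hp', hq'⟩ := mem_Lat_iff.1 hv
  have h2 : (p - p' : ℤ) ^ 2 + (p - p') * (q - q') + (q - q') ^ 2 = 1 := by
    have := norm_sq_lat (u - v)
    rw [← dist_eq_norm, h, map_sub, map_sub, hp, hq, hp', hq'] at this
    exact_mod_cast (by linear_combination -this :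
      ((p : ℝ) - p') ^ 2 + (p - p') * (q - q') + (q - q') ^ 2 = 1)
  have g1 : (p - p') ^ 2 ≤ 1 := by nlinarith [sq_nonneg (2 * (q - q') + (p - p'))]
  have g2 : (q - q') ^ 2 ≤ 1 := by nlinarith [sq_nonneg (2 * (p - p') + (q - q'))]
  have g3 : (p + q - (p' + q')) ^ 2 ≤ 1 := by nlinarith [sq_nonneg ((p - p') - (q - q'))]
  have key : ∀ x y : ℤ, (x - y) ^ 2 ≤ 1 →
      (x : ℝ) ∈ Icc ((min x y : ℤ) : ℝ) ((min x y : ℤ) + 1) ∧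
      (y : ℝ) ∈ Icc ((min x y : ℤ) : ℝ) ((min x y : ℤ) + 1) := by
    intro x y hxy
    have := abs_le_of_sq_le_sq' (show (x - y) ^ 2 ≤ 1 ^ 2 by simpa using hxy) zero_le_one
    have a1 : min x y ≤ x ∧ x ≤ min x y + 1 ∧ min x y ≤ y ∧ y ≤ min x y + 1 := by omega
    obtain ⟨b1, b2, b3, b4⟩ := a1
    exact ⟨⟨by exact_mod_cast b1, by exact_mod_cast b2⟩, by exact_mod_cast b3,
      by exact_mod_cast b4⟩
  refine ⟨min p p', min q q', min (p + q) (p' + q'), ⟨?_, ?_, ?_⟩, ?_, ?_, ?_⟩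
  · rw [hp]; exact (key _ _ g1).1
  · rw [hq]; exact (key _ _ g2).1
  · rw [hp, hq]; exact_mod_cast (key _ _ g3).1
  · rw [hp']; exact (key _ _ g1).2
  · rw [hq']; exact (key _ _ g2).2
  · rw [hp', hq']; exact_mod_cast (key _ _ g3).2

lemma shift_mem_micro {s : Finset E2} (hs : s ∈ micro) {z : E2} (hz : z ∈ Lat) :
    shift z s ∈ micro := by
  obtain ⟨x, hx, h⟩ := hs
  refine ⟨z + x, latG.add_mem hz hx, ?_⟩
  rw [coe_shift]
  rcases h with h | h
  · left
    rw [h, ← image_vadd, image_insert_eq, image_pair]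
    simp only [vadd_eq_add, add_assoc]
  · right
    rw [h, ← image_vadd, image_insert_eq, image_pair]
    simp only [vadd_eq_add, add_assoc]

lemma interior_closure_cell {N : ℕ} (hN : 0 < N) :
    interior (closure (cell N)) = interior (cell N) := by
  refine (convex_cell N).interior_closure_eq_interior_of_nonempty_interior ?_
  have h0 : (0 : ℝ) < N := by exact_mod_cast hN
  refine ⟨((N : ℝ) / 2) • a1 + ((N : ℝ) / 2) • a2, mem_interior_cell_iff.2 ?_⟩
  have e1 : cα (((N : ℝ) / 2) • a1 + ((N : ℝ) / 2) • a2) = N / 2 := by simp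
  have e2 : cβ (((N : ℝ) / 2) • a1 + ((N : ℝ) / 2) • a2) = N / 2 := by simp
  rw [e1, e2]
  exact ⟨⟨by linarith, by linarith⟩, by linarith, by linarith⟩

namespace ACMesh

variable (m : ACMesh)

/-- If Q were not in Ωa, the mesh triangle on the other side of the edge at Q would be a continuum
triangle and, by regularity, would have the same edge. Near P there are interior points of Ωa; they
avoid both triangles, so both triangles lie on the same side of the edge and therefore coincide.
Thus the relative interior of an edge is in Ωa entirely or not at all. -/
lemma mem_Ωa_of_edge {T : Finset E2} (hT : T ∈ m.Thc) {b : AffineBasis (Fin 3) ℝ E2}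
    (hb : IsBas b T) {i k l : Fin 3} (h1 : k ≠ l) (h2 : i ≠ k) (h3 : i ≠ l) {P : E2}
    (hP : P ∈ m.Ωa) (hPi : b.coord i P = 0) (hPk : 0 < b.coord k P) (hPl : 0 < b.coord l P)
    {Q : E2} (hQi : b.coord i Q = 0) (hQk : 0 < b.coord k Q) (hQl : 0 < b.coord l Q) :
    Q ∈ m.Ωa := by
  by_contra hQ
  have hTh : T ∈ m.Th := m.mem_Th_iff.2 (Or.inl hT)
  have hQT : Q ∈ tri T := hb.mem_tri_iff.2 fun x => by
    rcases fin3_cases h1 h2 h3 x with rfl | rfl | rfl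
    exacts [hQi.ge, hQk.le, hQl.le]
  have hcl : Q ∈ closure (tri T)ᶜ := by
    rw [closure_compl, hb.interior_tri]
    exact fun h => (h i).ne' hQi
  obtain ⟨⟨⟨t, ht⟩, ⟨z, hz⟩⟩, hj, hQj⟩ := m.isCover.exists_mem_of_closure
    (S := {j | shift j.2.1 j.1.1 ≠ T}) (U := (tri T)ᶜ) (fun X hX => by
      obtain ⟨j, hj⟩ := m.exists_mem_K X
      refine ⟨j, fun h => hX ?_, hj⟩
      rw [← h, mem_tri_shift]; exact hj) hcl
  rw [mem_ofPred_eq] at hj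
  rw [mem_K] at hQj
  simp only at hj hQj
  have htc : t ∈ m.Thc := by
    rcases m.mem_Th_iff.1 ht with h | h
    · exact h
    · have := eq_zero_of_mem_interior_closure hz (m.tri_sub_closure_cell hTh hQT)
        (m.Ωa_sub (h.2 hQj))
      rw [this, sub_zero] at hQj
      exact absurd (h.2 hQj) hQ
  obtain ⟨b₀, hb₀⟩ := m.exists_isBas ht
  obtain ⟨b', hb', -, -⟩ := hb₀.shift (perLat_sub_Lat _ hz)
  have hreg : Reg T (shift z t) := reg_of_face hb (m.regular T hT t htc z hz)
  have hQS : Q ∈ tri (shift z t) := mem_tri_shift.2 hQj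
  obtain ⟨k', hk'⟩ := hb'.exists_eq (hreg.mem_of_coord_pos hb hQT hQS hQk)
  obtain ⟨l', hl'⟩ := hb'.exists_eq (hreg.mem_of_coord_pos hb hQT hQS hQl)
  have h1' : k' ≠ l' := by
    rintro rfl
    exact h1 (b.ind.injective (hk'.symm.trans hl'))
  obtain ⟨i', h2', h3'⟩ := fin3_third k' l' h1'
  obtain ⟨e1, e2⟩ := eq_edge h1 h2 h3 hPi
  obtain ⟨f1, f2, f3⟩ := coord_edge (b := b') h1' h2' h3' e2
  rw [hk', hl', ← e1] at f1 f2 f3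
  -- A neighbourhood of P that is symmetric in the edge coordinates of both triangles: for X in it,
  -- these coordinates are positive at X and also at the reflected point P + P − X.
  set U : Set E2 := (b.coord k ⁻¹' Ioo 0 (2 * b.coord k P) ∩ b.coord l ⁻¹' Ioo 0 (2 * b.coord l P))
    ∩ (b'.coord k' ⁻¹' Ioo 0 (2 * b.coord k P) ∩ b'.coord l' ⁻¹' Ioo 0 (2 * b.coord l P)) with hU
  have hUo : IsOpen U :=
    ((isOpen_Ioo.preimage (continuous_coord b k)).inter
      (isOpen_Ioo.preimage (continuous_coord b l))).inter
    ((isOpen_Ioo.preimage (continuous_coord b' k')).inter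
      (isOpen_Ioo.preimage (continuous_coord b' l')))
  have hPU : P ∈ U := by
    refine ⟨⟨⟨hPk, by linarith⟩, ⟨hPl, by linarith⟩⟩, ⟨?_, ?_⟩, ?_, ?_⟩ <;>
      (first | rw [f2] | rw [f3]) <;> linarith
  obtain ⟨X, ⟨⟨⟨x1, x2⟩, ⟨x3, x4⟩⟩, ⟨x5, x6⟩, ⟨x7, x8⟩⟩, hX⟩ :=
    mem_closure_iff.1 (m.Ωa_sub_closure_interior hP) U hUo hPU
  have hXi : b.coord i X < 0 := by
    by_contra h
    push Not at h
    refine m.notMem_interior_of_mem hT (hb.mem_tri_iff.2 fun x => ?_) hX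
    rcases fin3_cases h1 h2 h3 x with rfl | rfl | rfl
    exacts [h, x1.le, x3.le]
  have hXi' : b'.coord i' X < 0 := by
    by_contra h
    push Not at h
    have hXS : X - z ∈ tri t := by
      rw [← mem_tri_shift, hb'.mem_tri_iff]
      intro x
      rcases fin3_cases h1' h2' h3' x with rfl | rfl | rfl
      exacts [h, x5.le, x7.le]
    have hz0 : -z = 0 := eq_zero_of_mem_interior_closure ((perG m.N).neg_mem hz)
      (m.tri_sub_closure_cell ht hXS) (by
        rw [sub_neg_eq_add, sub_add_cancel]; exact m.Ωa_sub (interior_subset hX))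
    rw [neg_eq_zero] at hz0
    rw [hz0, sub_zero] at hXS
    exact m.notMem_interior_of_mem htc hXS hX
  -- X lies beyond the edge for both triangles, so its reflection in P is inside both of them.
  have hX1 : ∀ x, 0 < b.coord x (P + P - X) := by
    intro x
    rw [coord_add]
    rcases fin3_cases h1 h2 h3 x with rfl | rfl | rfl <;> linarith
  have hX2 : P + P - X ∈ tri (shift z t) := hb'.mem_tri_iff.2 fun x => by
    rw [coord_add]
    rcases fin3_cases h1' h2' h3' x with rfl | rfl | rfl
    · linarith
    · rw [f2]; linarith
    · rw [f3]; linarith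
  have hsub := hreg.subset_of_interior hb hX1 hX2
  exact hj (Finset.eq_of_subset_of_card_le hsub (by rw [hb'.card, hb.card])).symm

/-- A common point P is not interior to T, since T avoids the interior of Ωa, which is dense in Ωa.
If P is a vertex of T, it is a lattice point of τ, hence a vertex of τ. Otherwise it is inside an
edge; that edge lies in the frontier of Ωa by `mem_Ωa_of_edge`, so it has length one, and edges of
length one meet micro-triangles in faces. -/
lemma reg_Thc_micro {T τ : Finset E2} (hT : T ∈ m.Thc) (hτ : τ ∈ micro) (hsub : tri τ ⊆ m.Ωa) :
    Reg T τ := by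
  classical
  intro c h0 c1 hPτ v hv hc
  have hTh : T ∈ m.Th := m.mem_Th_iff.2 (Or.inl hT)
  obtain ⟨b, hb⟩ := m.exists_isBas hTh
  have hPT : ∑ v ∈ T, c v • v ∈ tri T := mem_tri_iff.2 ⟨c, h0, c1, rfl⟩
  have hcoord : ∀ i, b.coord i (∑ v ∈ T, c v • v) = c (b i) := hb.coord_eq c1
  set P := ∑ v ∈ T, c v • v with hPdef
  have hnn := hb.mem_tri_iff.1 hPT
  have hvert : v ∈ tri τ → v ∈ τ := by
    obtain ⟨_, _, _, -, h⟩ := micro_slab hτ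
    exact h v (m.vertex_mem T hT hv)
  by_cases hall : ∀ i, 0 < b.coord i P
  · have hPint : P ∈ interior (tri T) := by rw [hb.interior_tri]; exact hall
    obtain ⟨X, hX, hX'⟩ := mem_closure_iff.1 (m.Ωa_sub_closure_interior (hsub hPτ)) _
      isOpen_interior hPint
    exact absurd hX' (m.notMem_interior_of_mem hT (interior_subset hX))
  push Not at hall
  obtain ⟨i, hi⟩ := hall
  have hi : b.coord i P = 0 := le_antisymm hi (hnn i)
  obtain ⟨k, l, h1, h2, h3⟩ := fin3_others i
  obtain ⟨i₀, rfl⟩ := hb.exists_eq hv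
  rw [← hcoord] at hc
  have hi0 : i₀ = k ∨ i₀ = l := by
    rcases fin3_cases h1 h2 h3 i₀ with rfl | h | h
    · exact absurd hi hc.ne'
    · exact Or.inl h
    · exact Or.inr h
  obtain ⟨e1, e2⟩ := eq_edge h1 h2 h3 hi
  by_cases hk : b.coord k P = 0
  · rw [hk, zero_add] at e2
    rw [hk, e2, zero_smul, zero_add, one_smul] at e1
    rcases hi0 with rfl | rfl
    · exact absurd hk hc.ne'
    · exact hvert (e1 ▸ hPτ)
  by_cases hl : b.coord l P = 0
  · rw [hl, add_zero] at e2
    rw [hl, e2, zero_smul, add_zero, one_smul] at e1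
    rcases hi0 with rfl | rfl
    · exact hvert (e1 ▸ hPτ)
    · exact absurd hl hc.ne'
  have hk : 0 < b.coord k P := lt_of_le_of_ne (hnn k) (Ne.symm hk)
  have hl : 0 < b.coord l P := lt_of_le_of_ne (hnn l) (Ne.symm hl)
  have hopen : openSegment ℝ (b k) (b l) ⊆ m.Ωa := by
    rintro Q ⟨α, β, hα, hβ, hαβ, rfl⟩
    obtain ⟨f1, f2, f3⟩ := coord_edge (b := b) h1 h2 h3 hαβ
    exact m.mem_Ωa_of_edge hT hb h1 h2 h3 (hsub hPτ) hi hk hl f1 (by rwa [f2]) (by rwa [f3])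
  have hseg : segment ℝ (b k) (b l) ⊆ frontier m.Ωa := by
    intro Q hQ
    refine ⟨?_, m.notMem_interior_of_mem hT ((convex_tri T).segment_subset
      (mem_tri_of_mem (hb.mem k)) (mem_tri_of_mem (hb.mem l)) hQ)⟩
    rw [← closure_openSegment] at hQ
    exact closure_mono hopen hQ
  have hd := m.unit_edges T hT _ (hb.mem k) _ (hb.mem l)
    (fun h => h1 (b.ind.injective h)) hseg
  obtain ⟨p, q, r, hu, hw⟩ := exists_slab_of_dist (hb.2 k) (hb.2 l) hd
  have hne : b k ≠ b l := fun h => h1 (b.ind.injective h)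
  refine micro_support (s := {b k, b l}) (i := p) (j := q) (k := r) ?_ hτ c ?_ ?_ ?_ _ ?_
    (by rwa [← hcoord])
  · intro x hx
    rw [Finset.mem_insert, Finset.mem_singleton] at hx
    rcases hx with rfl | rfl
    exacts [⟨hb.2 k, hu⟩, ⟨hb.2 l, hw⟩]
  · intro x hx
    rw [Finset.mem_insert, Finset.mem_singleton] at hx
    rcases hx with rfl | rfl
    exacts [h0 _ (hb.mem k), h0 _ (hb.mem l)]
  · rw [Finset.sum_pair hne, ← hcoord, ← hcoord, e2]
  · rw [Finset.sum_pair hne, ← hcoord, ← hcoord, ← e1]; exact hPτ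
  · rw [Finset.mem_insert, Finset.mem_singleton]
    rcases hi0 with rfl | rfl
    exacts [Or.inl rfl, Or.inr rfl]

lemma eq_zero_of_tri_inter {s t : Finset E2} (hs : s ∈ m.Th) (ht : tri t ⊆ m.Ωa) {z P : E2}
    (hz : z ∈ perLat m.N) (hP : P ∈ tri s) (hP' : P - z ∈ tri t) : z = 0 :=
  eq_zero_of_mem_interior_closure hz (m.tri_sub_closure_cell hs hP) (m.Ωa_sub (ht hP'))

lemma reg_Thc_micro_shift {T τ : Finset E2} (hT : T ∈ m.Thc) (hτ : τ ∈ micro)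
    (hsub : tri τ ⊆ m.Ωa) {z : E2} (hz : z ∈ perLat m.N) : Reg T (shift z τ) := by
  intro c h0 h1 hP v hv hc
  have hPT : ∑ v ∈ T, c v • v ∈ tri T := mem_tri_iff.2 ⟨c, h0, h1, rfl⟩
  have hz0 := m.eq_zero_of_tri_inter (m.mem_Th_iff.2 (Or.inl hT)) hsub hz hPT (mem_tri_shift.1 hP)
  rw [hz0, shift_zero] at hP ⊢
  exact m.reg_Thc_micro hT hτ hsub c h0 h1 hP v hv hc

lemma reg_shift {s t : Finset E2} (hs : s ∈ m.Th) (ht : t ∈ m.Th) {z : E2}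
    (hz : z ∈ perLat m.N) : Reg s (shift z t) := by
  obtain ⟨b, hb⟩ := m.exists_isBas hs
  rcases m.mem_Th_iff.1 hs with h | h <;> rcases m.mem_Th_iff.1 ht with h' | h'
  · exact reg_of_face hb (m.regular s h t h' z hz)
  · exact m.reg_Thc_micro_shift h h'.1 h'.2 hz
  · have := (m.reg_Thc_micro_shift h' h.1 h.2 ((perG m.N).neg_mem hz)).shift z
    rw [shift_shift, add_neg_cancel, shift_zero] at this
    exact this.symm hb
  · exact reg_micro h.1 (shift_mem_micro h'.1 (perLat_sub_Lat _ hz))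

lemma reg_Thper {s s' : Finset E2} (hs : s ∈ m.Thper) (hs' : s' ∈ m.Thper) : Reg s s' := by
  obtain ⟨t, ht, z, hz, rfl⟩ := hs
  obtain ⟨t', ht', z', hz', rfl⟩ := hs'
  have := (m.reg_shift ht ht' ((perG m.N).sub_mem hz' hz)).shift z
  rwa [shift_shift, add_sub_cancel] at this

/-- The mesh interpolant on a triangle. -/
lemma Ih_eq (f : E2 → E2) {j : m.Th × perLat m.N} {P : E2} (hP : P ∈ m.K j) :
    m.Ih f P = ∑ i, (m.bas j.1).coord i (P - j.2.1) • f (m.bas j.1 i + j.2.1) := by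
  obtain ⟨b', hb', h1, h2⟩ := (m.isBas j.1).shift (perLat_sub_Lat _ j.2.2)
  have hmem : shift j.2.1 j.1.1 ∈ m.Thper := ⟨j.1.1, j.1.2, j.2.1, j.2.2, rfl⟩
  rw [Ih, p1_eq hmem (fun s' hs' => m.reg_Thper hs' hmem) hb' (mem_tri_shift.2 hP)]
  simp only [h1, h2]

lemma interior_tri_sub_cell {s : Finset E2} (hs : s ∈ m.Th) :
    interior (tri s) ⊆ interior (cell m.N) := by
  rw [← interior_closure_cell m.N_pos]
  exact interior_mono (m.tri_sub_closure_cell hs)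

lemma mem_interior_K {j : m.Th × perLat m.N} {P : E2} :
    P ∈ interior (m.K j) ↔ P - j.2.1 ∈ interior (tri j.1.1) := by
  have : m.K j = (Homeomorph.subRight j.2.1) ⁻¹' tri j.1.1 := rfl
  rw [this, ← Homeomorph.preimage_interior]
  rfl

/-- At an interior point all three weights are positive, so regularity gives equal vertex sets. The
period is then determined as well, because the interiors of the unshifted triangles are in the
interior of the cell. -/
lemma eq_of_mem_interior_K {j j' : m.Th × perLat m.N} {P : E2} (h : P ∈ interior (m.K j))
    (h' : P ∈ m.K j') : j = j' := by
  rw [mem_interior_K] at h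
  have hz : j'.2.1 - j.2.1 ∈ perLat m.N := (perG m.N).sub_mem j'.2.2 j.2.2
  have hb := m.isBas j.1
  have e : P - j.2.1 - (j'.2.1 - j.2.1) = P - j'.2.1 := by abel
  have hsub : j.1.1 ⊆ shift (j'.2.1 - j.2.1) j'.1.1 := by
    refine (m.reg_shift j.1.2 j'.1.2 hz).subset_of_interior hb (P := P - j.2.1) ?_ ?_
    · rw [hb.interior_tri] at h; exact h
    · rw [mem_tri_shift, e]; exact h'
  have heq := Finset.eq_of_subset_of_card_le hsub
    (by rw [card_shift, (m.isBas j'.1).card, hb.card])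
  have hz0 : j'.2.1 - j.2.1 = 0 := by
    refine eq_zero_of_mem_interior_closure hz
      (subset_closure (interior_subset (m.interior_tri_sub_cell j.1.2 h))) ?_
    refine m.interior_tri_sub_cell j'.1.2 ?_
    have : P - j.2.1 ∈ interior (m.K (j'.1, ⟨j'.2.1 - j.2.1, hz⟩)) := by
      have hK : m.K (j'.1, ⟨j'.2.1 - j.2.1, hz⟩) = tri j.1.1 := by
        ext Q; rw [heq, mem_tri_shift]; rfl
      rw [hK]; exact h
    exact m.mem_interior_K.1 this
  rw [hz0, shift_zero] at heq
  exact Prod.ext (Subtype.ext heq) (Subtype.ext (sub_eq_zero.1 hz0).symm)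

end ACMesh


/-! ### Gradients and nodal values of the mesh interpolant -/

lemma sum_cl (b : AffineBasis (Fin 3) ℝ E2) (x : E2) : ∑ i, cl b i x = 0 := by
  have h : ∀ i, cl b i x = b.coord i x - b.coord i 0 := fun i => by rw [← cl_sub, sub_zero]
  simp only [h, Finset.sum_sub_distrib, b.sum_coord_apply_eq_one, sub_self]

lemma muOn_mul_le {S : Set E2} {y : E2 → E2} {x x' : E2} (hx : x ∈ S) (hx' : x' ∈ S) :
    muOn S y * ‖x' - x‖ ≤ ‖y x' - y x‖ := by
  by_cases h : x = x'
  · simp [h]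
  have h0 : 0 < ‖x' - x‖ := norm_pos_iff.2 (sub_ne_zero.2 (Ne.symm h))
  rw [← le_div_iff₀ h0]
  refine csInf_le ⟨0, ?_⟩ ⟨x, hx, x', hx', h, rfl⟩
  rintro _ ⟨_, _, _, _, _, rfl⟩
  positivity

lemma IsPA.hasFDerivAt {J : Type} {K : J → Set E2} {v : E2 → E2} {L : J → E2 →L[ℝ] E2}
    (hv : IsPA K v L) {j : J} {P : E2} (hP : P ∈ interior (K j)) : HasFDerivAt v (L j) P := by
  have h : HasFDerivAt (fun Q => v P + L j (Q - P)) (L j) P := by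
    have := (((L j).hasFDerivAt (x := P)).sub_const (L j P)).const_add (v P)
    simpa only [map_sub] using this
  refine h.congr_of_eventuallyEq ?_
  filter_upwards [mem_interior_iff_mem_nhds.1 hP] with Q hQ
  rw [← hv j P (interior_subset hP) Q hQ, add_sub_cancel]

namespace ACMesh

variable (m : ACMesh)

/-- The gradients of the mesh interpolant. -/
noncomputable def LI (f : E2 → E2) (j : m.Th × perLat m.N) : E2 →L[ℝ] E2 :=
  ∑ i, (cl (m.bas j.1) i).smulRight (f (m.bas j.1 i + j.2.1))

lemma LI_apply (f : E2 → E2) (j : m.Th × perLat m.N) (x : E2) :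
    m.LI f j x = ∑ i, cl (m.bas j.1) i x • f (m.bas j.1 i + j.2.1) := by
  simp [LI]

lemma isPA_Ih (f : E2 → E2) : IsPA m.K (m.Ih f) (m.LI f) := by
  intro j P hP Q hQ
  rw [m.Ih_eq f hP, m.Ih_eq f hQ, LI_apply, ← Finset.sum_sub_distrib]
  refine Finset.sum_congr rfl fun i _ => ?_
  rw [← sub_smul, ← cl_sub, sub_sub_sub_cancel_right]

/-- A period changes the nodal values on a triangle by a constant, and the gradients of the
barycentric coordinates add up to zero. So only finitely many gradients occur. -/
lemma LI_eq_zero_shift {f : E2 → E2} {B : E2 →L[ℝ] E2} (j : m.Th × perLat m.N)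
    (hf : ∀ v ∈ j.1.1, f (v + j.2.1) = f v + B j.2.1) :
    m.LI f j = m.LI f (j.1, ⟨0, (perG m.N).zero_mem⟩) := by
  ext1 x
  rw [LI_apply, LI_apply]
  simp only [fun i => hf _ ((m.isBas j.1).mem i), add_zero, smul_add, Finset.sum_add_distrib,
    ← Finset.sum_smul, sum_cl, zero_smul]

lemma Ih_vertex (f : E2 → E2) (j : m.Th × perLat m.N) {v : E2} (hv : v ∈ j.1.1) :
    m.Ih f (v + j.2.1) = f (v + j.2.1) := by
  obtain ⟨i, rfl⟩ := (m.isBas j.1).exists_eq hv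
  have hK : m.bas j.1 i + j.2.1 ∈ m.K j := by
    rw [mem_K, add_sub_cancel_right]; exact mem_tri_of_mem hv
  rw [m.Ih_eq f hK]
  simp only [add_sub_cancel_right, AffineBasis.coord_apply, ite_smul, one_smul, zero_smul]
  simp

lemma LI_sub_vertex (f : E2 → E2) (j : m.Th × perLat m.N) {v v' : E2} (hv : v ∈ j.1.1)
    (hv' : v' ∈ j.1.1) : m.LI f j (v' - v) = f (v' + j.2.1) - f (v + j.2.1) := by
  rw [← m.Ih_vertex f j hv, ← m.Ih_vertex f j hv', m.isPA_Ih f j, add_sub_add_right_eq_sub]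
  · rw [mem_K, add_sub_cancel_right]; exact mem_tri_of_mem hv
  · rw [mem_K, add_sub_cancel_right]; exact mem_tri_of_mem hv'

/-! ### Sites -/

lemma sites_sub_Lat : m.sites ⊆ Lat := by
  rintro _ ⟨x, hx, z, hz, rfl⟩
  exact latG.add_mem hx.1.1 (perLat_sub_Lat _ hz)

lemma sites0_sub : m.sites0 ⊆ m.sites := fun x hx =>
  ⟨x, hx, 0, (perG m.N).zero_mem, add_zero x⟩

lemma add_mem_sites {x z : E2} (hx : x ∈ m.sites) (hz : z ∈ perLat m.N) : x + z ∈ m.sites := by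
  obtain ⟨x, hx, z', hz', rfl⟩ := hx
  exact ⟨x, hx, z' + z, (perG m.N).add_mem hz' hz, (add_assoc _ _ _).symm⟩

/-- A continuum triangle avoids the interior of the atomistic region, where all vacancies are. -/
lemma vertex_mem_sites {j : m.Th × perLat m.N} (hj : j.1.1 ∈ m.Thc) {v : E2} (hv : v ∈ j.1.1) :
    v + j.2.1 ∈ m.sites := by
  have hvL : v ∈ Lat := m.vertex_mem _ hj hv
  refine m.add_mem_sites ?_ j.2.2
  obtain ⟨z, hz, hc⟩ := exists_sub_mem_cell m.N_pos v
  refine ⟨v - z, ⟨⟨latG.sub_mem hvL (perLat_sub_Lat _ hz), hc⟩, fun hV => ?_⟩, z, hz,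
    sub_add_cancel v z⟩
  have hi := m.V_int hV
  have hz0 := eq_zero_of_mem_interior_closure hz
    (m.tri_sub_closure_cell j.1.2 (mem_tri_of_mem hv)) (m.Ωa_sub (interior_subset hi))
  rw [hz0, sub_zero] at hi
  exact m.notMem_interior_of_mem hj (mem_tri_of_mem hv) hi

lemma LI_congr {f g : E2 → E2} (h : ∀ x ∈ m.sites, f x = g x) {j : m.Th × perLat m.N}
    (hj : j.1.1 ∈ m.Thc) : m.LI f j = m.LI g j := by
  ext1 x
  rw [LI_apply, LI_apply]
  refine Finset.sum_congr rfl fun i _ => ?_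
  rw [h _ (m.vertex_mem_sites hj ((m.isBas j.1).mem i))]

/-- Continuum triangles have only sites as vertices. In an atomistic triangle a site is a lattice
point, hence a vertex, and the interpolant reproduces its value there. So arbitrary values at the
vacancies do no harm. -/
lemma Ih_congr {f g : E2 → E2} (h : ∀ x ∈ m.sites, f x = g x) {x : E2} (hx : x ∈ m.sites) :
    m.Ih f x = m.Ih g x := by
  obtain ⟨j, hj⟩ := m.exists_mem_K x
  rcases m.mem_Th_iff.1 j.1.2 with hc | hc
  · rw [m.Ih_eq f hj, m.Ih_eq g hj]
    refine Finset.sum_congr rfl fun i _ => ?_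
    rw [h _ (m.vertex_mem_sites hc ((m.isBas j.1).mem i))]
  · have hv : x - j.2.1 ∈ j.1.1 := by
      obtain ⟨_, _, _, -, hl⟩ := micro_slab hc.1
      exact hl _ (latG.sub_mem (m.sites_sub_Lat hx) (perLat_sub_Lat _ j.2.2)) hj
    have h1 := m.Ih_vertex f j hv
    have h2 := m.Ih_vertex g j hv
    rw [sub_add_cancel] at h1 h2
    rw [h1, h2, h x hx]

/-! ### The continuum region -/

lemma notMem_interior_of_mem_Ωcper {P z : E2} (hP : P ∈ m.Ωcper) (hz : z ∈ perLat m.N) :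
    P - z ∉ interior m.Ωa := by
  obtain ⟨c, hc, z', hz', rfl⟩ := hP
  intro h
  have e : c + z' - z = c - (z - z') := by abel
  simp only [e] at h
  have hz0 := eq_zero_of_mem_interior_closure ((perG m.N).sub_mem hz hz')
    (subset_closure hc.2) (m.Ωa_sub (interior_subset h))
  rw [hz0, sub_zero] at h
  exact disjoint_left.1 m.closure_diff_disjoint hc.1 h

lemma notMem_Ωa_of_mem_interior {P z : E2} (hP : P ∈ interior m.Ωcper) (hz : z ∈ perLat m.N) :
    P - z ∉ m.Ωa := by
  intro h
  have ho : IsOpen ((fun Q => Q + z) ⁻¹' interior m.Ωcper) :=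
    isOpen_interior.preimage (by fun_prop)
  obtain ⟨Q, hQ, hQ'⟩ := mem_closure_iff.1 (m.Ωa_sub_closure_interior h) _ ho
    (by rw [mem_preimage, sub_add_cancel]; exact hP)
  refine m.notMem_interior_of_mem_Ωcper (interior_subset hQ) hz ?_
  simpa using hQ'

lemma mem_Thc_of_mem_K {P : E2} (hP : P ∈ interior m.Ωcper) {j : m.Th × perLat m.N}
    (hj : P ∈ m.K j) : j.1.1 ∈ m.Thc := by
  rcases m.mem_Th_iff.1 j.1.2 with hc | hc
  · exact hc
  · exact absurd (hc.2 hj) (m.notMem_Ωa_of_mem_interior hP j.2.2)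

lemma exists_Dc_eq {P : E2} (hP : P ∈ interior m.Ωcper) (r : E2) :
    ∃ j : m.Th × perLat m.N, j.1.1 ∈ m.Thc ∧ ∀ v L, IsPA m.K v L → Dc r v P = L j r := by
  obtain ⟨j, δ, hδ, hj⟩ := m.isCover.exists_dir P r
  refine ⟨j, m.mem_Thc_of_mem_K hP ?_, fun v L hv => hv.Dc_eq hδ hj⟩
  simpa using hj 0 ⟨le_rfl, hδ.le⟩

lemma Dc_Ih_congr {f g : E2 → E2} (h : ∀ x ∈ m.sites, f x = g x) {P : E2}
    (hP : P ∈ interior m.Ωcper) (r : E2) : Dc r (m.Ih f) P = Dc r (m.Ih g) P := by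
  obtain ⟨j, hj, hD⟩ := m.exists_Dc_eq hP r
  rw [hD _ _ (m.isPA_Ih f), hD _ _ (m.isPA_Ih g), m.LI_congr h hj]

lemma interior_tri_sub_Ωc {T : Finset E2} (hT : T ∈ m.Thc) : interior (tri T) ⊆ m.Ωc := by
  intro P hP
  exact ⟨m.tri_sub_closure_diff hT (interior_subset hP),
    interior_subset (m.interior_tri_sub_cell (m.mem_Th_iff.2 (Or.inl hT)) hP)⟩

-- The gradient on a triangle is a difference quotient over two nearby interior points of it. The
-- triangle is first shifted back to the base cell, since the invertibility constant is taken over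
-- the continuum region of one cell only.
open Filter Topology in
lemma muC_mul_le {y : E2 → E2} {B : E2 →L[ℝ] E2}
    (hy : ∀ x ∈ m.sites, ∀ z ∈ perLat m.N, y (x + z) = y x + B z) {j : m.Th × perLat m.N}
    (hj : j.1.1 ∈ m.Thc) (r : E2) : m.muC (m.Ih y) * ‖r‖ ≤ ‖m.LI y j r‖ := by
  rw [m.LI_eq_zero_shift (B := B) j fun v hv => hy v (by
    have := m.vertex_mem_sites (j := (j.1, ⟨0, (perG m.N).zero_mem⟩)) hj hv
    simpa using this) _ j.2.2]
  obtain ⟨P, hP⟩ := interior_tri_nonempty (m.isBas j.1)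
  have hc : Tendsto (fun t : ℝ => P + t • r) (𝓝[>] 0) (𝓝 P) := by
    have : Continuous fun t : ℝ => P + t • r := by fun_prop
    simpa using (this.tendsto 0).mono_left nhdsWithin_le_nhds
  obtain ⟨t, ht, ht0⟩ := ((hc.eventually (isOpen_interior.mem_nhds hP)).and
    self_mem_nhdsWithin).exists
  have ht0' : (0 : ℝ) < t := ht0
  have h1 := muOn_mul_le (y := m.Ih y) (m.interior_tri_sub_Ωc hj hP)
    (m.interior_tri_sub_Ωc hj ht)
  rw [m.isPA_Ih y (j.1, ⟨0, (perG m.N).zero_mem⟩) P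
    (by rw [mem_K, sub_zero]; exact interior_subset hP) _
    (by rw [mem_K, sub_zero]; exact interior_subset ht), add_sub_cancel_left, map_smul,
    norm_smul, norm_smul, Real.norm_eq_abs, abs_of_pos ht0'] at h1
  have : t * (m.muC (m.Ih y) * ‖r‖) ≤ t * ‖m.LI y (j.1, ⟨0, (perG m.N).zero_mem⟩) r‖ := by
    refine le_trans (le_of_eq ?_) h1
    rw [muC]; ring
  exact le_of_mul_le_mul_left this ht0'

lemma muC_mul_le_Dc {y : E2 → E2} {B : E2 →L[ℝ] E2}
    (hy : ∀ x ∈ m.sites, ∀ z ∈ perLat m.N, y (x + z) = y x + B z) {P : E2}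
    (hP : P ∈ interior m.Ωcper) (r : E2) : m.muC (m.Ih y) * ‖r‖ ≤ ‖Dc r (m.Ih y) P‖ := by
  obtain ⟨j, hj, hD⟩ := m.exists_Dc_eq hP r
  rw [hD _ _ (m.isPA_Ih y)]
  exact m.muC_mul_le hy hj r

/-- Take a micro-triangle of the cell that contains P modulo periods. If its interior met Ωa, it
would be one of the triangles that make up Ωa, and P would be in Ωa up to a period. Otherwise its
interior, and hence the triangle, belongs to the closed continuum region. -/
lemma exists_mem_Tac {P : E2} (hP : P ∈ interior m.Ωcper) :
    ∃ τ ∈ m.Tac, ∃ z ∈ perLat m.N, P - z ∈ tri τ := by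
  obtain ⟨z, hz, hPz⟩ := exists_sub_mem_cell m.N_pos P
  obtain ⟨τ, hτ, hPτ⟩ := exists_mem_Ta m.N_pos hPz
  refine ⟨τ, ⟨hτ, ?_⟩, z, hz, hPτ⟩
  obtain ⟨b, hb⟩ := exists_isBas_of_micro hτ.1
  by_cases hdis : ∃ X ∈ interior (tri τ), X ∈ m.Ωa
  · exfalso
    obtain ⟨X, hX, hXa⟩ := hdis
    obtain ⟨t, ht, htsub, hXt⟩ := m.mem_Ωa_iff.1 hXa
    rw [hb.interior_tri] at hX
    obtain ⟨b', hb'⟩ := exists_isBas_of_micro ht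
    have := Finset.eq_of_subset_of_card_le ((reg_micro hτ.1 ht).subset_of_interior hb hX hXt)
      (by rw [hb.card, hb'.card])
    rw [← this] at htsub
    exact m.notMem_Ωa_of_mem_interior hP hz (htsub hPτ)
  · push Not at hdis
    rw [tri_eq_closure_interior hb]
    refine closure_mono fun X hX => ?_
    have hcl : X ∈ closure (cell m.N) := hτ.2 (interior_subset hX)
    have hint : X ∈ interior (cell m.N) := by
      rw [← interior_closure_cell m.N_pos]
      exact interior_mono hτ.2 hX
    have hXc := interior_subset hint
    exact ⟨subset_closure ⟨hXc, hdis X hX⟩, hXc⟩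

lemma Uh_isPA {u : E2 → E2} (hu : u ∈ m.Uh) :
    ∃ L : m.Th → E2 →L[ℝ] E2, IsPA m.K u fun j => L j.1 := by
  obtain ⟨hper, haff, -⟩ := hu
  choose A hA using fun s : m.Th => haff s.1 s.2
  refine ⟨fun s => LinearMap.toContinuousLinearMap (A s).linear, fun j P hP Q hQ => ?_⟩
  have h : ∀ X ∈ m.K j, u X = A j.1 (X - j.2.1) := fun X hX => by
    rw [← hA j.1 _ hX, ← hper (X - j.2.1) _ j.2.2, sub_add_cancel]
  rw [h P hP, h Q hQ, LinearMap.coe_toContinuousLinearMap', ← vsub_eq_sub (A j.1 _),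
    ← AffineMap.linearMap_vsub, vsub_eq_sub, sub_sub_sub_cancel_right]

end ACMesh


/-! ### Lattice sums along bonds -/

/-- The smallest of the values attached to the sets that contain a given point. -/
noncomputable def low {J : Type} (K : J → Set E2) (f : J → ℝ≥0∞) (P : E2) : ℝ≥0∞ :=
  ⨅ (j) (_ : P ∈ K j), f j

lemma low_le {J : Type} {K : J → Set E2} (f : J → ℝ≥0∞) {P : E2} {j : J} (h : P ∈ K j) :
    low K f P ≤ f j := iInf₂_le j h

lemma measurable_low {J : Type} [Countable J] {K : J → Set E2} (hK : ∀ j, IsClosed (K j))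
    (f : J → ℝ≥0∞) : Measurable (low K f) := by
  classical
  refine Measurable.iInf fun j => ?_
  have : (fun P => ⨅ (_ : P ∈ K j), f j) = fun P => if P ∈ K j then f j else ⊤ := by
    ext P; exact iInf_eq_if _
  rw [this]
  exact Measurable.ite (hK j).measurableSet measurable_const measurable_const

lemma measurable_triWeight (b : AffineBasis (Fin 3) ℝ E2) : Measurable (triWeight b) :=
  ((measurable_const.indicator (isOpen_triOpen b).measurableSet).add
    (measurable_const.indicator (measurableSet_triMid b))).const_mul _

lemma half_le_triWeight {b : AffineBasis (Fin 3) ℝ E2} {s : Finset E2} (hb : IsBas b s) {P : E2}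
    (hP : P ∈ tri s) (hL : P ∉ Lat) : 2⁻¹ ≤ triWeight b P := by
  have : P ∈ triMid b := ⟨hb.mem_tri_iff.1 hP, by rintro ⟨i, rfl⟩; exact hL (hb.2 i)⟩
  rw [triWeight, indicator_of_mem this]
  calc (2⁻¹ : ℝ≥0∞) = 2⁻¹ * 1 := (mul_one _).symm
    _ ≤ _ := by gcongr; exact le_add_self

lemma triWeight_interior {b : AffineBasis (Fin 3) ℝ E2} {s : Finset E2} (hb : IsBas b s) {P : E2}
    (hP : P ∈ interior (tri s)) : triWeight b P = 1 := by
  rw [hb.interior_tri] at hP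
  have : P ∈ triMid b := ⟨fun i => (hP i).le, by
    rintro ⟨i, rfl⟩
    obtain ⟨k, l, -, h, -⟩ := fin3_others i
    have := hP k
    rw [AffineBasis.coord_apply_ne _ h.symm] at this
    exact lt_irrefl _ this⟩
  rw [triWeight, indicator_of_mem this, indicator_of_mem hP]
  simp only [Pi.one_apply, one_add_one_eq_two]
  exact ENNReal.inv_mul_cancel two_ne_zero ENNReal.ofNat_ne_top

lemma ae_notMem_Lat (x : E2) {r : E2} (hr : r ≠ 0) : ∀ᵐ t : ℝ, x + t • r ∉ Lat := by
  have hinj : Function.Injective fun t : ℝ => x + t • r := fun t t' h =>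
    smul_left_injective ℝ hr (add_left_cancel h)
  have : ((fun t : ℝ => x + t • r) ⁻¹' Lat).Countable :=
    Set.Countable.preimage (s := Lat) (countable_Lat) hinj
  exact this.ae_notMem volume

/-- Unfolding: each lattice point has at most one representation as a point of the cell minus a
period. -/
lemma tsum_cell_perLat_le {N : ℕ} (F : E2 → ℝ≥0∞) :
    ∑' x : ↥(Lat ∩ cell N), ∑' z : perLat N, F (x - z) ≤ ∑' x : latG, F x := by
  rw [← ENNReal.tsum_prod (f := fun (x : ↥(Lat ∩ cell N)) (z : perLat N) => F (x - z))]
  set g : ↥(Lat ∩ cell N) × perLat N → latG := fun p =>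
    ⟨p.1.1 - p.2.1, latG.sub_mem p.1.2.1 (perLat_sub_Lat _ p.2.2)⟩
  have hg : Function.Injective g := by
    rintro ⟨x, z⟩ ⟨x', z'⟩ h
    have h : x.1 - z.1 = x'.1 - z'.1 := congrArg Subtype.val h
    have e : x.1 - (z.1 - z'.1) = x'.1 := by rw [← sub_add, h, sub_add_cancel]
    have hz := eq_zero_of_mem_cells ((perG N).sub_mem z.2 z'.2) x.2.2 (e ▸ x'.2.2)
    rw [hz, sub_zero] at e
    exact Prod.ext (Subtype.ext e) (Subtype.ext (sub_eq_zero.1 hz))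
  exact ENNReal.tsum_comp_le_tsum_of_injective hg fun x : latG => F x

/-- Sums along the bonds of a family of translated weights. -/
lemma tsum_lintegral_weights_le {S : Type} [Countable S] {N : ℕ} (W : S → E2 → ℝ≥0∞)
    (hW : ∀ s, Measurable (W s)) (f : S → ℝ≥0∞) (r : E2) :
    ∑' x : ↥(Lat ∩ cell N), ∫⁻ t in Icc (0 : ℝ) 1,
        ∑' j : S × perLat N, W j.1 (x + t • r - j.2) * f j.1 ≤
      ∑' s, f s * ∑' x : latG, ∫⁻ t in Icc (0 : ℝ) 1, W s (x + t • r) := by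
  have hm : ∀ (s : S) (x : E2), Measurable fun t : ℝ => W s (x + t • r) := fun s x =>
    (hW s).comp (by fun_prop)
  have hre : ∀ (x z : E2) (t : ℝ), x + t • r - z = x - z + t • r := fun x z t => by abel
  simp only [hre]
  calc _ = ∑' x : ↥(Lat ∩ cell N), ∑' s, ∑' z : perLat N,
        (∫⁻ t in Icc (0 : ℝ) 1, W s (x - z + t • r)) * f s := by
        refine tsum_congr fun x => ?_
        rw [lintegral_tsum fun j => ((hm _ _).mul_const _).aemeasurable, ENNReal.tsum_prod']
        refine tsum_congr fun s => tsum_congr fun z => ?_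
        rw [lintegral_mul_const _ (hm _ _)]
    _ = ∑' s, f s * ∑' x : ↥(Lat ∩ cell N), ∑' z : perLat N,
        ∫⁻ t in Icc (0 : ℝ) 1, W s (x - z + t • r) := by
        rw [ENNReal.tsum_comm]
        refine tsum_congr fun s => ?_
        rw [← ENNReal.tsum_mul_left]
        refine tsum_congr fun x => ?_
        rw [← ENNReal.tsum_mul_left]
        refine tsum_congr fun z => mul_comm _ _
    _ ≤ _ := by
        refine ENNReal.tsum_le_tsum fun s => ?_
        gcongr
        exact tsum_cell_perLat_le fun x => ∫⁻ t in Icc (0 : ℝ) 1, W s (x + t • r)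

lemma volume_interior_tri (s : Finset E2) : volume (interior (tri s)) = volume (tri s) := by
  refine le_antisymm (measure_mono interior_subset) ?_
  have h : tri s ⊆ interior (tri s) ∪ frontier (tri s) := fun P hP => by
    by_cases h : P ∈ interior (tri s)
    · exact Or.inl h
    · exact Or.inr ⟨subset_closure hP, h⟩
  calc _ ≤ _ := measure_mono h
    _ ≤ _ := measure_union_le _ _
    _ = _ := by rw [(convex_tri s).addHaar_frontier volume, add_zero]

/-- A micro-triangle in fact has half this area; the factor two given away is absorbed by the 5/2 of
the final constant. -/
lemma volume_micro_le {s : Finset E2} (hs : s ∈ micro) : volume (tri s) ≤ volume unitCell := by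
  obtain ⟨i, j, k, h, -⟩ := micro_slab hs
  rw [← volume_interior_tri]
  have hsub : interior (tri s) ⊆ (fun P => P - ((i : ℝ) • a1 + (j : ℝ) • a2)) ⁻¹' unitCell := by
    have h1 : IsOpenMap cα := cα.isOpenMap (fun c => ⟨c • a1, by simp⟩)
    have h2 : IsOpenMap cβ := cβ.isOpenMap (fun c => ⟨c • a2, by simp⟩)
    have g1 : interior (tri s) ⊆ cα ⁻¹' interior (Icc (i : ℝ) (i + 1)) := by
      rw [h1.preimage_interior_eq_interior_preimage cα.continuous]
      exact interior_mono fun P hP => by rw [h] at hP; exact hP.1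
    have g2 : interior (tri s) ⊆ cβ ⁻¹' interior (Icc (j : ℝ) (j + 1)) := by
      rw [h2.preimage_interior_eq_interior_preimage cβ.continuous]
      exact interior_mono fun P hP => by rw [h] at hP; exact hP.2.1
    intro P hP
    have k1 := g1 hP
    have k2 := g2 hP
    rw [mem_preimage, interior_Icc] at k1 k2
    have e1 : cα (P - ((i : ℝ) • a1 + (j : ℝ) • a2)) = cα P - i := by simp
    have e2 : cβ (P - ((i : ℝ) • a1 + (j : ℝ) • a2)) = cβ P - j := by simp
    rw [mem_preimage]
    refine ⟨?_, ?_⟩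
    · rw [e1]; exact ⟨by linarith [k1.1], by linarith [k1.2]⟩
    · rw [e2]; exact ⟨by linarith [k2.1], by linarith [k2.2]⟩
  refine (measure_mono hsub).trans (le_of_eq ?_)
  simp only [sub_eq_add_neg]
  exact measure_preimage_add_right volume _ _

lemma volume_unitCell_ne_zero : volume unitCell ≠ 0 := by
  rw [volume_unitCell]; simp

/-- The average length of lattice bonds in a micro-triangle. -/
lemma tsum_lintegral_micro_le {s : Finset E2} (hs : s ∈ micro) {r : E2} (hr : r ∈ Lat)
    (hr0 : r ≠ 0) :
    ∑' x : latG, ∫⁻ t in Icc (0 : ℝ) 1, (tri s).indicator 1 (x + t • r) ≤ (2 : ℝ≥0∞) := by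
  obtain ⟨b, hb⟩ := exists_isBas_of_micro hs
  have hm : ∀ x : E2, Measurable fun t : ℝ => triWeight b (x + t • r) := fun x =>
    (measurable_triWeight b).comp (by fun_prop)
  -- Away from the vertices the weight of a point of the closed triangle is at least 1/2, and almost
  -- no point of a bond is a lattice point.
  calc _ ≤ ∑' x : latG, ∫⁻ t in Icc (0 : ℝ) 1, 2 * triWeight b (x + t • r) := by
        refine ENNReal.tsum_le_tsum fun x => lintegral_mono_ae (ae_restrict_of_ae ?_)
        filter_upwards [ae_notMem_Lat x.1 hr0] with t ht
        by_cases hP : x.1 + t • r ∈ tri s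
        · rw [indicator_of_mem hP, Pi.one_apply,
            ← ENNReal.mul_inv_cancel two_ne_zero ENNReal.ofNat_ne_top]
          gcongr
          exact half_le_triWeight hb hP ht
        · rw [indicator_of_notMem hP]; exact zero_le
    _ = 2 * ∑' x : latG, ∫⁻ t in Icc (0 : ℝ) 1, triWeight b (x + t • r) := by
        rw [← ENNReal.tsum_mul_left]
        exact tsum_congr fun x => lintegral_const_mul _ (hm _)
    _ ≤ 2 * (volume (convexHull ℝ (range b)) / volume unitCell) := by
        gcongr; exact tsum_lintegral_triWeight_le b hb.2 hr
    _ ≤ 2 * 1 := by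
        gcongr
        refine ENNReal.div_le_of_le_mul ?_
        rw [← hb.tri_eq, one_mul]
        exact volume_micro_le hs
    _ = 2 := mul_one _

namespace ACMesh

variable (m : ACMesh)

/-- An interior point of a triangle has weight one there. Any other point lies in at least two
closed triangles, each of weight at least one half, and the infimum is below both values. With
one-sided values in place of the infimum, a bond along an edge would spoil this. -/
lemma low_le_tsum (f : m.Th → ℝ≥0∞) {P : E2} (hP : P ∉ Lat) :
    low m.K (fun j => f j.1) P ≤ ∑' j : m.Th × perLat m.N,
      triWeight (m.bas j.1) (P - j.2) * f j.1 := by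
  classical
  obtain ⟨j, hj⟩ := m.exists_mem_K P
  have hL : ∀ j : m.Th × perLat m.N, P - j.2.1 ∉ Lat := fun j h => hP (by
    have := latG.add_mem h (perLat_sub_Lat _ j.2.2)
    rwa [sub_add_cancel] at this)
  by_cases hint : P ∈ interior (m.K j)
  · refine (low_le _ hj).trans (le_trans ?_ (ENNReal.le_tsum j))
    rw [triWeight_interior (m.isBas j.1) (m.mem_interior_K.1 hint), one_mul]
  · have hcl : P ∈ closure (m.K j)ᶜ := by rwa [closure_compl]
    obtain ⟨j', hne, hj'⟩ := m.isCover.exists_mem_of_closure (S := {j' | j' ≠ j})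
      (U := (m.K j)ᶜ) (fun Q hQ => by
        obtain ⟨i, hi⟩ := m.exists_mem_K Q
        exact ⟨i, fun h => hQ (h ▸ hi), hi⟩) hcl
    refine le_trans ?_ (ENNReal.sum_le_tsum {j, j'})
    rw [Finset.sum_pair (Ne.symm hne)]
    calc low m.K (fun j => f j.1) P
        = 2⁻¹ * low m.K (fun j => f j.1) P + 2⁻¹ * low m.K (fun j => f j.1) P := by
          rw [← add_mul, ENNReal.inv_two_add_inv_two, one_mul]
      _ ≤ _ := by
          gcongr
          · exact half_le_triWeight (m.isBas j.1) hj (hL j)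
          · exact low_le _ hj
          · exact half_le_triWeight (m.isBas j'.1) hj' (hL j')
          · exact low_le _ hj'

/-- The lattice bonds in a given direction have the same average density in all triangles. -/
lemma tsum_lintegral_low_le (f : m.Th → ℝ≥0∞) {r : E2} (hr : r ∈ Lstar) :
    ∑' x : ↥(Lat ∩ cell m.N), ∫⁻ t in Icc (0 : ℝ) 1, low m.K (fun j => f j.1) (x + t • r) ≤
      (∑' s : m.Th, volume (tri s.1) * f s) / volume unitCell := by
  calc _ ≤ ∑' x : ↥(Lat ∩ cell m.N), ∫⁻ t in Icc (0 : ℝ) 1,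
        ∑' j : m.Th × perLat m.N, triWeight (m.bas j.1) (x + t • r - j.2) * f j.1 := by
        refine ENNReal.tsum_le_tsum fun x => lintegral_mono_ae (ae_restrict_of_ae ?_)
        filter_upwards [ae_notMem_Lat x.1 hr.2] with t ht
        exact m.low_le_tsum f ht
    _ ≤ _ := tsum_lintegral_weights_le _ (fun s => measurable_triWeight _) f r
    _ ≤ ∑' s : m.Th, f s * (volume (tri s.1) / volume unitCell) := by
        refine ENNReal.tsum_le_tsum fun s => ?_
        gcongr
        rw [(m.isBas s).tri_eq]
        exact tsum_lintegral_triWeight_le _ (m.isBas s).2 hr.1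
    _ = _ := by
        rw [div_eq_mul_inv, ← ENNReal.tsum_mul_right]
        refine tsum_congr fun s => ?_
        rw [div_eq_mul_inv]; ring

/-- The periodic family of micro-triangles in the continuum region. -/
def Kc (j : m.Tac × perLat m.N) : Set E2 := {P | P - j.2.1 ∈ tri j.1.1}

lemma isClosed_Kc (j : m.Tac × perLat m.N) : IsClosed (m.Kc j) :=
  (isClosed_tri j.1.1).preimage (by fun_prop)

instance : Countable m.Tac := by
  have h : m.Tac ⊆ (fun s : Finset Lat => s.map (Function.Embedding.subtype _)) '' univ := by
    classical
    rintro s ⟨⟨hs, -⟩, -⟩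
    refine ⟨s.subtype (· ∈ Lat), mem_univ _, ?_⟩
    refine (Finset.subtype_map _).trans ?_
    exact Finset.filter_true_of_mem fun v hv => micro_vertex_mem hs hv
  exact (countable_univ.image _).mono h

/-- The continuum micro-triangles do not cover the plane, and the infimum is infinite where there is
none. The sets c x restrict the integral to points that lie in such a triangle. -/
lemma tsum_lintegral_low_Kc_le (f : m.Tac → ℝ≥0∞) {r : E2} (hr : r ∈ Lstar) (c : E2 → Set ℝ)
    (hc : ∀ x, ∀ t ∈ c x, x + t • r ∈ interior m.Ωcper) :
    ∑' x : ↥(Lat ∩ cell m.N), ∫⁻ t in Icc (0 : ℝ) 1,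
      (c x).indicator (fun t => low m.Kc (fun j => f j.1) (x + t • r)) t ≤ 2 * ∑' τ : m.Tac, f τ := by
  calc _ ≤ ∑' x : ↥(Lat ∩ cell m.N), ∫⁻ t in Icc (0 : ℝ) 1,
        ∑' j : m.Tac × perLat m.N, (tri j.1.1).indicator 1 (x + t • r - j.2) * f j.1 := by
        refine ENNReal.tsum_le_tsum fun x => lintegral_mono fun t => ?_
        by_cases ht : t ∈ c x
        · rw [indicator_of_mem ht]
          obtain ⟨τ, hτ, z, hz, hP⟩ := m.exists_mem_Tac (hc x t ht)
          refine (low_le (j := (⟨τ, hτ⟩, ⟨z, hz⟩)) _ hP).trans (le_trans ?_ (ENNReal.le_tsum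
            (⟨⟨τ, hτ⟩, ⟨z, hz⟩⟩ : m.Tac × perLat m.N)))
          simp only [indicator_of_mem hP, Pi.one_apply, one_mul, le_refl]
        · rw [indicator_of_notMem ht]; exact zero_le
    _ ≤ _ := tsum_lintegral_weights_le _
        (fun s : m.Tac => measurable_one.indicator (isClosed_tri s.1).measurableSet) f r
    _ ≤ ∑' τ : m.Tac, f τ * 2 := by
        refine ENNReal.tsum_le_tsum fun τ => ?_
        gcongr
        exact tsum_lintegral_micro_le τ.2.1.1 hr.1 hr.2
    _ = _ := by rw [ENNReal.tsum_mul_right, mul_comm]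

end ACMesh


/-! ### Interpolation on a shape regular mesh -/

lemma norm_apply_le_frob (A : E2 →L[ℝ] E2) (r : E2) : ‖A r‖ ≤ frob A * ‖r‖ := by
  have hr : r = ∑ i, r i • e i := by
    ext j; fin_cases j <;> simp [e, Fin.sum_univ_two]
  have h1 : ‖A r‖ ≤ ∑ i, ‖A (e i)‖ * |r i| := by
    conv_lhs => rw [hr]
    simp only [map_sum, map_smul]
    refine (norm_sum_le _ _).trans_eq (Finset.sum_congr rfl fun i _ => ?_)
    rw [norm_smul, Real.norm_eq_abs, mul_comm]
  refine h1.trans ((Real.sum_mul_le_sqrt_mul_sqrt _ _ _).trans (le_of_eq ?_))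
  rw [frob, EuclideanSpace.norm_eq]
  simp only [Real.norm_eq_abs]

lemma frob2_le (H : E2 →L[ℝ] E2 →L[ℝ] E2) : frob2 H ≤ 2 * ‖H‖ := by
  have he : ∀ i, ‖e i‖ = 1 := fun i => by simp [e]
  have h : ∀ i j, ‖H (e i) (e j)‖ ^ 2 ≤ ‖H‖ ^ 2 := fun i j => by
    gcongr
    have := H.le_opNorm₂ (e i) (e j)
    rwa [he, he, mul_one, mul_one] at this
  rw [frob2]
  refine Real.sqrt_le_iff.2 ⟨by positivity, ?_⟩
  simp only [Fin.sum_univ_two]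
  linarith [h 0 0, h 0 1, h 1 0, h 1 1]

lemma linf_ne_top {H : E2 → E2 →L[ℝ] E2 →L[ℝ] E2} (hH : MemLp H ⊤ volume) (A : Set E2) :
    linf H A ≠ ⊤ := by
  have h2 : eLpNorm H ⊤ volume < ⊤ := hH.2
  rw [eLpNorm_exponent_top] at h2
  have h1 : ∀ᵐ x ∂volume.restrict A, ‖frob2 (H x)‖ ≤ 2 * (eLpNormEssSup H volume).toReal := by
    refine ae_restrict_of_ae ?_
    filter_upwards [ae_le_eLpNormEssSup (f := H) (μ := volume)] with x hx
    have h3 : ‖H x‖ ≤ (eLpNormEssSup H volume).toReal :=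
      (toReal_enorm (H x)).symm.le.trans ((ENNReal.toReal_le_toReal enorm_ne_top h2.ne).2 hx)
    have h4 : 0 ≤ frob2 (H x) := Real.sqrt_nonneg _
    rw [Real.norm_eq_abs, abs_of_nonneg h4]
    have := frob2_le (H x)
    linarith
  rw [linf, eLpNorm_exponent_top]
  exact ne_top_of_le_ne_top ENNReal.ofReal_ne_top (eLpNormEssSup_le_of_ae_bound h1)

lemma eq_cl_smul (b : AffineBasis (Fin 3) ℝ E2) (r : E2) :
    r = cl b 1 r • (b 1 - b 0) + cl b 2 r • (b 2 - b 0) := by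
  have h : ∀ i, cl b i r = b.coord i r - b.coord i 0 := fun i => by rw [← cl_sub, sub_zero]
  have h1 : ∑ i, cl b i r • b i = r := by
    simp only [h, sub_smul, Finset.sum_sub_distrib, sum_coord_smul, sub_zero]
  have h2 := sum_cl b r
  rw [Fin.sum_univ_three] at h1 h2
  have h3 : cl b 0 r = -(cl b 1 r + cl b 2 r) := by linarith
  rw [h3] at h1
  conv_lhs => rw [← h1]
  simp only [smul_sub, neg_smul, add_smul]
  abel

/-- A lower bound for the sines of the angles of a shape regular mesh. -/
noncomputable def sinBound (κ : ℝ) : ℝ := Real.sin (Real.pi / (3 * κ))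

namespace ACMesh

variable (m : ACMesh)

-- The angles of a triangle add up to π and none exceeds κ times any other, so each is at least
-- π/(3κ).
variable {m} in
lemma ShapeRegular.sin_le {κ : ℝ} (h : m.ShapeRegular κ) (s : m.Th) :
    0 < sinBound κ ∧ sinBound κ ≤
      Real.sin (InnerProductGeometry.angle (m.bas s 1 - m.bas s 0) (m.bas s 2 - m.bas s 0)) := by
  set b := m.bas s
  have hb : IsBas b s.1 := m.isBas s
  have hne : ∀ {i j : Fin 3}, i ≠ j → b i ≠ b j := fun hij h => hij (b.ind.injective h)
  have key : ∀ i j k i' j' k' : Fin 3, i ≠ j → j ≠ k → i ≠ k → i' ≠ j' → j' ≠ k' → i' ≠ k' →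
      EuclideanGeometry.angle (b i) (b j) (b k) ≤
        κ * EuclideanGeometry.angle (b i') (b j') (b k') := fun i j k i' j' k' h1 h2 h3 h4 h5 h6 =>
    h _ s.2 _ (hb.mem i) _ (hb.mem j) _ (hb.mem k) (hne h1) (hne h2) (hne h3)
      _ s.2 _ (hb.mem i') _ (hb.mem j') _ (hb.mem k') (hne h4) (hne h5) (hne h6)
  have hsum := EuclideanGeometry.angle_add_angle_add_angle_eq_pi (b 2)
    (hne (by decide : (1 : Fin 3) ≠ 0))
  have low : ∀ i' j' k' : Fin 3, i' ≠ j' → j' ≠ k' → i' ≠ k' →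
      Real.pi ≤ 3 * κ * EuclideanGeometry.angle (b i') (b j') (b k') := by
    intro i' j' k' h4 h5 h6
    have g1 := key 0 1 2 i' j' k' (by decide) (by decide) (by decide) h4 h5 h6
    have g2 := key 1 2 0 i' j' k' (by decide) (by decide) (by decide) h4 h5 h6
    have g3 := key 2 0 1 i' j' k' (by decide) (by decide) (by decide) h4 h5 h6
    linarith
  have l0 := low 1 0 2 (by decide) (by decide) (by decide)
  have l1 := low 0 1 2 (by decide) (by decide) (by decide)
  have l2 := low 1 2 0 (by decide) (by decide) (by decide)
  have hself := key 1 0 2 1 0 2 (by decide) (by decide) (by decide) (by decide) (by decide)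
    (by decide)
  rw [EuclideanGeometry.angle_comm (b 2)] at hsum
  set θ := EuclideanGeometry.angle (b 1) (b 0) (b 2) with hθ
  have hθ0 : 0 ≤ θ := EuclideanGeometry.angle_nonneg _ _ _
  have hpi := Real.pi_pos
  have hκ0 : 0 < κ := by
    by_contra hneg
    push Not at hneg
    nlinarith
  have hθpos : 0 < θ := by
    by_contra hneg
    have : θ = 0 := le_antisymm (not_lt.1 hneg) hθ0
    rw [this] at l0; linarith
  have hκ : 1 ≤ κ := by
    by_contra hneg
    push Not at hneg
    nlinarith
  have hδ : Real.pi / (3 * κ) ≤ Real.pi / 3 := by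
    gcongr; linarith
  have hδ0 : 0 < Real.pi / (3 * κ) := by positivity
  have bound : ∀ t, Real.pi ≤ 3 * κ * t → Real.pi / (3 * κ) ≤ t := fun t ht => by
    rw [div_le_iff₀ (by positivity)]; linarith
  have b0 := bound _ l0
  have b1 := bound _ l1
  have b2 := bound _ l2
  refine ⟨Real.sin_pos_of_pos_of_lt_pi hδ0 (by linarith), ?_⟩
  change _ ≤ Real.sin θ
  rw [sinBound]
  -- The sine is small also near π. That is excluded because the other two angles are bounded below,
  -- which keeps π − θ away from zero.
  rcases le_total θ (Real.pi / 2) with hle | hle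
  · exact Real.sin_le_sin_of_le_of_le_pi_div_two (by linarith) hle b0
  · rw [← Real.sin_pi_sub θ]
    exact Real.sin_le_sin_of_le_of_le_pi_div_two (by linarith) (by linarith) (by linarith)

/-- The local coarsening error. -/
noncomputable def coarse (H : E2 → E2 →L[ℝ] E2 →L[ℝ] E2) (s : m.Th) : ℝ≥0∞ :=
  ENNReal.ofReal (Metric.diam (tri s.1)) * linf H (tri s.1)

lemma fderiv_sub_period {w : E2 → E2} {B : E2 →L[ℝ] E2} {z : E2}
    (hper : ∀ x, w (x + z) = w x + B z) (P : E2) : fderiv ℝ w (P - z) = fderiv ℝ w P := by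
  have : (fun x => w (x + -z)) = fun x => w x - B z := by
    ext1 x
    rw [eq_sub_iff_add_eq, ← hper, neg_add_cancel_right]
  rw [sub_eq_add_neg, ← fderiv_comp_add_right, this, fderiv_sub_const]

lemma interp_error {κ : ℝ} (hκ : m.ShapeRegular κ) {w : E2 → E2}
    {H : E2 → E2 →L[ℝ] E2 →L[ℝ] E2} (hw : ContDiff ℝ 1 w) (hb : GradBound w H)
    (hH : MemLp H ⊤ volume) {B : E2 →L[ℝ] E2}
    (hper : ∀ x, ∀ z ∈ perLat m.N, w (x + z) = w x + B z) (j : m.Th × perLat m.N) {P : E2}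
    (hP : P ∈ m.K j) (r : E2) :
    ‖m.LI w j r - fderiv ℝ w P r‖ₑ ≤
      ENNReal.ofReal (2 / sinBound κ) * (‖r‖ₑ * m.coarse H j.1) := by
  obtain ⟨hσ, hsin⟩ := hκ.sin_le j.1
  have hT := m.isBas j.1
  have hA := linf_ne_top hH (tri j.1.1)
  rw [m.LI_eq_zero_shift j fun v _ => hper v _ j.2.2,
    ← fderiv_sub_period (fun x => hper x _ j.2.2) P]
  set j0 : m.Th × perLat m.N := (j.1, ⟨0, (perG m.N).zero_mem⟩) with hj0
  have hmem : ∀ i, m.bas j.1 0 + (m.bas j.1 i - m.bas j.1 0) ∈ tri j.1.1 := fun i => by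
    rw [add_sub_cancel]; exact mem_tri_of_mem (hT.mem i)
  have hL : ∀ i, m.LI w j0 (m.bas j.1 i - m.bas j.1 0) =
      w (m.bas j.1 0 + (m.bas j.1 i - m.bas j.1 0)) - w (m.bas j.1 0) := fun i => by
    have := m.LI_sub_vertex w j0 (hT.mem 0) (hT.mem i)
    simp only [hj0, add_zero] at this
    rw [add_sub_cancel, hj0, this]
  have key := norm_interp_sub_le (σ := sinBound κ) (A := (linf H (tri j.1.1)).toReal) hw
    (convex_tri j.1.1) (isCompact_tri j.1.1).isBounded
    (mem_tri_of_mem (hT.mem 0)) (hmem 1) (hmem 2) hP hσ hsin ENNReal.toReal_nonneg (fun Q hQ => by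
      have := hb.of_convex hw (convex_tri j.1.1) (interior_tri_nonempty hT) hP hQ
      rwa [← ofReal_norm (Q - _), enorm_le_mul_iff hA (norm_nonneg _)] at this) (hL 1) (hL 2)
      (cl (m.bas j.1) 1 r) (cl (m.bas j.1) 2 r)
  rw [← eq_cl_smul] at key
  rw [← ofReal_norm, ← ofReal_norm, coarse]
  refine (ENNReal.ofReal_le_ofReal key).trans (le_of_eq ?_)
  have hd : 0 ≤ Metric.diam (tri j.1.1) := Metric.diam_nonneg
  rw [ENNReal.ofReal_mul (by positivity), ENNReal.ofReal_mul (by positivity),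
    ENNReal.ofReal_mul hd, ENNReal.ofReal_toReal hA]
  ring

/-! ### Gradients of finite element functions -/

lemma gradNorm_ge_top {u : E2 → E2} {L : m.Th → E2 →L[ℝ] E2} (hu : IsPA m.K u fun j => L j.1)
    (s : m.Th) : ‖frob (L s)‖ₑ ≤ gradNorm m.N ⊤ u := by
  set j : m.Th × perLat m.N := (s, ⟨0, (perG m.N).zero_mem⟩)
  have hne : volume (interior (tri s.1)) ≠ 0 :=
    (isOpen_interior.measure_pos volume (interior_tri_nonempty (m.isBas s))).ne'
  have hsub := (m.interior_tri_sub_cell s.2).trans interior_subset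
  have hae := ae_restrict_of_ae_restrict_of_subset hsub
    (ae_le_eLpNormEssSup (μ := volume.restrict (cell m.N)) (f := fun x => frob (fderiv ℝ u x)))
  have : (ae (volume.restrict (interior (tri s.1)))).NeBot := by
    rw [ae_neBot]; exact fun h => hne (Measure.restrict_eq_zero.1 h)
  obtain ⟨P, h1, h2⟩ := (hae.and (ae_restrict_mem isOpen_interior.measurableSet)).exists
  have hP : P ∈ interior (m.K j) := by rw [mem_interior_K, sub_zero]; exact h2
  rw [(hu.hasFDerivAt hP).fderiv] at h1
  rwa [gradNorm, eLpNorm_exponent_top]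

lemma sum_le_gradNorm {u : E2 → E2} {L : m.Th → E2 →L[ℝ] E2} (hu : IsPA m.K u fun j => L j.1)
    {q : ℝ≥0∞} (hq0 : q ≠ 0) (hq : q ≠ ⊤) :
    ∑' s : m.Th, volume (tri s.1) * ‖frob (L s)‖ₑ ^ q.toReal ≤ gradNorm m.N q u ^ q.toReal := by
  have hqr : q.toReal ≠ 0 := ENNReal.toReal_ne_zero.2 ⟨hq0, hq⟩
  rw [gradNorm, eLpNorm_eq_lintegral_rpow_enorm_toReal hq0 hq, ← ENNReal.rpow_mul,
    one_div, inv_mul_cancel₀ hqr, ENNReal.rpow_one]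
  have hdis : Pairwise (Function.onFun Disjoint fun s : m.Th => interior (tri s.1)) := by
    intro s s' hne
    refine disjoint_left.2 fun P hP hP' => hne ?_
    have := m.eq_of_mem_interior_K (j := (s, ⟨0, (perG m.N).zero_mem⟩))
      (j' := (s', ⟨0, (perG m.N).zero_mem⟩)) (P := P) (by rw [mem_interior_K, sub_zero]; exact hP)
      (by rw [mem_K, sub_zero]; exact interior_subset hP')
    exact congrArg Prod.fst this
  calc _ = ∑' s : m.Th, ∫⁻ x in interior (tri s.1), ‖frob (fderiv ℝ u x)‖ₑ ^ q.toReal := by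
        refine tsum_congr fun s => ?_
        rw [setLIntegral_congr_fun (g := fun _ => ‖frob (L s)‖ₑ ^ q.toReal)
          isOpen_interior.measurableSet, setLIntegral_const, volume_interior_tri, mul_comm]
        intro P hP
        have hP' : P ∈ interior (m.K (s, ⟨0, (perG m.N).zero_mem⟩)) := by
          rw [mem_interior_K, sub_zero]; exact hP
        simp only [(hu.hasFDerivAt hP').fderiv]
    _ = ∫⁻ x in ⋃ s : m.Th, interior (tri s.1), ‖frob (fderiv ℝ u x)‖ₑ ^ q.toReal := by
        rw [lintegral_iUnion (fun s => isOpen_interior.measurableSet) hdis]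
    _ ≤ _ := lintegral_mono_set (iUnion_subset fun s =>
        (m.interior_tri_sub_cell s.2).trans interior_subset)

end ACMesh


/-! ### Differentiability of the energies -/

lemma measurable_rad {φ : ℝ → ℝ} (hφ : ContDiffOn ℝ 2 φ (Ioi 0)) : Measurable (rad φ) := by
  refine measurable_of_continuousOn_compl_singleton 0 fun a ha => ?_
  exact (contDiffAt_rad hφ ha).continuousAt.continuousWithinAt

lemma measurable_fderiv_rad_apply (φ : ℝ → ℝ) {α : Type*} [MeasurableSpace α] {a c : α → E2}
    (ha : Measurable a) (hc : Measurable c) :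
    Measurable fun s => fderiv ℝ (rad φ) (a s) (c s) :=
  ((isBoundedBilinearMap_apply (𝕜 := ℝ) (E := E2) (F := ℝ)).continuous.measurable).comp
    (((measurable_fderiv ℝ (rad φ)).comp ha).prodMk hc)

lemma hasDerivAt_rad_line {φ : ℝ → ℝ} (hφ : ContDiffOn ℝ 2 φ (Ioi 0)) {a c : E2} {t : ℝ}
    (h : a + t • c ≠ 0) :
    HasDerivAt (fun t : ℝ => rad φ (a + t • c)) (fderiv ℝ (rad φ) (a + t • c) c) t := by
  have h1 : HasDerivAt (fun t : ℝ => a + t • c) c t := by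
    simpa using ((hasDerivAt_id t).smul_const c).const_add a
  exact (differentiableAt_rad hφ h).hasFDerivAt.comp_hasDerivAt t h1

open Metric in
lemma hasDerivAt_integral_rad {φ : ℝ → ℝ} (hφ : ContDiffOn ℝ 2 φ (Ioi 0)) {ρ D δ : ℝ}
    (hρ : 0 < ρ) (hM0 : Mk φ 0 ρ ≠ ⊤) (hM1 : Mk φ 1 ρ ≠ ⊤) {a c : ℝ → E2} (ha : Measurable a)
    (hc : Measurable c) (hcD : ∀ s, ‖c s‖ ≤ D)
    (hac : ∀ s ∈ Icc (0 : ℝ) 1, ∀ t ∈ ball (0 : ℝ) δ, ρ ≤ ‖a s + t • c s‖) {t : ℝ}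
    (ht : t ∈ ball (0 : ℝ) δ) :
    HasDerivAt (fun t : ℝ => ∫ s in (0 : ℝ)..1, rad φ (a s + t • c s))
      (∫ s in (0 : ℝ)..1, fderiv ℝ (rad φ) (a s + t • c s) (c s)) t := by
  have hne : ∀ s ∈ Icc (0 : ℝ) 1, ∀ t ∈ ball (0 : ℝ) δ, a s + t • c s ≠ 0 := fun s hs t ht =>
    norm_pos_iff.1 (hρ.trans_le (hac s hs t ht))
  have hmem : ∀ s ∈ uIoc (0 : ℝ) 1, s ∈ Icc (0 : ℝ) 1 := fun s hs => by
    rw [uIoc_of_le zero_le_one] at hs; exact ⟨hs.1.le, hs.2⟩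
  have hmeas : ∀ t : ℝ, Measurable fun s => a s + t • c s := fun t => ha.add (hc.const_smul t)
  have hm0 : ∀ t : ℝ, AEStronglyMeasurable (fun s => rad φ (a s + t • c s))
      (volume.restrict (uIoc (0 : ℝ) 1)) := fun t =>
    ((measurable_rad hφ).comp (hmeas t)).aestronglyMeasurable
  refine (intervalIntegral.hasDerivAt_integral_of_dominated_loc_of_deriv_le
    (F' := fun t s => fderiv ℝ (rad φ) (a s + t • c s) (c s))
    (bound := fun _ => (Mk φ 1 ρ).toReal * D) (isOpen_ball.mem_nhds ht)
    (.of_forall fun t => hm0 t) ?_ ?_ ?_ intervalIntegrable_const ?_).2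
  · refine (intervalIntegrable_const (c := (Mk φ 0 ρ).toReal)).mono_fun' (hm0 t) ?_
    refine (ae_restrict_mem measurableSet_uIoc).mono fun s hs => ?_
    exact norm_rad_le φ (hac s (hmem s hs) t ht) hM0
  · exact (measurable_fderiv_rad_apply φ (hmeas t) hc).aestronglyMeasurable
  · refine .of_forall fun s hs t ht => ?_
    refine (ContinuousLinearMap.le_opNorm _ _).trans ?_
    gcongr
    · exact norm_fderiv_rad_le φ (hac s (hmem s hs) t ht) hM1
    · exact hcD s
  · exact .of_forall fun s hs t ht => hasDerivAt_rad_line hφ (hne s (hmem s hs) t ht)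

lemma Mk_ne_top {φ : ℝ → ℝ} (hφ : IsPotential φ) {k : ℕ} (hk : k ≤ 2) {s : ℝ} (hs : 0 < s)
    (r : Lstar) : Mk φ k (s * ‖r.1‖) ≠ ⊤ := by
  intro h
  have h1 := ENNReal.ne_top_of_tsum_ne_top (hφ.2 k hk s hs) r
  rw [h, ENNReal.top_mul] at h1
  · exact h1 rfl
  · exact pow_ne_zero _ (by simpa using r.2.2)

open Metric in
/-- Differentiation of a lattice sum of bond energies. -/
lemma hasDerivAt_tsum_rad {φ : ℝ → ℝ} (hφ : IsPotential φ) {ι : Type} (r : ι → Lstar)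
    (hsum : ∀ F : Lstar → ℝ≥0∞, ∑' r, F r ≠ ⊤ → ∑' i, F (r i) ≠ ⊤) {μ C : ℝ} (hμ : 0 < μ)
    {a c : ι → ℝ → E2} (ha : ∀ i, Measurable (a i)) (hc : ∀ i, Measurable (c i))
    (hcC : ∀ i s, ‖c i s‖ ≤ C * ‖(r i).1‖)
    (haμ : ∀ i, ∀ s ∈ Icc (0 : ℝ) 1, μ * ‖(r i).1‖ ≤ ‖a i s‖) :
    HasDerivAt (fun t : ℝ => ∑' i, ∫ s in (0 : ℝ)..1, rad φ (a i s + t • c i s))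
      (∑' i, ∫ s in (0 : ℝ)..1, fderiv ℝ (rad φ) (a i s) (c i s)) 0 ∧
    Summable fun i => ∫ s in (0 : ℝ)..1, fderiv ℝ (rad φ) (a i s) (c i s) := by
  have hr : ∀ i, 0 < ‖(r i).1‖ := fun i => norm_pos_iff.2 (r i).2.2
  -- For |t| < δ the perturbation of each bond is at most half of its lower bound μ|r|, uniformly
  -- over all bonds, so all terms stay where the potential is controlled. Adding 1 covers C = 0.
  set δ := μ / (2 * (|C| + 1)) with hδ
  have hδ0 : 0 < δ := by positivity
  have hμ2 : 0 < μ / 2 := by positivity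
  have hac : ∀ i, ∀ s ∈ Icc (0 : ℝ) 1, ∀ t ∈ ball (0 : ℝ) δ,
      μ / 2 * ‖(r i).1‖ ≤ ‖a i s + t • c i s‖ := by
    intro i s hs t ht
    rw [mem_ball_zero_iff, Real.norm_eq_abs] at ht
    have h1 : ‖t • c i s‖ ≤ μ / 2 * ‖(r i).1‖ := by
      rw [norm_smul, Real.norm_eq_abs]
      have hC : ‖c i s‖ ≤ (|C| + 1) * ‖(r i).1‖ := by
        refine (hcC i s).trans ?_
        gcongr
        linarith [le_abs_self C]
      calc |t| * ‖c i s‖ ≤ δ * ((|C| + 1) * ‖(r i).1‖) := by gcongr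
        _ = μ / 2 * ‖(r i).1‖ := by rw [hδ]; field_simp
    have h2 := norm_sub_le (a i s + t • c i s) (t • c i s)
    rw [add_sub_cancel_right] at h2
    linarith [haμ i s hs]
  have hM0 := fun i => Mk_ne_top hφ (k := 0) (by norm_num) hμ2 (r i)
  have hM1 := fun i => Mk_ne_top hφ (k := 1) (by norm_num) hμ2 (r i)
  have hs0 := ENNReal.summable_toReal (hsum _ (hφ.2 0 (by norm_num) (μ / 2) hμ2))
  have hs1 := (ENNReal.summable_toReal (hsum _ (hφ.2 1 (by norm_num) (μ / 2) hμ2))).mul_left C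
  have hD : ∀ i, ∀ t ∈ ball (0 : ℝ) δ,
      ‖∫ s in (0 : ℝ)..1, fderiv ℝ (rad φ) (a i s + t • c i s) (c i s)‖ ≤
        C * (Mk φ 1 (μ / 2 * ‖(r i).1‖) * ‖(r i).1‖ₑ ^ 1).toReal := by
    intro i t ht
    have := intervalIntegral.norm_integral_le_of_norm_le_const (a := (0 : ℝ)) (b := 1)
      (f := fun s => fderiv ℝ (rad φ) (a i s + t • c i s) (c i s))
      (C := (Mk φ 1 (μ / 2 * ‖(r i).1‖)).toReal * (C * ‖(r i).1‖)) fun s hs => by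
        have hs' : s ∈ Icc (0 : ℝ) 1 := by
          rw [uIoc_of_le zero_le_one] at hs; exact ⟨hs.1.le, hs.2⟩
        refine (ContinuousLinearMap.le_opNorm _ _).trans ?_
        gcongr
        · exact norm_fderiv_rad_le φ (hac i s hs' t ht) (hM1 i)
        · exact hcC i s
    refine this.trans (le_of_eq ?_)
    rw [ENNReal.toReal_mul, pow_one, toReal_enorm, sub_zero, abs_one]
    ring
  have h0 : (0 : ℝ) ∈ ball (0 : ℝ) δ := mem_ball_self hδ0
  have hder := fun i (t : ℝ) (ht : t ∈ ball (0 : ℝ) δ) =>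
    hasDerivAt_integral_rad hφ.1 (by have := hr i; positivity) (hM0 i) (hM1 i) (ha i) (hc i)
      (hcC i) (hac i) ht
  refine ⟨?_, ?_⟩
  · have := hasDerivAt_tsum_of_isPreconnected hs1 isOpen_ball
      (convex_ball (0 : ℝ) δ).isPreconnected hder hD h0
      (hs0.of_norm_bounded fun i => ?_) h0
    · simpa only [zero_smul, add_zero] using this
    · have := intervalIntegral.norm_integral_le_of_norm_le_const (a := (0 : ℝ)) (b := 1)
        (f := fun s => rad φ (a i s + (0 : ℝ) • c i s))
        (C := (Mk φ 0 (μ / 2 * ‖(r i).1‖)).toReal) fun s hs => by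
          have hs' : s ∈ Icc (0 : ℝ) 1 := by
            rw [uIoc_of_le zero_le_one] at hs; exact ⟨hs.1.le, hs.2⟩
          exact norm_rad_le φ (hac i s hs' 0 h0) (hM0 i)
      simpa using this
  · refine hs1.of_norm_bounded fun i => ?_
    simpa only [zero_smul, add_zero] using hD i 0 h0

namespace ACMesh

variable (m : ACMesh)

instance : Finite ↥(Lat ∩ cell m.N) := finite_Lat_inter_cell m.N

lemma bond_dir_mem {b : E2 × E2} (hb : b ∈ m.bonds) : b.2 - b.1 ∈ Lstar :=
  ⟨latG.sub_mem (m.sites_sub_Lat hb.2.1) (m.sites_sub_Lat (m.sites0_sub hb.1)),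
    fun h => hb.2.2 (sub_eq_zero.1 h).symm⟩

/-- A bond is determined by its direction and its initial point in the cell. Summing over all such
pairs separates the decay in r from the geometry. -/
lemma tsum_bonds_le (G : E2 × E2 → ℝ≥0∞) :
    ∑' b : m.bonds, G b ≤ ∑' i : Lstar × ↥(Lat ∩ cell m.N),
      m.bonds.indicator G (i.2.1, i.2.1 + i.1.1) := by
  set g : m.bonds → Lstar × ↥(Lat ∩ cell m.N) := fun b =>
    (⟨_, m.bond_dir_mem b.2⟩, ⟨b.1.1, b.2.1.1⟩) with hg
  have hval : ∀ b : m.bonds, ((g b).2.1, (g b).2.1 + (g b).1.1) = b.1 := fun b => by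
    simp only [hg]; exact Prod.ext rfl (add_sub_cancel _ _)
  have hinj : Function.Injective g := fun b b' h => by
    apply Subtype.ext
    rw [← hval b, ← hval b', h]
  refine le_trans (le_of_eq ?_) (ENNReal.tsum_comp_le_tsum_of_injective hinj _)
  refine tsum_congr fun b => ?_
  rw [hval, indicator_of_mem b.2]

lemma tsum_bonds_ne_top {S : Set (E2 × E2)} (hS : S ⊆ m.bonds) (F : Lstar → ℝ≥0∞)
    (hF : ∑' r, F r ≠ ⊤) : ∑' b : S, F ⟨_, m.bond_dir_mem (hS b.2)⟩ ≠ ⊤ := by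
  have := Fintype.ofFinite ↥(Lat ∩ cell m.N)
  set g : S → Lstar × ↥(Lat ∩ cell m.N) := fun b =>
    (⟨_, m.bond_dir_mem (hS b.2)⟩, ⟨b.1.1, (hS b.2).1.1⟩) with hg
  have hinj : Function.Injective g := fun b b' h => by
    have h1 : b.1.2 - b.1.1 = b'.1.2 - b'.1.1 := congrArg (fun p => p.1.1) h
    have h2 : b.1.1 = b'.1.1 := congrArg (fun p => p.2.1) h
    rw [h2] at h1
    exact Subtype.ext (Prod.ext h2 (sub_left_injective h1))
  refine ne_top_of_le_ne_top ?_ (ENNReal.tsum_comp_le_tsum_of_injective hinj fun i => F i.1)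
  rw [ENNReal.tsum_prod']
  simp only [tsum_fintype, Finset.sum_const, nsmul_eq_mul]
  rw [ENNReal.tsum_mul_left]
  exact ENNReal.mul_ne_top (ENNReal.natCast_ne_top _) hF

lemma bond_segment {b : E2 × E2} {s : ℝ} (hs : s ∈ Icc (0 : ℝ) 1) :
    b.1 + s • (b.2 - b.1) ∈ segment ℝ b.1 b.2 := by
  rw [segment_eq_image']; exact ⟨s, hs, rfl⟩

lemma exists_bound {u : E2 → E2} {L : m.Th → E2 →L[ℝ] E2} (hu : IsPA m.K u fun j => L j.1) :
    ∃ C : ℝ, (∀ P r, ‖Dc r u P‖ ≤ C * ‖r‖) ∧ ∀ x x', ‖u x' - u x‖ ≤ C * ‖x' - x‖ := by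
  have := Fintype.ofFinite m.Th
  have hC : ∀ j : m.Th × perLat m.N, ‖L j.1‖ ≤ ∑ s, ‖L s‖ := fun j =>
    Finset.single_le_sum (f := fun s => ‖L s‖) (fun s _ => norm_nonneg _) (Finset.mem_univ j.1)
  refine ⟨_, fun P r => hu.norm_Dc_le m.isCover hC P r, fun x x' => ?_⟩
  have := hu.norm_bond_le m.isCover hC x (x' - x)
  rwa [add_sub_cancel] at this

/-- The first variation of the bond energy of the bond `b`. -/
noncomputable def dA (φ : ℝ → ℝ) (y u : E2 → E2) (b : E2 × E2) : ℝ :=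
  fderiv ℝ (rad φ) (y b.2 - y b.1) (u b.2 - u b.1)

/-- The first variation of the continuum energy of the bond `b`. -/
noncomputable def dC (φ : ℝ → ℝ) (y u : E2 → E2) (b : E2 × E2) : ℝ :=
  ∫ s in (0 : ℝ)..1, fderiv ℝ (rad φ) (Dc (b.2 - b.1) y (b.1 + s • (b.2 - b.1)))
    (Dc (b.2 - b.1) u (b.1 + s • (b.2 - b.1)))

/-- Finite differences are the special case of `hasDerivAt_tsum_rad` in which the integrand is
constant along the bond. -/
lemma hasDerivAt_bonds {φ : ℝ → ℝ} (hφ : IsPotential φ) {S : Set (E2 × E2)} (hS : S ⊆ m.bonds)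
    {μ : ℝ} (hμ : 0 < μ) {y u : E2 → E2} (hy : ∀ b ∈ S, μ * ‖b.2 - b.1‖ ≤ ‖y b.2 - y b.1‖)
    {L : m.Th → E2 →L[ℝ] E2} (hu : IsPA m.K u fun j => L j.1) :
    HasDerivAt (fun t : ℝ => ∑' b : S, φ ‖(y + t • u) b.1.2 - (y + t • u) b.1.1‖)
      (∑' b : S, dA φ y u b) 0 ∧ Summable fun b : S => dA φ y u b := by
  obtain ⟨C, -, hC⟩ := m.exists_bound hu
  have := hasDerivAt_tsum_rad hφ (fun b : S => ⟨_, m.bond_dir_mem (hS b.2)⟩)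
    (fun F hF => m.tsum_bonds_ne_top hS F hF) hμ (a := fun b _ => y b.1.2 - y b.1.1)
    (c := fun b _ => u b.1.2 - u b.1.1) (C := C) (fun _ => measurable_const)
    (fun _ => measurable_const) (fun b _ => hC _ _) (fun b _ _ => hy _ b.2)
  simp only [intervalIntegral.integral_const, sub_zero, one_smul] at this
  refine ⟨this.1.congr_of_eventuallyEq (.of_forall fun t => tsum_congr fun b => ?_), this.2⟩
  rw [rad]
  congr 2
  simp only [Pi.add_apply, Pi.smul_apply, smul_sub]
  abel

lemma hasDerivAt_bondsC {φ : ℝ → ℝ} (hφ : IsPotential φ) {μ : ℝ} (hμ : 0 < μ) {y u : E2 → E2}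
    {M : m.Th × perLat m.N → E2 →L[ℝ] E2} (hPA : IsPA m.K y M)
    (hy : ∀ P ∈ interior m.Ωcper, ∀ r, μ * ‖r‖ ≤ ‖Dc r y P‖)
    {L : m.Th → E2 →L[ℝ] E2} (hu : IsPA m.K u fun j => L j.1) :
    HasDerivAt (fun t : ℝ => ∑' b : m.bondsC, ∫ s in (0 : ℝ)..1,
        φ ‖Dc (b.1.2 - b.1.1) (y + t • u) (b.1.1 + s • (b.1.2 - b.1.1))‖)
      (∑' b : m.bondsC, dC φ y u b) 0 ∧ Summable fun b : m.bondsC => dC φ y u b := by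
  obtain ⟨C, hC, -⟩ := m.exists_bound hu
  have hS : m.bondsC ⊆ m.bonds := fun b hb => hb.1
  have := hasDerivAt_tsum_rad hφ (fun b : m.bondsC => ⟨_, m.bond_dir_mem (hS b.2)⟩)
    (fun F hF => m.tsum_bonds_ne_top hS F hF) hμ
    (a := fun b s => Dc (b.1.2 - b.1.1) y (b.1.1 + s • (b.1.2 - b.1.1)))
    (c := fun b s => Dc (b.1.2 - b.1.1) u (b.1.1 + s • (b.1.2 - b.1.1))) (C := C)
    (fun _ => hPA.measurable_Dc m.isCover _ _) (fun _ => hu.measurable_Dc m.isCover _ _)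
    (fun b _ => hC _ _) (fun b s hs => hy _ (b.2.2 (bond_segment hs)) _)
  refine ⟨this.1.congr_of_eventuallyEq (.of_forall fun t => tsum_congr fun b => ?_), this.2⟩
  refine intervalIntegral.integral_congr fun s _ => ?_
  simp only [rad, hPA.Dc_add_smul hu m.isCover]

end ACMesh


/-! ### First variations of the two energies as sums over bonds -/

namespace ACMesh

variable (m : ACMesh)

/-- The difference of the two first variations of the energy of the bond `b`. -/
noncomputable def bondDiff (φ : ℝ → ℝ) (y u : E2 → E2) (b : E2 × E2) : ℝ :=
  open Classical in
  (if b ∈ m.bondsC then dC φ (m.Ih y) u b else dA φ (m.Ih y) u b) - dA φ y u b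

lemma hasDerivAt_Eac {φ : ℝ → ℝ} (hφ : IsPotential φ) {B : E2 →L[ℝ] E2} {y : E2 → E2}
    (hy : ∀ x ∈ m.sites, ∀ z ∈ perLat m.N, y (x + z) = y x + B z) {μ : ℝ} (hμ : 0 < μ)
    (h2 : μ ≤ m.muA (m.Ih y)) (h3 : μ ≤ m.muC (m.Ih y)) {u : E2 → E2} {L : m.Th → E2 →L[ℝ] E2}
    (hu : IsPA m.K u fun j => L j.1) :
    HasDerivAt (fun t : ℝ => m.Eac φ (m.Ih y + t • u))
      ((∑' b : m.bondsA, dA φ (m.Ih y) u b) + ∑' b : m.bondsC, dC φ (m.Ih y) u b) 0 ∧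
    (Summable fun b : m.bondsA => dA φ (m.Ih y) u b) ∧
    Summable fun b : m.bondsC => dC φ (m.Ih y) u b := by
  have hA := m.hasDerivAt_bonds hφ (S := m.bondsA) sdiff_subset hμ (y := m.Ih y) (fun b hb => by
    refine le_trans ?_ (muOn_mul_le (m.sites0_sub hb.1.1) hb.1.2.1)
    gcongr
    exact h2) hu
  have hC := m.hasDerivAt_bondsC hφ hμ (m.isPA_Ih y) (fun P hP r => by
    refine le_trans ?_ (m.muC_mul_le_Dc hy hP r)
    gcongr) hu
  exact ⟨hA.1.add hC.1, hA.2, hC.2⟩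

lemma hasDerivAt_Ea {φ : ℝ → ℝ} (hφ : IsPotential φ) {y : E2 → E2} {μ : ℝ} (hμ : 0 < μ)
    (h1 : μ ≤ m.muA y) {u : E2 → E2} {L : m.Th → E2 →L[ℝ] E2}
    (hu : IsPA m.K u fun j => L j.1) :
    HasDerivAt (fun t : ℝ => m.Ea φ (y + t • u)) (∑' b : m.bonds, dA φ y u b) 0 ∧
    Summable fun b : m.bonds => dA φ y u b :=
  m.hasDerivAt_bonds hφ (S := m.bonds) subset_rfl hμ (fun b hb => by
    refine le_trans ?_ (muOn_mul_le (m.sites0_sub hb.1) hb.2.1)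
    gcongr
    exact h1) hu

lemma firstVar_sub_le {φ : ℝ → ℝ} (hφ : IsPotential φ) {B : E2 →L[ℝ] E2} {y : E2 → E2}
    (hy : ∀ x ∈ m.sites, ∀ z ∈ perLat m.N, y (x + z) = y x + B z) {μ : ℝ} (hμ : 0 < μ)
    (h1 : μ ≤ m.muA y) (h2 : μ ≤ m.muA (m.Ih y)) (h3 : μ ≤ m.muC (m.Ih y)) {u : E2 → E2}
    {L : m.Th → E2 →L[ℝ] E2} (hu : IsPA m.K u fun j => L j.1) :
    ENNReal.ofReal (firstVar (m.Eac φ) (m.Ih y) u - firstVar (m.Ea φ) y u) ≤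
      ∑' b : m.bonds, ‖m.bondDiff φ y u b‖ₑ := by
  classical
  obtain ⟨d1, sA, sC⟩ := m.hasDerivAt_Eac hφ hy hμ h2 h3 hu
  obtain ⟨d2, sB⟩ := m.hasDerivAt_Ea hφ hμ h1 hu
  rw [firstVar, firstVar, d1.deriv, d2.deriv]
  set f : E2 × E2 → ℝ := fun b => if b ∈ m.bondsC then dC φ (m.Ih y) u b else dA φ (m.Ih y) u b
    with hf
  have eA : (f ∘ (↑) : m.bondsA → ℝ) = fun b : m.bondsA => dA φ (m.Ih y) u b :=
    funext fun b => if_neg b.2.2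
  have eC : (f ∘ (↑) : m.bondsC → ℝ) = fun b : m.bondsC => dC φ (m.Ih y) u b :=
    funext fun b => if_pos b.2
  have hd : Disjoint m.bondsA m.bondsC := disjoint_sdiff_left
  have hAC := HasSum.add_disjoint hd (f := f) (by rw [eA]; exact sA.hasSum)
    (by rw [eC]; exact sC.hasSum)
  have hun : m.bondsA ∪ m.bondsC = m.bonds := sdiff_union_of_subset fun b hb => hb.1
  rw [hun] at hAC
  rw [← hAC.tsum_eq, ← hAC.summable.tsum_sub sB]
  calc _ ≤ ‖∑' b : m.bonds, m.bondDiff φ y u b‖ₑ := by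
        rw [← ofReal_norm]
        exact ENNReal.ofReal_le_ofReal (le_abs_self _)
    _ ≤ _ := enorm_tsum_le_tsum_enorm

end ACMesh

/-! ### Weighted Hölder inequality for bonds -/

/-- The weighted `L^p` norm of a family of functions on the unit interval is at most `X`. -/
def BoundLp {ι : Type} (p : ℝ≥0∞) (k : ι → ℝ≥0∞) (a : ι → ℝ → ℝ≥0∞) (X : ℝ≥0∞) : Prop :=
  (p ≠ ⊤ → ∑' i, k i * ∫⁻ t in Icc (0 : ℝ) 1, a i t ^ p.toReal ≤ X ^ p.toReal) ∧
    (p = ⊤ → ∀ i, k i ≠ 0 → ∀ᵐ t ∂volume.restrict (Icc (0 : ℝ) 1), a i t ≤ X)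

lemma holder_top {ι : Type} {k : ι → ℝ≥0∞} {a u : ι → ℝ → ℝ≥0∞} {X Y : ℝ≥0∞}
    (hu : ∀ i, Measurable (u i)) (h1 : BoundLp ⊤ k a X) (h2 : BoundLp 1 k u Y) :
    ∑' i, k i * ∫⁻ t in Icc (0 : ℝ) 1, a i t * u i t ≤ X * Y := by
  have h2 := h2.1 ENNReal.one_ne_top
  simp only [ENNReal.toReal_one, ENNReal.rpow_one] at h2
  calc _ ≤ ∑' i, X * (k i * ∫⁻ t in Icc (0 : ℝ) 1, u i t) := by
        refine ENNReal.tsum_le_tsum fun i => ?_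
        by_cases hk : k i = 0
        · simp [hk]
        · rw [mul_left_comm, ← lintegral_const_mul _ (hu i)]
          gcongr 1
          refine lintegral_mono_ae ?_
          filter_upwards [h1.2 rfl i hk] with t ht
          gcongr
    _ ≤ _ := by rw [ENNReal.tsum_mul_left]; gcongr

/-- Hölder's inequality for the counting measure, with the weight split as k = k^(1/p) k^(1/q). -/
lemma tsum_mul_le_Lp {ι : Type} {p q : ℝ} (hpq : p.HolderConjugate q) (k f g : ι → ℝ≥0∞) :
    ∑' i, k i * (f i ^ (1 / p) * g i ^ (1 / q)) ≤
      (∑' i, k i * f i) ^ (1 / p) * (∑' i, k i * g i) ^ (1 / q) := by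
  let : MeasurableSpace ι := ⊤
  have hp := hpq.pos
  have hq := hpq.symm.pos
  have := ENNReal.lintegral_mul_le_Lp_mul_Lq (Measure.count (α := ι)) hpq
    (f := fun i => (k i * f i) ^ (1 / p)) (g := fun i => (k i * g i) ^ (1 / q))
    measurable_from_top.aemeasurable measurable_from_top.aemeasurable
  simp only [lintegral_count, Pi.mul_apply, ← ENNReal.rpow_mul, one_div, inv_mul_cancel₀ hp.ne',
    inv_mul_cancel₀ hq.ne', ENNReal.rpow_one] at this
  simp only [one_div]
  refine le_trans (le_of_eq (tsum_congr fun i => ?_)) this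
  rw [ENNReal.mul_rpow_of_nonneg _ _ (by positivity), ENNReal.mul_rpow_of_nonneg _ _ (by positivity)]
  have e : k i = k i ^ p⁻¹ * k i ^ q⁻¹ := by
    rw [← ENNReal.rpow_add_of_nonneg _ _ (by positivity) (by positivity), hpq.inv_add_inv_eq_one,
      ENNReal.rpow_one]
  conv_lhs => rw [e]
  ring

/-- For finite exponents Hölder is applied twice, first along each bond and then over the bonds. -/
lemma holder_bonds {ι : Type} {p q : ℝ≥0∞} (hpq : p.HolderConjugate q) {k : ι → ℝ≥0∞}
    {a u : ι → ℝ → ℝ≥0∞} {X Y : ℝ≥0∞} (ha : ∀ i, Measurable (a i)) (hu : ∀ i, Measurable (u i))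
    (h1 : BoundLp p k a X) (h2 : BoundLp q k u Y) :
    ∑' i, k i * ∫⁻ t in Icc (0 : ℝ) 1, a i t * u i t ≤ X * Y := by
  by_cases hp : p = ⊤
  · subst hp
    have hq : q = 1 := by
      have := hpq.inv_add_inv_eq_inv
      simpa using this
    subst hq
    exact holder_top hu h1 h2
  by_cases hq : q = ⊤
  · subst hq
    have hp : p = 1 := by
      have := hpq.inv_add_inv_eq_inv
      simpa using this
    subst hp
    rw [mul_comm X]
    simp only [mul_comm (a _ _)]
    exact holder_top ha h2 h1
  have hr := ENNReal.HolderConjugate.toReal_of_ne_top hp hq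
  have e : ∀ (Z : ℝ≥0∞) {s : ℝ}, 0 < s → (Z ^ s) ^ (1 / s) = Z := fun Z s hs => by
    rw [← ENNReal.rpow_mul, mul_one_div_cancel hs.ne', ENNReal.rpow_one]
  calc _ ≤ ∑' i, k i * ((∫⁻ t in Icc (0 : ℝ) 1, a i t ^ p.toReal) ^ (1 / p.toReal) *
        (∫⁻ t in Icc (0 : ℝ) 1, u i t ^ q.toReal) ^ (1 / q.toReal)) := by
        refine ENNReal.tsum_le_tsum fun i => ?_
        gcongr
        exact ENNReal.lintegral_mul_le_Lp_mul_Lq _ hr (ha i).aemeasurable (hu i).aemeasurable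
    _ ≤ _ := tsum_mul_le_Lp hr _ _ _
    _ ≤ (X ^ p.toReal) ^ (1 / p.toReal) * (Y ^ q.toReal) ^ (1 / q.toReal) := by
        have := hr.pos
        have := hr.symm.pos
        gcongr
        · exact h1.1 hp
        · exact h2.1 hq
    _ = X * Y := by rw [e _ hr.pos, e _ hr.symm.pos]


/-! ### The error in the first variation of a bond energy -/

/-- A bound that holds with every adjacent piece holds with the best one. The constant must be
finite and non-zero, because the infimum may be infinite or zero. -/
lemma le_mul_low {J : Type} {K : J → Set E2} {f : J → ℝ≥0∞} {P : E2} {X c : ℝ≥0∞} (hc : c ≠ 0)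
    (hc' : c ≠ ⊤) (h : ∀ j, P ∈ K j → X ≤ c * f j) : X ≤ c * low K f P := by
  rw [mul_comm, ← ENNReal.div_le_iff hc hc']
  refine le_iInf₂ fun j hj => ?_
  rw [ENNReal.div_le_iff hc hc', mul_comm]
  exact h j hj

lemma enorm_fderiv_rad_sub_apply_le {φ : ℝ → ℝ} (hφ : IsPotential φ) {μ : ℝ} (hμ : 0 < μ) {r : E2}
    (hr : r ∈ Lstar) {a d : E2} (ha : μ * ‖r‖ ≤ ‖a‖) (hd : μ * ‖r‖ ≤ ‖d‖) (v : E2) :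
    ‖fderiv ℝ (rad φ) a v - fderiv ℝ (rad φ) d v‖ₑ ≤
      ENNReal.ofReal √2 * Mk φ 2 (μ * ‖r‖) * (‖a - d‖ₑ * ‖v‖ₑ) := by
  have hM := Mk_ne_top hφ le_rfl hμ ⟨r, hr⟩
  have hr0 := norm_pos_iff.2 hr.2
  have h1 := norm_fderiv_rad_sub_le hφ.1 (by positivity) hM ha hd
  have h2 : ‖fderiv ℝ (rad φ) a v - fderiv ℝ (rad φ) d v‖ ≤
      √2 * (Mk φ 2 (μ * ‖r‖)).toReal * (‖a - d‖ * ‖v‖) := by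
    have := (fderiv ℝ (rad φ) a - fderiv ℝ (rad φ) d).le_opNorm v
    rw [sub_apply] at this
    refine this.trans ((mul_le_mul_of_nonneg_right h1 (norm_nonneg v)).trans (le_of_eq ?_))
    ring
  rw [← ofReal_norm, ← ofReal_norm (a - d), ← ofReal_norm v]
  refine (ENNReal.ofReal_le_ofReal h2).trans (le_of_eq ?_)
  rw [ENNReal.ofReal_mul (by positivity), ENNReal.ofReal_mul (by positivity),
    ENNReal.ofReal_mul (norm_nonneg _), ENNReal.ofReal_toReal hM]

lemma enorm_intervalIntegral_le {F : Type*} [NormedAddCommGroup F] [NormedSpace ℝ F]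
    (f : ℝ → F) : ‖∫ s in (0 : ℝ)..1, f s‖ₑ ≤ ∫⁻ s in Icc (0 : ℝ) 1, ‖f s‖ₑ := by
  rw [intervalIntegral.integral_of_le zero_le_one]
  exact (enorm_integral_le_lintegral_enorm _).trans (lintegral_mono_set Ioc_subset_Icc_self)

namespace ACMesh

variable (m : ACMesh)

/-- The local coarsening error at a point. -/
noncomputable def coarseAt (H : E2 → E2 →L[ℝ] E2 →L[ℝ] E2) (P : E2) : ℝ≥0∞ :=
  low m.K (fun j => m.coarse H j.1) P

/-- The local modelling error at a point, in direction `r`. -/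
noncomputable def modelAt (H : E2 → E2 →L[ℝ] E2 →L[ℝ] E2) (r P : E2) : ℝ≥0∞ :=
  low m.Kc (fun j => linfHull H (m.omega j.1.1 r)) P

/-- The gradient of a finite element function at a point. -/
noncomputable def gradAt (L : m.Th → E2 →L[ℝ] E2) (P : E2) : ℝ≥0∞ :=
  low m.K (fun j => ‖frob (L j.1)‖ₑ) P

lemma measurable_coarseAt (H : E2 → E2 →L[ℝ] E2 →L[ℝ] E2) : Measurable (m.coarseAt H) :=
  measurable_low m.isCover.closed _

lemma measurable_modelAt (H : E2 → E2 →L[ℝ] E2 →L[ℝ] E2) (r : E2) : Measurable (m.modelAt H r) :=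
  measurable_low m.isClosed_Kc _

lemma measurable_gradAt (L : m.Th → E2 →L[ℝ] E2) : Measurable (m.gradAt L) :=
  measurable_low m.isCover.closed _

lemma ae_Dc_le_gradAt {u : E2 → E2} {L : m.Th → E2 →L[ℝ] E2} (hu : IsPA m.K u fun j => L j.1)
    {r : E2} (hr : r ≠ 0) (x : E2) :
    ∀ᵐ t : ℝ, ‖Dc r u (x + t • r)‖ₑ ≤ ‖r‖ₑ * m.gradAt L (x + t • r) := by
  filter_upwards [m.isCover.ae_Dc x r] with t ht
  refine le_mul_low (by simpa using hr) enorm_ne_top fun j hj => ?_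
  rw [ht j hj u _ hu, mul_comm]
  have h1 := norm_apply_le_frob (L j.1) r
  have h2 : 0 ≤ frob (L j.1) := Real.sqrt_nonneg _
  rw [← ofReal_norm, ← ofReal_norm, ← ofReal_norm, Real.norm_eq_abs, abs_of_nonneg h2,
    ← ENNReal.ofReal_mul h2]
  exact ENNReal.ofReal_le_ofReal h1

/-- The constant of the interpolation error. -/
noncomputable def interpConst (κ : ℝ) : ℝ≥0∞ := ENNReal.ofReal (2 / sinBound κ)

/-- A periodic deformation with gradient bounded by a bounded field of second derivatives. -/
structure IsSmooth (B : E2 →L[ℝ] E2) (w : E2 → E2) (H : E2 → E2 →L[ℝ] E2 →L[ℝ] E2) : Prop where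
  contDiff : ContDiff ℝ 1 w
  gradBound : GradBound w H
  memLp : MemLp H ⊤ volume
  per : ∀ x, ∀ z ∈ perLat m.N, w (x + z) = w x + B z

variable {m} {κ : ℝ} {w : E2 → E2} {H : E2 → E2 →L[ℝ] E2 →L[ℝ] E2} {B : E2 →L[ℝ] E2}

lemma IsSmooth.ae_interp_le (h : m.IsSmooth B w H) (hκ : m.ShapeRegular κ) {r : E2} (hr : r ≠ 0) (x : E2) :
    ∀ᵐ t : ℝ, ‖Dc r (m.Ih w) (x + t • r) - fderiv ℝ w (x + t • r) r‖ₑ ≤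
      interpConst κ * ‖r‖ₑ * m.coarseAt H (x + t • r) := by
  filter_upwards [m.isCover.ae_Dc x r] with t ht
  obtain ⟨j, hj⟩ := m.exists_mem_K (x + t • r)
  have hσ := (hκ.sin_le j.1).1
  refine le_mul_low (mul_ne_zero ?_ (by simpa using hr))
    (ENNReal.mul_ne_top ENNReal.ofReal_ne_top enorm_ne_top) fun j hj => ?_
  · rw [interpConst]; simpa using hσ
  · rw [ht j hj _ _ (m.isPA_Ih w), mul_assoc]
    exact m.interp_error hκ h.contDiff h.gradBound h.memLp h.per j hj r

lemma bound_LI (hper : ∀ x, ∀ z ∈ perLat m.N, w (x + z) = w x + B z) : ∃ C : ℝ, ∀ j, ‖m.LI w j‖ ≤ C := by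
  have := Fintype.ofFinite m.Th
  refine ⟨∑ s, ‖m.LI w (s, ⟨0, (perG m.N).zero_mem⟩)‖, fun j => ?_⟩
  rw [m.LI_eq_zero_shift j fun v _ => hper v _ j.2.2]
  exact Finset.single_le_sum (f := fun s => ‖m.LI w (s, ⟨0, (perG m.N).zero_mem⟩)‖)
    (fun s _ => norm_nonneg _) (Finset.mem_univ j.1)

lemma IsSmooth.bond_interp_le (h : m.IsSmooth B w H) (hκ : m.ShapeRegular κ) {r : E2} (hr : r ≠ 0) (x : E2) :
    ‖m.Ih w (x + r) - m.Ih w x - (w (x + r) - w x)‖ₑ ≤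
      interpConst κ * ‖r‖ₑ * ∫⁻ t in Icc (0 : ℝ) 1, m.coarseAt H (x + t • r) := by
  obtain ⟨C, hC⟩ := bound_LI h.per
  have hw := h.contDiff
  have hPA := m.isPA_Ih w
  have hcont : Continuous fun s : ℝ => fderiv ℝ w (x + s • r) r :=
    ((hw.continuous_fderiv (by norm_num)).comp (by fun_prop)).clm_apply continuous_const
  rw [← hPA.integral_Dc m.isCover hC, ← integral_fderiv_line hw, ← intervalIntegral.integral_sub
    (hPA.integrable_Dc m.isCover hC _ _ _ _) (hcont.intervalIntegrable _ _)]
  refine (enorm_intervalIntegral_le _).trans ?_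
  have hm : Measurable fun t : ℝ => m.coarseAt H (x + t • r) :=
    (m.measurable_coarseAt H).comp (by fun_prop)
  rw [← lintegral_const_mul _ hm]
  exact lintegral_mono_ae (ae_restrict_of_ae (h.ae_interp_le hκ hr x))

/-- For almost every t, each micro-triangle through the point x + tr contains a piece of the bond of
positive length. The bond, shifted by the period of the triangle, is then one of those that span ω,
so the segment estimate applies on ω. -/
lemma IsSmooth.ae_model_le (h : m.IsSmooth B w H) {b : E2 × E2} (hbC : b ∈ m.bondsC) :
    ∀ᵐ t ∂volume.restrict (Icc (0 : ℝ) 1),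
      ‖fderiv ℝ w (b.1 + t • (b.2 - b.1)) (b.2 - b.1) - (w b.2 - w b.1)‖ₑ ≤
      ENNReal.ofReal (1 / 2 * ‖b.2 - b.1‖ ^ 2) *
        m.modelAt H (b.2 - b.1) (b.1 + t • (b.2 - b.1)) := by
  obtain ⟨x, x'⟩ := b
  have hr := (m.bond_dir_mem hbC.1).2
  simp only at hr ⊢
  set r := x' - x with hrdef
  have hx' : x' = x + r := (add_sub_cancel x x').symm
  have hr0 : r ≠ 0 := hr
  have hIoo : ∀ᵐ t ∂volume.restrict (Icc (0 : ℝ) 1), t ∈ Ioo (0 : ℝ) 1 := by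
    rw [← Measure.restrict_congr_set Ioo_ae_eq_Icc]
    exact ae_restrict_mem measurableSet_Ioo
  filter_upwards [hIoo, ae_restrict_of_ae (ae_line_interior m.isClosed_Kc (fun j => by
    have : m.Kc j = tri (shift j.2.1 j.1.1) := by ext P; rw [mem_tri_shift]; rfl
    rw [this]; exact convex_tri _) x r)] with t ht hline
  have hn := norm_pos_iff.2 hr0
  refine le_mul_low (by rw [ne_eq, ENNReal.ofReal_eq_zero, not_le]; positivity)
    ENNReal.ofReal_ne_top fun j hj => ?_
  obtain ⟨δ, hδ, hδ'⟩ := hline j hj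
  have hbper : (x - j.2.1, x - j.2.1 + r) ∈ m.bondsCper := by
    refine ⟨(x, x'), hbC, -j.2.1, (perG m.N).neg_mem j.2.2, ?_⟩
    rw [hx']
    exact Prod.ext (sub_eq_add_neg _ _) (by simp only; abel)
  have hseg : ∀ s ∈ Icc (0 : ℝ) 1,
      x - j.2.1 + s • r ∈ segment ℝ (x - j.2.1) (x - j.2.1 + r) := fun s hs => by
    rw [segment_eq_image']; exact ⟨s, hs, by simp⟩
  have hnon : (segment ℝ (x - j.2.1) (x - j.2.1 + r) ∩ tri j.1.1).Nontrivial := by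
    -- The second point, at parameter t + ε, must lie in the triangle and also on the bond.
    set ε := min δ (1 - t) with hε
    have hε0 : 0 < ε := lt_min hδ (by linarith [ht.2])
    have hεt : ε ≤ 1 - t := min_le_right _ _
    refine ⟨x - j.2.1 + t • r, ⟨hseg t ⟨ht.1.le, ht.2.le⟩, ?_⟩, x - j.2.1 + (t + ε) • r,
      ⟨hseg (t + ε) ⟨by linarith [ht.1], by linarith⟩, ?_⟩, ?_⟩
    · have : x - j.2.1 + t • r = x + t • r - j.2.1 := by abel
      rw [this]; exact hj
    · have h1 := hδ' ε (by rw [abs_of_pos hε0]; exact min_le_left _ _)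
      have : x - j.2.1 + (t + ε) • r = x + t • r + ε • r - j.2.1 := by rw [add_smul]; abel
      rw [this]; exact h1
    · intro h'
      have h1 := smul_left_injective ℝ hr0 (add_left_cancel h')
      linarith
  have hsub : segment ℝ (x - j.2.1) (x - j.2.1 + r) ⊆ m.omega j.1.1 r := by
    refine Subset.trans ?_ (subset_convexHull ℝ _)
    exact subset_biUnion_of_mem (u := fun b : E2 × E2 => segment ℝ b.1 b.2)
      (show (x - j.2.1, x - j.2.1 + r) ∈ {b : E2 × E2 | b ∈ m.bondsCper ∧ b.2 - b.1 = r ∧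
        (segment ℝ b.1 b.2 ∩ tri j.1.1).Nontrivial} from
        ⟨hbper, add_sub_cancel_left _ _, hnon⟩)
  have key := h.gradBound.bond h.contDiff (convex_convexHull ℝ _) hr0 hsub ⟨ht.1.le, ht.2.le⟩
  have e1 : x - j.2.1 + t • r = x + t • r - j.2.1 := by abel
  have e2 : x' = x - j.2.1 + r + j.2.1 := by rw [hx']; abel
  have e3 : w x' - w x = w (x - j.2.1 + r) - w (x - j.2.1) := by
    have h1 := h.per (x - j.2.1 + r) _ j.2.2
    have h2 := h.per (x - j.2.1) _ j.2.2
    rw [sub_add_cancel] at h2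
    rw [← e2] at h1
    rw [h1, h2]; abel
  rw [e1, fderiv_sub_period (fun x => h.per x _ j.2.2)] at key
  rw [e3, mul_comm]
  exact key

end ACMesh


/-! ### Coarsening and modelling errors along a bond -/

namespace ACMesh

variable (m : ACMesh)

open Classical in
/-- The coarsening error along a bond, averaged for the atomistic bonds. -/
noncomputable def coarseB (H : E2 → E2 →L[ℝ] E2 →L[ℝ] E2) (b : E2 × E2) (t : ℝ) : ℝ≥0∞ :=
  if b ∈ m.bondsC then m.coarseAt H (b.1 + t • (b.2 - b.1))
  else ∫⁻ s in Icc (0 : ℝ) 1, m.coarseAt H (b.1 + s • (b.2 - b.1))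

open Classical in
/-- The modelling error along a bond. -/
noncomputable def modelB (H : E2 → E2 →L[ℝ] E2 →L[ℝ] E2) (b : E2 × E2) (t : ℝ) : ℝ≥0∞ :=
  if b ∈ m.bondsC then
    (Icc (0 : ℝ) 1).indicator (fun t => m.modelAt H (b.2 - b.1) (b.1 + t • (b.2 - b.1))) t
  else 0

/-- The gradient of a finite element function along a bond. -/
noncomputable def gradB (L : m.Th → E2 →L[ℝ] E2) (b : E2 × E2) (t : ℝ) : ℝ≥0∞ :=
  m.gradAt L (b.1 + t • (b.2 - b.1))

lemma measurable_coarseB (H : E2 → E2 →L[ℝ] E2 →L[ℝ] E2) (b : E2 × E2) :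
    Measurable (m.coarseB H b) := by
  by_cases hb : b ∈ m.bondsC
  · have : m.coarseB H b = fun t => m.coarseAt H (b.1 + t • (b.2 - b.1)) := by
      ext t; rw [coarseB, if_pos hb]
    rw [this]
    exact (m.measurable_coarseAt H).comp (by fun_prop)
  · have : m.coarseB H b = fun _ => ∫⁻ s in Icc (0 : ℝ) 1,
        m.coarseAt H (b.1 + s • (b.2 - b.1)) := by
      ext t; rw [coarseB, if_neg hb]
    rw [this]
    exact measurable_const

lemma measurable_modelB (H : E2 → E2 →L[ℝ] E2 →L[ℝ] E2) (b : E2 × E2) :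
    Measurable (m.modelB H b) := by
  by_cases hb : b ∈ m.bondsC
  · have : m.modelB H b = (Icc (0 : ℝ) 1).indicator
        fun t => m.modelAt H (b.2 - b.1) (b.1 + t • (b.2 - b.1)) := by
      ext t; rw [modelB, if_pos hb]
    rw [this]
    exact ((m.measurable_modelAt H _).comp (by fun_prop)).indicator measurableSet_Icc
  · have : m.modelB H b = fun _ => 0 := by ext t; rw [modelB, if_neg hb]
    rw [this]
    exact measurable_const

lemma measurable_gradB (L : m.Th → E2 →L[ℝ] E2) (b : E2 × E2) : Measurable (m.gradB L b) :=
  (m.measurable_gradAt L).comp (by fun_prop)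

variable {m} {κ : ℝ} {w : E2 → E2} {H : E2 → E2 →L[ℝ] E2 →L[ℝ] E2} {B : E2 →L[ℝ] E2}

/-- The bound for the difference of the first variations of a bond energy. -/
noncomputable def bondBound (m : ACMesh) (κ : ℝ) (H : E2 → E2 →L[ℝ] E2 →L[ℝ] E2)
    (L : m.Th → E2 →L[ℝ] E2) (M : ℝ≥0∞) (b : E2 × E2) : ℝ≥0∞ :=
  ∫⁻ t in Icc (0 : ℝ) 1, ENNReal.ofReal √2 * M *
    ((interpConst κ * ‖b.2 - b.1‖ₑ * m.coarseB H b t +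
      ENNReal.ofReal (1 / 2 * ‖b.2 - b.1‖ ^ 2) * m.modelB H b t) *
      (‖b.2 - b.1‖ₑ * m.gradB L b t))

/-- For a finite difference bond the stress error and the displacement difference are integrated
over the bond separately. The product of these two integrals has the form of the common bound
because `coarseB` is then constant, equal to the mean of the local error. -/
lemma IsSmooth.bondDiff_le_of_notMem (h : m.IsSmooth B w H) (hκ : m.ShapeRegular κ) {φ : ℝ → ℝ}
    (hφ : IsPotential φ) {y : E2 → E2} (hwy : ∀ x ∈ m.sites, w x = y x) {μ : ℝ} (hμ : 0 < μ)
    (h1 : μ ≤ m.muA y) (h2 : μ ≤ m.muA (m.Ih y)) {u : E2 → E2}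
    {L : m.Th → E2 →L[ℝ] E2} (hu : IsPA m.K u fun j => L j.1) {b : E2 × E2} (hb : b ∈ m.bonds)
    (hbC : b ∉ m.bondsC) :
    ‖m.bondDiff φ y u b‖ₑ ≤ m.bondBound κ H L (Mk φ 2 (μ * ‖b.2 - b.1‖)) b := by
  obtain ⟨x, x'⟩ := b
  have hr := m.bond_dir_mem hb
  have hx := m.sites0_sub hb.1
  have hx'S := hb.2.1
  simp only at hr hx hx'S
  have hA : ∀ t, m.coarseB H (x, x') t =
      ∫⁻ s in Icc (0 : ℝ) 1, m.coarseAt H (x + s • (x' - x)) := fun t => by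
    rw [coarseB, if_neg hbC]
  have hA2 : ∀ t, m.modelB H (x, x') t = 0 := fun t => by rw [modelB, if_neg hbC]
  rw [bondDiff, if_neg hbC, bondBound]
  simp only [hA, hA2, mul_zero, add_zero, dA, gradB]
  set r := x' - x with hrdef
  have hx' : x' = x + r := (add_sub_cancel x x').symm
  have hm : Measurable fun t : ℝ => m.gradAt L (x + t • r) :=
    (m.measurable_gradAt L).comp (by fun_prop)
  have hd1 : μ * ‖r‖ ≤ ‖m.Ih y x' - m.Ih y x‖ := by
    refine le_trans ?_ (muOn_mul_le hx hx'S); gcongr; exact h2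
  have hd2 : μ * ‖r‖ ≤ ‖y x' - y x‖ := by
    refine le_trans ?_ (muOn_mul_le hx hx'S); gcongr; exact h1
  refine (enorm_fderiv_rad_sub_apply_le hφ hμ hr hd1 hd2 _).trans ?_
  rw [lintegral_const_mul _ ((hm.const_mul _).const_mul _),
    lintegral_const_mul _ (hm.const_mul _), lintegral_const_mul _ hm]
  refine mul_le_mul' le_rfl (mul_le_mul' ?_ ?_)
  · rw [m.Ih_congr (fun x hx => (hwy x hx).symm) hx, m.Ih_congr (fun x hx => (hwy x hx).symm) hx'S,
      ← hwy x hx, ← hwy x' hx'S, hx']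
    exact h.bond_interp_le hκ hr.2 x
  · obtain ⟨C, hC⟩ : ∃ C, ∀ j : m.Th × perLat m.N, ‖L j.1‖ ≤ C := by
      have := Fintype.ofFinite m.Th
      exact ⟨∑ s, ‖L s‖, fun j => Finset.single_le_sum (f := fun s => ‖L s‖)
        (fun s _ => norm_nonneg _) (Finset.mem_univ j.1)⟩
    rw [hx', ← hu.integral_Dc m.isCover hC, ← lintegral_const_mul _ hm]
    refine (enorm_intervalIntegral_le _).trans (lintegral_mono_ae (ae_restrict_of_ae ?_))
    exact m.ae_Dc_le_gradAt hu hr.2 x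

/-- The atomistic variation is also written as an integral of ∇_r u along the bond. Under the common
integral, ∇_r w is inserted between ∇_r I_h w and the difference quotient of w; the two parts are
the coarsening and the modelling error. -/
lemma IsSmooth.bondDiff_le_of_mem (h : m.IsSmooth B w H) (hκ : m.ShapeRegular κ) {φ : ℝ → ℝ}
    (hφ : IsPotential φ) {y : E2 → E2}
    (hy : ∀ x ∈ m.sites, ∀ z ∈ perLat m.N, y (x + z) = y x + B z)
    (hwy : ∀ x ∈ m.sites, w x = y x) {μ : ℝ} (hμ : 0 < μ)
    (h1 : μ ≤ m.muA y) (h3 : μ ≤ m.muC (m.Ih y)) {u : E2 → E2}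
    {L : m.Th → E2 →L[ℝ] E2} (hu : IsPA m.K u fun j => L j.1) {b : E2 × E2}
    (hbC : b ∈ m.bondsC) :
    ‖m.bondDiff φ y u b‖ₑ ≤ m.bondBound κ H L (Mk φ 2 (μ * ‖b.2 - b.1‖)) b := by
  have hb := hbC.1
  have hmodel := h.ae_model_le hbC
  obtain ⟨x, x'⟩ := b
  have hr := m.bond_dir_mem hb
  have hx := m.sites0_sub hb.1
  have hx'S := hb.2.1
  simp only at hr hx hx'S hmodel
  have hseg : ∀ t ∈ Icc (0 : ℝ) 1, x + t • (x' - x) ∈ interior m.Ωcper := fun t ht =>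
    hbC.2 (bond_segment (b := (x, x')) ht)
  have hA : ∀ t, m.coarseB H (x, x') t = m.coarseAt H (x + t • (x' - x)) := fun t => by
    rw [coarseB, if_pos hbC]
  have hA2 : ∀ t ∈ Icc (0 : ℝ) 1, m.modelB H (x, x') t =
      m.modelAt H (x' - x) (x + t • (x' - x)) := fun t ht => by
    rw [modelB, if_pos hbC, indicator_of_mem ht]
  rw [bondDiff, if_pos hbC, bondBound]
  simp only [hA, dA, dC, gradB]
  set r := x' - x with hrdef
  have hx' : x' = x + r := (add_sub_cancel x x').symm
  have hr0 := norm_pos_iff.2 hr.2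
  have hd2 : μ * ‖r‖ ≤ ‖y x' - y x‖ := by
    refine le_trans ?_ (muOn_mul_le hx hx'S); gcongr; exact h1
  have hd1 : ∀ t ∈ Icc (0 : ℝ) 1, μ * ‖r‖ ≤ ‖Dc r (m.Ih y) (x + t • r)‖ := fun t ht => by
    refine le_trans ?_ (m.muC_mul_le_Dc hy (hseg t ht) r); gcongr
  obtain ⟨C, hC⟩ : ∃ C, ∀ j : m.Th × perLat m.N, ‖L j.1‖ ≤ C := by
    have := Fintype.ofFinite m.Th
    exact ⟨∑ s, ‖L s‖, fun j => Finset.single_le_sum (f := fun s => ‖L s‖)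
      (fun s _ => norm_nonneg _) (Finset.mem_univ j.1)⟩
  have hmD := (m.isPA_Ih y).measurable_Dc m.isCover x r
  have hmU := hu.measurable_Dc m.isCover x r
  have hint1 : IntervalIntegrable (fun t : ℝ => fderiv ℝ (rad φ) (Dc r (m.Ih y) (x + t • r))
      (Dc r u (x + t • r))) volume 0 1 := by
    refine (intervalIntegrable_const (c := (Mk φ 1 (μ * ‖r‖)).toReal * (C * ‖r‖))).mono_fun'
      (measurable_fderiv_rad_apply φ hmD hmU).aestronglyMeasurable ?_
    refine (ae_restrict_mem measurableSet_uIoc).mono fun s hs => ?_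
    have hs' : s ∈ Icc (0 : ℝ) 1 := by
      rw [uIoc_of_le zero_le_one] at hs; exact ⟨hs.1.le, hs.2⟩
    refine (ContinuousLinearMap.le_opNorm _ _).trans ?_
    exact mul_le_mul (norm_fderiv_rad_le φ (hd1 s hs') (Mk_ne_top hφ (by norm_num) hμ ⟨r, hr⟩))
      (hu.norm_Dc_le m.isCover hC _ _) (norm_nonneg _) ENNReal.toReal_nonneg
  have hint2 := hu.integrable_Dc m.isCover hC x r 0 1
  have e : fderiv ℝ (rad φ) (y x' - y x) (u x' - u x) =
      ∫ t in (0 : ℝ)..1, fderiv ℝ (rad φ) (y x' - y x) (Dc r u (x + t • r)) := by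
    rw [ContinuousLinearMap.intervalIntegral_comp_comm _ hint2, hu.integral_Dc m.isCover hC, ← hx']
  rw [e, ← intervalIntegral.integral_sub hint1
    ⟨ContinuousLinearMap.integrable_comp _ hint2.1, ContinuousLinearMap.integrable_comp _ hint2.2⟩]
  refine (enorm_intervalIntegral_le _).trans (lintegral_mono_ae ?_)
  filter_upwards [ae_restrict_mem measurableSet_Icc, hmodel,
    ae_restrict_of_ae (h.ae_interp_le hκ hr.2 x), ae_restrict_of_ae (m.ae_Dc_le_gradAt hu hr.2 x)]
    with t ht g1 g2 g3
  refine (enorm_fderiv_rad_sub_apply_le hφ hμ hr (hd1 t ht) hd2 _).trans ?_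
  rw [hA2 t ht]
  gcongr
  rw [m.Dc_Ih_congr (fun x hx => (hwy x hx).symm) (hseg t ht), ← hwy x hx, ← hwy x' hx'S,
    ← sub_add_sub_cancel _ (fderiv ℝ w (x + t • r) r)]
  exact (enorm_add_le _ _).trans (add_le_add g2 g1)

end ACMesh


/-! ### The norms of the local errors -/

lemma low_rpow_le {J : Type} (K : J → Set E2) (f : J → ℝ≥0∞) {p : ℝ} (hp : 0 ≤ p) (P : E2) :
    low K f P ^ p ≤ low K (fun j => f j ^ p) P :=
  le_iInf₂ fun _ hj => ENNReal.rpow_le_rpow (low_le f hj) hp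

lemma wlp_rpow {ι : Type} {p : ℝ≥0∞} (hp0 : p ≠ 0) (hp : p ≠ ⊤) (w a : ι → ℝ≥0∞) :
    wlp p w a ^ p.toReal = ∑' i, w i * a i ^ p.toReal := by
  rw [wlp, if_neg hp, ← ENNReal.rpow_mul, one_div,
    inv_mul_cancel₀ (ENNReal.toReal_ne_zero.2 ⟨hp0, hp⟩), ENNReal.rpow_one]

lemma le_wlp_top {ι : Type} (w a : ι → ℝ≥0∞) {i : ι} (hi : w i ≠ 0) : a i ≤ wlp ⊤ w a := by
  rw [wlp, if_pos rfl]
  exact le_iSup₂ (f := fun i (_ : w i ≠ 0) => a i) i hi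

lemma rpow_inv_mul_rpow {p : ℝ≥0∞} (hp0 : p ≠ 0) (hp : p ≠ ⊤) (A W : ℝ≥0∞) :
    (A ^ (p⁻¹).toReal * W) ^ p.toReal = A * W ^ p.toReal := by
  rw [ENNReal.mul_rpow_of_nonneg _ _ ENNReal.toReal_nonneg, ← ENNReal.rpow_mul, ENNReal.toReal_inv,
    inv_mul_cancel₀ (ENNReal.toReal_ne_zero.2 ⟨hp0, hp⟩), ENNReal.rpow_one]

lemma lintegral_rpow_le {p : ℝ} (hp : 1 ≤ p) {f : ℝ → ℝ≥0∞} (hf : Measurable f) :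
    (∫⁻ t in Icc (0 : ℝ) 1, f t) ^ p ≤ ∫⁻ t in Icc (0 : ℝ) 1, f t ^ p := by
  rcases hp.eq_or_lt with rfl | hp
  · simp
  have hpq := Real.HolderConjugate.conjExponent hp
  have := ENNReal.lintegral_mul_le_Lp_mul_Lq (volume.restrict (Icc (0 : ℝ) 1)) hpq
    (f := f) (g := fun _ => 1) hf.aemeasurable aemeasurable_const
  simp only [Pi.mul_apply, mul_one, ENNReal.one_rpow, lintegral_const, Measure.restrict_apply_univ,
    Real.volume_Icc, sub_zero, ENNReal.ofReal_one] at this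
  calc _ ≤ ((∫⁻ t in Icc (0 : ℝ) 1, f t ^ p) ^ (1 / p)) ^ p := by gcongr
    _ = _ := by
      rw [← ENNReal.rpow_mul, one_div, inv_mul_cancel₀ (by positivity), ENNReal.rpow_one]

/-- By Jensen's inequality, replacing a function on the unit interval by its mean does not increase
its norm, so atomistic and continuum bonds obey the same bound. -/
lemma BoundLp.average {ι : Type} {p : ℝ≥0∞} (hp1 : 1 ≤ p) {k : ι → ℝ≥0∞} {a a' : ι → ℝ → ℝ≥0∞}
    {X : ℝ≥0∞} (h : BoundLp p k a X) (ha : ∀ i, Measurable (a i))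
    (h' : ∀ i, a' i = a i ∨ a' i = fun _ => ∫⁻ s in Icc (0 : ℝ) 1, a i s) :
    BoundLp p k a' X := by
  refine ⟨fun hp => (ENNReal.tsum_le_tsum fun i => ?_).trans (h.1 hp), fun hp i hi => ?_⟩
  · gcongr 1
    rcases h' i with e | e
    · rw [e]
    · rw [e, lintegral_const, Measure.restrict_apply_univ, Real.volume_Icc, sub_zero,
        ENNReal.ofReal_one, mul_one]
      refine lintegral_rpow_le ?_ (ha i)
      rw [← ENNReal.toReal_one]
      exact (ENNReal.toReal_le_toReal ENNReal.one_ne_top hp).2 hp1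
  · have h1 := h.2 hp i hi
    rcases h' i with e | e
    · rw [e]; exact h1
    · refine .of_forall fun t => ?_
      rw [e]
      refine (lintegral_mono_ae h1).trans (le_of_eq ?_)
      rw [lintegral_const, Measure.restrict_apply_univ, Real.volume_Icc, sub_zero,
        ENNReal.ofReal_one, mul_one]

namespace ACMesh

variable (m : ACMesh)

/-- The density estimate is uniform in the direction, so summation over r only contributes the total
weight, and its p-th root appears in the norm. -/
lemma boundLp_low {p : ℝ≥0∞} (hp0 : p ≠ 0) (k : Lstar → ℝ≥0∞) (f : m.Th → ℝ≥0∞) {W : ℝ≥0∞}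
    (h1 : p ≠ ⊤ → ∑' s : m.Th, volume (tri s.1) * f s ^ p.toReal ≤ W ^ p.toReal)
    (h2 : p = ⊤ → ∀ s, f s ≤ W) :
    BoundLp p (fun i : Lstar × ↥(Lat ∩ cell m.N) => k i.1)
      (fun i t => low m.K (fun j => f j.1) (i.2.1 + t • i.1.1))
      (((∑' r, k r) / volume unitCell) ^ (p⁻¹).toReal * W) := by
  refine ⟨fun hp => ?_, fun hp i _ => .of_forall fun t => ?_⟩
  · rw [rpow_inv_mul_rpow hp0 hp, ENNReal.tsum_prod']
    calc _ ≤ ∑' r : Lstar, k r * (W ^ p.toReal / volume unitCell) := by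
          refine ENNReal.tsum_le_tsum fun r => ?_
          dsimp only
          rw [ENNReal.tsum_mul_left]
          gcongr
          calc _ ≤ ∑' x : ↥(Lat ∩ cell m.N), ∫⁻ t in Icc (0 : ℝ) 1,
                low m.K (fun j => f j.1 ^ p.toReal) (x + t • r.1) := by
                gcongr
                exact low_rpow_le _ _ ENNReal.toReal_nonneg _
            _ ≤ _ := m.tsum_lintegral_low_le (fun s => f s ^ p.toReal) r.2
            _ ≤ _ := by gcongr; exact h1 hp
      _ = _ := by rw [ENNReal.tsum_mul_right, div_eq_mul_inv, div_eq_mul_inv]; ring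
  · subst hp
    obtain ⟨j, hj⟩ := m.exists_mem_K (i.2.1 + t • i.1.1)
    simp only [ENNReal.inv_top, ENNReal.toReal_zero, ENNReal.rpow_zero, one_mul]
    exact (low_le _ hj).trans (h2 rfl j.1)

/-- The bond with a given direction and initial point. -/
def bondOf (i : Lstar × ↥(Lat ∩ cell m.N)) : E2 × E2 := (i.2.1, i.2.1 + i.1.1)

lemma bondOf_dir (i : Lstar × ↥(Lat ∩ cell m.N)) : (m.bondOf i).2 - (m.bondOf i).1 = i.1.1 :=
  add_sub_cancel_left _ _

lemma boundLp_gradB {q : ℝ≥0∞} (hq0 : q ≠ 0) (k : Lstar → ℝ≥0∞) {u : E2 → E2}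
    {L : m.Th → E2 →L[ℝ] E2} (hu : IsPA m.K u fun j => L j.1) (h1 : gradNorm m.N q u = 1) :
    BoundLp q (fun i : Lstar × ↥(Lat ∩ cell m.N) => k i.1) (fun i => m.gradB L (m.bondOf i))
      (((∑' r, k r) / volume unitCell) ^ (q⁻¹).toReal) := by
  have := m.boundLp_low hq0 k (fun s => ‖frob (L s)‖ₑ) (W := 1)
    (fun hq => h1 ▸ m.sum_le_gradNorm hu hq0 hq)
    (fun hq s => by subst hq; exact h1 ▸ m.gradNorm_ge_top hu s)
  rw [mul_one] at this
  convert this using 3 with i t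
  rw [gradB, bondOf_dir]
  rfl

lemma boundLp_coarseB {p : ℝ≥0∞} (hp1 : 1 ≤ p) (k : Lstar → ℝ≥0∞)
    (H : E2 → E2 →L[ℝ] E2 →L[ℝ] E2) :
    BoundLp p (fun i : Lstar × ↥(Lat ∩ cell m.N) => k i.1) (fun i => m.coarseB H (m.bondOf i))
      (((∑' r, k r) / volume unitCell) ^ (p⁻¹).toReal *
        wlp p (fun T : m.Th => volume (tri T.1)) (m.coarse H)) := by
  have hp0 : p ≠ 0 := (one_pos.trans_le hp1).ne'
  refine (m.boundLp_low hp0 k (m.coarse H) (fun hp => (wlp_rpow hp0 hp _ _).ge)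
    (fun hp s => ?_)).average hp1 (fun i => ?_) fun i => ?_
  · subst hp
    refine le_wlp_top (fun T : m.Th => volume (tri T.1)) (m.coarse H) ?_
    rw [← volume_interior_tri]
    exact (isOpen_interior.measure_pos volume (interior_tri_nonempty (m.isBas s))).ne'
  · exact (m.measurable_coarseAt H).comp (by fun_prop)
  · by_cases hb : m.bondOf i ∈ m.bondsC
    · left
      ext t
      rw [coarseB, if_pos hb, bondOf_dir]
      rfl
    · right
      ext t
      rw [coarseB, if_neg hb, bondOf_dir]
      rfl

/-- Unlike the coarsening error, the modelling error depends on r, so the weights stay inside the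
sum over triangles and directions. The factor 2 is the density bound for closed micro-triangles. -/
lemma boundLp_modelB {p : ℝ≥0∞} (hp0 : p ≠ 0) (k : Lstar → ℝ≥0∞)
    (H : E2 → E2 →L[ℝ] E2 →L[ℝ] E2) :
    BoundLp p (fun i : Lstar × ↥(Lat ∩ cell m.N) => k i.1) (fun i => m.modelB H (m.bondOf i))
      (2 ^ (p⁻¹).toReal * wlp p (fun i : m.Tac × Lstar => k i.2)
        (fun i : m.Tac × Lstar => linfHull H (m.omega i.1.1 i.2.1))) := by
  have hmem : ∀ (i : Lstar × ↥(Lat ∩ cell m.N)) (t : ℝ), m.bondOf i ∈ m.bondsC →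
      t ∈ Icc (0 : ℝ) 1 → i.2.1 + t • i.1.1 ∈ interior m.Ωcper := fun i t hb ht => by
    have := hb.2 (bond_segment (b := m.bondOf i) ht)
    rwa [bondOf_dir] at this
  have hval : ∀ (i : Lstar × ↥(Lat ∩ cell m.N)) (t : ℝ), m.modelB H (m.bondOf i) t =
      {t | m.bondOf i ∈ m.bondsC ∧ t ∈ Icc (0 : ℝ) 1}.indicator
        (fun t => m.modelAt H i.1.1 (i.2.1 + t • i.1.1)) t := fun i t => by
    by_cases hb : m.bondOf i ∈ m.bondsC
    · rw [modelB, if_pos hb, bondOf_dir]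
      by_cases ht : t ∈ Icc (0 : ℝ) 1
      · rw [indicator_of_mem ht, indicator_of_mem (show t ∈ {t | _ ∧ _} from ⟨hb, ht⟩)]
        rfl
      · rw [indicator_of_notMem ht, indicator_of_notMem fun h => ht h.2]
    · rw [modelB, if_neg hb, indicator_of_notMem]
      exact fun h => hb h.1
  refine ⟨fun hp => ?_, fun hp i hi => ?_⟩
  · have hpr : 0 < p.toReal := ENNReal.toReal_pos hp0 hp
    rw [rpow_inv_mul_rpow hp0 hp, wlp_rpow hp0 hp, ENNReal.tsum_prod', ENNReal.tsum_prod',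
      ENNReal.tsum_comm (f := fun (τ : m.Tac) (r : Lstar) => _), ← ENNReal.tsum_mul_left]
    refine ENNReal.tsum_le_tsum fun r => ?_
    dsimp only
    rw [ENNReal.tsum_mul_left, ENNReal.tsum_mul_left, mul_left_comm]
    gcongr
    refine le_trans (ENNReal.tsum_le_tsum fun x => lintegral_mono fun t => ?_)
      (m.tsum_lintegral_low_Kc_le (fun τ : m.Tac => linfHull H (m.omega τ.1 r.1) ^ p.toReal) r.2
        (fun x => {t | (x, x + r.1) ∈ m.bondsC ∧ t ∈ Icc (0 : ℝ) 1}) ?_)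
    · rw [hval]
      by_cases ht : t ∈ {t | m.bondOf (r, x) ∈ m.bondsC ∧ t ∈ Icc (0 : ℝ) 1}
      · rw [indicator_of_mem ht, indicator_of_mem (show t ∈ {t | (x.1, x.1 + r.1) ∈ m.bondsC ∧
          t ∈ Icc (0 : ℝ) 1} from ht)]
        exact low_rpow_le _ _ hpr.le _
      · rw [indicator_of_notMem ht, ENNReal.zero_rpow_of_pos hpr]
        exact zero_le
    · rintro x t ⟨hb, ht⟩
      have := hb.2 (bond_segment (b := (x, x + r.1)) ht)
      simpa only [add_sub_cancel_left] using this
  · subst hp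
    refine .of_forall fun t => ?_
    simp only [ENNReal.inv_top, ENNReal.toReal_zero, ENNReal.rpow_zero, one_mul]
    rw [hval]
    by_cases ht : t ∈ {t | m.bondOf i ∈ m.bondsC ∧ t ∈ Icc (0 : ℝ) 1}
    · rw [indicator_of_mem ht]
      obtain ⟨τ, hτ, z, hz, hP⟩ := m.exists_mem_Tac (hmem i t ht.1 ht.2)
      refine (low_le (j := (⟨τ, hτ⟩, ⟨z, hz⟩)) _ hP).trans ?_
      exact le_wlp_top (fun i : m.Tac × Lstar => k i.2)
        (fun i : m.Tac × Lstar => linfHull H (m.omega i.1.1 i.2.1)) (i := (⟨τ, hτ⟩, i.1)) hi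
    · rw [indicator_of_notMem ht]; exact zero_le

end ACMesh


/-! ### The error estimate -/

/-- With a = 1/p and b = 1/p', the factors are the Lipschitz constant √2, the 1/2 of the bond error,
the 2^(1/p) of the bond density and a power of √2, which bounds the inverse cell area. Their product
is exactly √2^(1/p). -/
lemma const_le {a b : ℝ} (ha : 0 ≤ a) (hab : a + b = 1) :
    √2 * (1 / 2) * 2 ^ a * √2 ^ b ≤ (5 / 2 : ℝ) ^ a := by
  have h2 : (0 : ℝ) < √2 := by positivity
  have hsq : √2 * √2 = 2 := Real.mul_self_sqrt (by norm_num)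
  have e1 : (2 : ℝ) ^ a = √2 ^ a * √2 ^ a := by
    rw [← Real.mul_rpow h2.le h2.le, hsq]
  have e2 : √2 ^ a * √2 ^ b = √2 := by rw [← Real.rpow_add h2, hab, Real.rpow_one]
  have e3 : √2 * (1 / 2) * 2 ^ a * √2 ^ b = √2 ^ a := by
    rw [e1]
    calc _ = √2 * (1 / 2) * √2 ^ a * (√2 ^ a * √2 ^ b) := by ring
      _ = √2 * √2 * (1 / 2) * √2 ^ a := by rw [e2]; ring
      _ = _ := by rw [hsq]; ring
  rw [e3]
  refine Real.rpow_le_rpow h2.le ?_ ha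
  rw [Real.sqrt_le_left (by norm_num)]
  norm_num

lemma ennreal_const_le {a b : ℝ} (ha : 0 ≤ a) (hb : 0 ≤ b) (hab : a + b = 1) (S : ℝ≥0∞) :
    ENNReal.ofReal √2 * ENNReal.ofReal (1 / 2) * 2 ^ a * (S / volume unitCell) ^ b ≤
      (5 / 2) ^ a * S ^ b := by
  have hD : S / volume unitCell ≤ ENNReal.ofReal √2 * S := by
    rw [volume_unitCell, mul_comm]
    refine ENNReal.div_le_of_le_mul ?_
    rw [mul_assoc, ← ENNReal.ofReal_mul (by positivity)]
    refine le_mul_of_one_le_right zero_le (ENNReal.one_le_ofReal.2 ?_)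
    -- The inverse cell area 2/√3 is at most √2, because 2 ≤ √6.
    have h6 : √2 * √3 = √6 := by rw [← Real.sqrt_mul (by norm_num)]; norm_num
    have : (2 : ℝ) ≤ √6 := Real.le_sqrt_of_sq_le (by norm_num)
    linarith
  have h2 : (2 : ℝ≥0∞) = ENNReal.ofReal 2 := by simp
  have h5 : (5 / 2 : ℝ≥0∞) = ENNReal.ofReal (5 / 2) := by
    rw [ENNReal.ofReal_div_of_pos two_pos]; simp
  calc _ ≤ ENNReal.ofReal √2 * ENNReal.ofReal (1 / 2) * 2 ^ a * (ENNReal.ofReal √2 * S) ^ b := by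
        gcongr
    _ = ENNReal.ofReal (√2 * (1 / 2) * 2 ^ a * √2 ^ b) * S ^ b := by
        rw [ENNReal.mul_rpow_of_nonneg _ _ hb, h2, ENNReal.ofReal_rpow_of_pos two_pos,
          ENNReal.ofReal_rpow_of_pos (by positivity), ENNReal.ofReal_mul (by positivity),
          ENNReal.ofReal_mul (by positivity), ENNReal.ofReal_mul (by positivity)]
        ring
    _ ≤ _ := by
        rw [h5, ENNReal.ofReal_rpow_of_pos (by norm_num)]
        gcongr
        exact const_le ha hab

lemma toReal_inv_add {p q : ℝ≥0∞} (hpq : p.HolderConjugate q) :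
    (p⁻¹).toReal + (q⁻¹).toReal = 1 := by
  have h : p⁻¹ + q⁻¹ = 1 := by
    have := hpq.inv_add_inv_eq_inv
    rwa [inv_one] at this
  have h1 : p⁻¹ ≠ ⊤ := ne_top_of_le_ne_top ENNReal.one_ne_top (h ▸ le_self_add)
  have h2 : q⁻¹ ≠ ⊤ := ne_top_of_le_ne_top ENNReal.one_ne_top (h ▸ le_add_self)
  rw [← ENNReal.toReal_add h1 h2, h, ENNReal.toReal_one]

lemma one_le_of_conj {p q : ℝ≥0∞} (hpq : p.HolderConjugate q) : 1 ≤ p := by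
  have h : p⁻¹ + q⁻¹ = 1 := by
    have := hpq.inv_add_inv_eq_inv
    rwa [inv_one] at this
  rw [← ENNReal.inv_le_one, ← h]
  exact le_self_add

/-- The constant of the coarsening error, for a given shape regularity. -/
noncomputable def coarseConst (κ : ℝ) : ℝ≥0 :=
  (ENNReal.ofReal √2 * ACMesh.interpConst κ / volume unitCell).toNNReal

lemma coe_coarseConst (κ : ℝ) :
    (coarseConst κ : ℝ≥0∞) = ENNReal.ofReal √2 * ACMesh.interpConst κ / volume unitCell :=
  ENNReal.coe_toNNReal (ENNReal.div_ne_top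
    (ENNReal.mul_ne_top ENNReal.ofReal_ne_top ENNReal.ofReal_ne_top) volume_unitCell_ne_zero)

namespace ACMesh

variable {m : ACMesh} {κ : ℝ} {w : E2 → E2} {H : E2 → E2 →L[ℝ] E2 →L[ℝ] E2} {B : E2 →L[ℝ] E2}

lemma bondBound_eq (m : ACMesh) (κ : ℝ) (H : E2 → E2 →L[ℝ] E2 →L[ℝ] E2)
    (L : m.Th → E2 →L[ℝ] E2) (φ : ℝ → ℝ) (μ : ℝ) (i : Lstar × ↥(Lat ∩ cell m.N)) :
    m.bondBound κ H L (Mk φ 2 (μ * ‖i.1.1‖)) (m.bondOf i) =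
      ENNReal.ofReal √2 * interpConst κ * (Mk φ 2 (μ * ‖i.1.1‖) * ‖i.1.1‖ₑ ^ 2 *
        ∫⁻ t in Icc (0 : ℝ) 1, m.coarseB H (m.bondOf i) t * m.gradB L (m.bondOf i) t) +
      ENNReal.ofReal √2 * ENNReal.ofReal (1 / 2) * (Kr φ μ i.1.1 *
        ∫⁻ t in Icc (0 : ℝ) 1, m.modelB H (m.bondOf i) t * m.gradB L (m.bondOf i) t) := by
  have m3 := m.measurable_gradB L (m.bondOf i)
  have m13 : Measurable fun t => m.coarseB H (m.bondOf i) t * m.gradB L (m.bondOf i) t :=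
    (m.measurable_coarseB H (m.bondOf i)).mul m3
  have m23 : Measurable fun t => m.modelB H (m.bondOf i) t * m.gradB L (m.bondOf i) t :=
    (m.measurable_modelB H (m.bondOf i)).mul m3
  have hn : ENNReal.ofReal (1 / 2 * ‖i.1.1‖ ^ 2) = ENNReal.ofReal (1 / 2) * ‖i.1.1‖ₑ ^ 2 := by
    rw [ENNReal.ofReal_mul (by norm_num), ENNReal.ofReal_pow (norm_nonneg _), ofReal_norm]
  rw [← mul_assoc, ← mul_assoc (ENNReal.ofReal √2 * ENNReal.ofReal (1 / 2)),
    ← lintegral_const_mul _ m13, ← lintegral_const_mul _ m23,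
    ← lintegral_add_left (m13.const_mul _), bondBound, bondOf_dir]
  refine lintegral_congr fun t => ?_
  rw [hn, Kr]
  ring

lemma IsSmooth.error_le (h : m.IsSmooth B w H) (hκ : m.ShapeRegular κ) {φ : ℝ → ℝ}
    (hφ : IsPotential φ) {y : E2 → E2}
    (hy : ∀ x ∈ m.sites, ∀ z ∈ perLat m.N, y (x + z) = y x + B z)
    (hwy : ∀ x ∈ m.sites, w x = y x) {μ : ℝ} (hμ : 0 < μ)
    (h1 : μ ≤ m.muA y) (h2 : μ ≤ m.muA (m.Ih y)) (h3 : μ ≤ m.muC (m.Ih y)) {p q : ℝ≥0∞}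
    (hpq : p.HolderConjugate q) {u : E2 → E2}
    {L : m.Th → E2 →L[ℝ] E2} (hu : IsPA m.K u fun j => L j.1) (hu1 : gradNorm m.N q u = 1) :
    ENNReal.ofReal (firstVar (m.Eac φ) (m.Ih y) u - firstVar (m.Ea φ) y u) ≤
      Ccoarse (coarseConst κ) φ μ * wlp p (fun T : m.Th => volume (tri T.1)) (m.coarse H) +
      Cmodel p q φ μ * wlp p (fun i : m.Tac × Lstar => Kr φ μ i.2.1)
        (fun i : m.Tac × Lstar => linfHull H (m.omega i.1.1 i.2.1)) := by
  have hp1 := one_le_of_conj hpq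
  have hq1 := one_le_of_conj hpq.symm
  have hp0 : p ≠ 0 := (one_pos.trans_le hp1).ne'
  have hq0 : q ≠ 0 := (one_pos.trans_le hq1).ne'
  have hab := toReal_inv_add hpq
  set a := (p⁻¹).toReal with ha
  set b := (q⁻¹).toReal with hb
  have ha0 : 0 ≤ a := ENNReal.toReal_nonneg
  have hb0 : 0 ≤ b := ENNReal.toReal_nonneg
  set k₁ : Lstar → ℝ≥0∞ := fun r => Mk φ 2 (μ * ‖r.1‖) * ‖r.1‖ₑ ^ 2 with hk₁
  set k₂ : Lstar → ℝ≥0∞ := fun r => Kr φ μ r.1 with hk₂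
  set W₁ := wlp p (fun T : m.Th => volume (tri T.1)) (m.coarse H)
  set W₂ := wlp p (fun i : m.Tac × Lstar => Kr φ μ i.2.1)
    (fun i : m.Tac × Lstar => linfHull H (m.omega i.1.1 i.2.1))
  have g1 := holder_bonds hpq (fun i => m.measurable_coarseB H (m.bondOf i))
    (fun i => m.measurable_gradB L (m.bondOf i)) (m.boundLp_coarseB hp1 k₁ H)
    (m.boundLp_gradB hq0 k₁ hu hu1)
  have g2 := holder_bonds hpq (fun i => m.measurable_modelB H (m.bondOf i))
    (fun i => m.measurable_gradB L (m.bondOf i)) (m.boundLp_modelB hp0 k₂ H)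
    (m.boundLp_gradB hq0 k₂ hu hu1)
  have hbond : ∀ i : Lstar × ↥(Lat ∩ cell m.N),
      m.bonds.indicator (fun b => ‖m.bondDiff φ y u b‖ₑ) (i.2.1, i.2.1 + i.1.1) ≤
        m.bondBound κ H L (Mk φ 2 (μ * ‖i.1.1‖)) (m.bondOf i) := by
    intro i
    by_cases hbi : m.bondOf i ∈ m.bonds
    · refine (indicator_of_mem hbi _).le.trans ?_
      rw [← m.bondOf_dir i]
      by_cases hC : m.bondOf i ∈ m.bondsC
      · exact h.bondDiff_le_of_mem hκ hφ hy hwy hμ h1 h3 hu hC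
      · exact h.bondDiff_le_of_notMem hκ hφ hwy hμ h1 h2 hu hbi hC
    · exact (indicator_of_notMem hbi _).le.trans zero_le
  calc _ ≤ _ := m.firstVar_sub_le hφ hy hμ h1 h2 h3 hu
    _ ≤ _ := m.tsum_bonds_le _
    _ ≤ _ := ENNReal.tsum_le_tsum hbond
    _ = ENNReal.ofReal √2 * interpConst κ * (∑' i : Lstar × ↥(Lat ∩ cell m.N), k₁ i.1 *
        ∫⁻ t in Icc (0 : ℝ) 1, m.coarseB H (m.bondOf i) t * m.gradB L (m.bondOf i) t) +
        ENNReal.ofReal √2 * ENNReal.ofReal (1 / 2) * (∑' i : Lstar × ↥(Lat ∩ cell m.N), k₂ i.1 *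
        ∫⁻ t in Icc (0 : ℝ) 1, m.modelB H (m.bondOf i) t * m.gradB L (m.bondOf i) t) := by
        rw [← ENNReal.tsum_mul_left, ← ENNReal.tsum_mul_left, ← ENNReal.tsum_add]
        exact tsum_congr fun i => m.bondBound_eq κ H L φ μ i
    _ ≤ ENNReal.ofReal √2 * interpConst κ *
          (((∑' r, k₁ r) / volume unitCell) ^ a * W₁ * ((∑' r, k₁ r) / volume unitCell) ^ b) +
        ENNReal.ofReal √2 * ENNReal.ofReal (1 / 2) *
          (2 ^ a * W₂ * ((∑' r, k₂ r) / volume unitCell) ^ b) := by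
        gcongr
    _ ≤ _ := by
        -- In the coarsening term both Hölder factors carry the same weight sum, and the exponents
        -- 1/p and 1/q recombine to one. In the modelling term only the power 1/q of the weight sum
        -- is outside the norm.
        refine add_le_add (le_of_eq ?_) ?_
        · rw [mul_right_comm _ W₁, ← ENNReal.rpow_add_of_nonneg _ _ ha0 hb0, hab, ENNReal.rpow_one,
            Ccoarse, coe_coarseConst, div_eq_mul_inv, div_eq_mul_inv]
          ring
        · calc _ = ENNReal.ofReal √2 * ENNReal.ofReal (1 / 2) * 2 ^ a *
                ((∑' r, k₂ r) / volume unitCell) ^ b * W₂ := by ring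
            _ ≤ _ := by
              rw [Cmodel]
              exact mul_le_mul' (ennreal_const_le ha0 hb0 hab _) le_rfl

end ACMesh

lemma ACMesh.IsInterpolant.isSmooth {m : ACMesh} {B : E2 →L[ℝ] E2} {y w : E2 → E2}
    {H : E2 → E2 →L[ℝ] E2 →L[ℝ] E2} (h : m.IsInterpolant B y w H) : m.IsSmooth B w H := by
  obtain ⟨hc, -, hper, G, hG, hH, -, hHb⟩ := h
  obtain ⟨h1, h2⟩ := contDiff_of_weakDeriv hc hG hH hHb
  exact ⟨h1, h2, hHb, hper⟩

end ACVacancy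

theorem theoremB1 (κ : ℝ) :
    ∃ C₁ : ℝ≥0, ∀ (m : ACVacancy.ACMesh), m.ShapeRegular κ →
      ∀ (φ : ℝ → ℝ), ACVacancy.IsPotential φ →
      ∀ (B : ACVacancy.E2 →L[ℝ] ACVacancy.E2), 0 < B.det →
      ∀ (y : ACVacancy.E2 → ACVacancy.E2), m.IsDeformation B y →
      ∀ (μ : ℝ), μ = min (min (m.muA y) (m.muA (m.Ih y)))
          (min (m.muC (m.Ih y)) (m.muC (ACVacancy.microInterp y))) → 0 < μ →
      ∀ (p q : ℝ≥0∞), p.HolderConjugate q →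
      (∀ u ∈ m.Uh, DifferentiableAt ℝ (fun t : ℝ => m.Eac φ (m.Ih y + t • u)) 0 ∧
        DifferentiableAt ℝ (fun t : ℝ => m.Ea φ (y + t • u)) 0) ∧
      ∀ (w : ACVacancy.E2 → ACVacancy.E2)
        (H : ACVacancy.E2 → ACVacancy.E2 →L[ℝ] ACVacancy.E2 →L[ℝ] ACVacancy.E2),
        m.IsInterpolant B y w H →
        m.negNorm q (fun u => ACVacancy.firstVar (m.Eac φ) (m.Ih y) u
            - ACVacancy.firstVar (m.Ea φ) y u) ≤
          ACVacancy.Ccoarse C₁ φ μ *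
              ACVacancy.wlp p (fun T : m.Th => volume (ACVacancy.tri T.1))
                (fun T : m.Th => ENNReal.ofReal (Metric.diam (ACVacancy.tri T.1)) *
                  ACVacancy.linf H (ACVacancy.tri T.1)) +
            ACVacancy.Cmodel p q φ μ *
              ACVacancy.wlp p (fun i : m.Tac × ACVacancy.Lstar => ACVacancy.Kr φ μ i.2.1)
                (fun i : m.Tac × ACVacancy.Lstar =>
                  ACVacancy.linfHull H (m.omega i.1.1 i.2.1)) := by
  -- The constant is √2 times 2/sin(π/(3κ)) divided by the area of the unit cell; it involves
  -- neither p nor the mesh.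
  refine ⟨ACVacancy.coarseConst κ, fun m hκ φ hφ B _ y hy μ hμ hμ0 p q hpq => ?_⟩
  have h1 : μ ≤ m.muA y := hμ ▸ (min_le_left _ _).trans (min_le_left _ _)
  have h2 : μ ≤ m.muA (m.Ih y) := hμ ▸ (min_le_left _ _).trans (min_le_right _ _)
  have h3 : μ ≤ m.muC (m.Ih y) := hμ ▸ (min_le_right _ _).trans (min_le_left _ _)
  refine ⟨fun u hu => ?_, fun w H hw => ?_⟩
  · obtain ⟨L, hL⟩ := m.Uh_isPA hu
    exact ⟨(m.hasDerivAt_Eac hφ hy.1 hμ0 h2 h3 hL).1.differentiableAt,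
      (m.hasDerivAt_Ea hφ hμ0 h1 hL).1.differentiableAt⟩
  · refine iSup_le fun u => iSup_le fun hu => iSup_le fun hu1 => ?_
    obtain ⟨L, hL⟩ := m.Uh_isPA hu
    exact hw.isSmooth.error_le hκ hφ hy.1 hw.2.1 hμ0 h1 h2 h3 hpq hL hu1
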